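/- Let $M$ be a compact oriented smooth $6$-manifold (without boundary), let $H$ be a closed $3$-form on $M$, and let $d_H\alpha=d\alpha+H\wedge\alpha$ for forms $\alpha$ of mixed degree; $d_H$ maps $\Omega^{ev}(M)$ to $\Omega^{od}(M)$ and vice versa, and $d_H^2=0$. For a real oriented $6$-dimensional vector space $V$, let $v+\xi\in V\oplus V^*$ act on $\Lambda^*V^*$ by $(v+\xi)\cdot\varphi=\iota(v)\varphi+\xi\wedge\varphi$, and let $\langle\varphi,\psi\rangle=(\sigma\varphi\wedge\psi)_6\in\Lambda^6V^*$, where $\sigma$ multiplies the components of degree $2m$ and $2m+1$ by $(-1)^m$. After a choice of a positive volume form $\mathrm{vol}\in\Lambda^6V^*$, which identifies $\Lambda^{ev/od}V^*$ with the real half-spin representations $S^\pm$ of $\mathfrak{so}(V\oplus V^*)$ (inner product $(v+\xi,v+\xi)=-\langle v,\xi\rangle$) and $\Lambda^6V^*$ with $\mathbf R$, let $\mu(\rho)\in\mathfrak{so}(V\oplus V^*)$ be the moment map, defined by $\mathrm{tr}(\mu(\rho)a)=\frac12\langle a\cdot\rho,\rho\rangle$ for all $a\in\mathfrak{so}(V\oplus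 V^*)$, where $a\cdot\rho$ denotes the spin representation, and let $q(\rho)=\mathrm{tr}\,\mu(\rho)^2$. An even or odd form $\rho$ on $V$ is stable if $q(\rho)<0$; then $\phi(\rho)=\sqrt{-q(\rho)/3}\;\mathrm{vol}\in\Lambda^6V^*$ does not depend on the choice of $\mathrm{vol}$, and there is a unique real form $\hat\rho$ of the same parity such that $\rho+i\hat\rho=2\psi$, where $\psi\in\Lambda^*V^*\otimes\mathbf C$ is a pure spinor (its annihilator in $(V\oplus V^*)\otimes\mathbf C$ has complex dimension $6$) and $-i\langle\psi,\bar\psi\rangle$ is positive. A form $\rho\in\Omega^{ev}(M)$ or $\Omega^{od}(M)$ is called stable if it is stable at every point of $M$, and then $V(\rho)=\int_M\phi(\rho)$. Theorem. Let $\rho\in\Omega^{ev}(M)$ (respectively $\Omega^{od}(M)$) be stable with $d_H\rho=0$. Then $\rho$ is a critical point of $V$ in its $d_H$-cohomology class, i.e. $\frac{d}{dt}\big|_{t=0}V(\rho+t\,d_H\alpha)=0$ for all $\alpha\in\Omega^{od}(M)$ (respectively $\Omega^{ev}(M)$), if and only if $d_H\hat\rho=0$ (where $\hat\rho$ is again a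 smooth form). -/

import Mathlib

open scoped Manifold ContDiff

noncomputable section

namespace GenCY

/-! ### Linear algebra of mixed forms on `ℝ⁶` -/

/-- The model vector space `V = ℝ⁶`; the tangent spaces of a 6-manifold modelled on `V` are
copies of it. -/
abbrev V6 : Type := EuclideanSpace ℝ (Fin 6)

/-- The standard basis vector `e_i` of `V`. -/
def stdVec (i : Fin 6) : V6 := EuclideanSpace.single i (1 : ℝ)

/-- The dual basis covector `e^i`. -/
def stdCovec (i : Fin 6) : V6 →L[ℝ] ℝ := EuclideanSpace.proj i

theorem sum_stdVec (v : V6) : v = ∑ i, v i • stdVec i := by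
  have h := ((EuclideanSpace.basisFun (Fin 6) ℝ).sum_repr v).symm
  simpa [stdVec] using h

/-- Every multilinear map on `V` is continuous. -/
theorem continuous_multilinear {A : Type*} [NormedAddCommGroup A] [NormedSpace ℝ A] {n : ℕ}
    (f : MultilinearMap ℝ (fun _ : Fin n => V6) A) : Continuous f := by
  have h : (f : (Fin n → V6) → A) =
      fun v => ∑ r : Fin n → Fin 6, (∏ i, v i (r i)) • f (fun i => stdVec (r i)) := by
    funext v
    conv_lhs => rw [show v = fun i => ∑ j, v i j • stdVec j from funext fun i => sum_stdVec (v i)]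
    rw [MultilinearMap.map_sum]
    exact Finset.sum_congr rfl fun r _ => by rw [MultilinearMap.map_smul_univ]
  rw [h]
  refine continuous_finsetSum _ fun r _ => Continuous.smul ?_ continuous_const
  refine continuous_finsetProd _ fun i _ => ?_
  exact (EuclideanSpace.proj (r i) : V6 →L[ℝ] ℝ).continuous.comp (continuous_apply i)

/-- An alternating map on `V`, regarded as a continuous alternating map. -/
def toCont {A : Type*} [NormedAddCommGroup A] [NormedSpace ℝ A] {n : ℕ}
    (f : V6 [⋀^Fin n]→ₗ[ℝ] A) : V6 [⋀^Fin n]→L[ℝ] A :=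
  { f with cont := continuous_multilinear f.toMultilinearMap }

/-- The exterior product `a ∧ b` of a `k`-form and an `l`-form (sum over `(k,l)`-shuffles),
regarded as an `n`-form for `n = k + l`. -/
def wedge {A : Type} [NormedCommRing A] [NormedAlgebra ℝ A] {k l n : ℕ} (h : k + l = n)
    (a : V6 [⋀^Fin k]→L[ℝ] A) (b : V6 [⋀^Fin l]→L[ℝ] A) : V6 [⋀^Fin n]→L[ℝ] A :=
  toCont (AlternatingMap.domDomCongr (finSumFinEquiv.trans (finCongr h))
    ((LinearMap.mul' ℝ A).compAlternatingMap
      (AlternatingMap.domCoprod a.toAlternatingMap b.toAlternatingMap)))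

/-- `Λ*V* ⊗ A`, for `A = ℝ` or `ℂ`: forms of mixed degree. (The components of degree `> 6` vanish
automatically.) -/
abbrev Mixed (A : Type) [NormedCommRing A] [NormedAlgebra ℝ A] : Type := (k : ℕ) → V6 [⋀^Fin k]→L[ℝ] A

/-- The exterior product of a `k`-form and a form of mixed degree. -/
def wedgeMixed {A : Type} [NormedCommRing A] [NormedAlgebra ℝ A] {k : ℕ} (a : V6 [⋀^Fin k]→L[ℝ] A) (φ : Mixed A) : Mixed A :=
  fun n => if h : k ≤ n then wedge (Nat.add_sub_of_le h) a (φ (n - k)) else 0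

/-- The interior product `ι(v)φ`, for `v ∈ V ⊗ A = A⁶`. -/
def contract {A : Type} [NormedCommRing A] [NormedAlgebra ℝ A] (v : EuclideanSpace A (Fin 6)) (φ : Mixed A) : Mixed A :=
  fun n => ∑ i, v i • (φ (n + 1)).curryLeft (stdVec i)

/-- `(V ⊕ V*) ⊗ A`, where `V* ⊗ A` is the space of real-linear maps `V → A`. -/
abbrev W (A : Type) [NormedCommRing A] [NormedAlgebra ℝ A] : Type := EuclideanSpace A (Fin 6) × (V6 →L[ℝ] A)

/-- The action of `v + ξ ∈ V ⊕ V*` on forms: `(v + ξ)·φ = ι(v)φ + ξ ∧ φ`. -/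
def cliff {A : Type} [NormedCommRing A] [NormedAlgebra ℝ A] (w : W A) (φ : Mixed A) : Mixed A :=
  contract w.1 φ + wedgeMixed (ContinuousAlternatingMap.ofSubsingleton ℝ V6 A (0 : Fin 1) w.2) φ

/-- A form of mixed degree is even (`p = 0`) or odd (`p = 1`). -/
def HasParity {A : Type} [NormedCommRing A] [NormedAlgebra ℝ A] (p : ZMod 2) (φ : Mixed A) : Prop :=
  ∀ k : ℕ, (k : ZMod 2) ≠ p → φ k = 0

/-- The bilinear form `⟨φ, ψ⟩ = (σφ ∧ ψ)₆`, where `σ` multiplies the components of degree `2m` and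
`2m + 1` by `(-1)^m`. It takes values in `Λ⁶V* ⊗ A`, which is identified with `A` by evaluation on
the standard basis of `V = ℝ⁶`. -/
def pairing {A : Type} [NormedCommRing A] [NormedAlgebra ℝ A] (φ ψ : Mixed A) : A :=
  (∑ k : Fin 7, (-1 : A) ^ ((k : ℕ) / 2) •
    wedge (Nat.add_sub_of_le (Nat.lt_succ_iff.mp k.isLt)) (φ k) (ψ (6 - k))) stdVec

/-! #### The quartic invariant -/

/-- The indefinite inner product on `V ⊕ V*`, the polarization of `(v + ξ, v + ξ) = -⟨v, ξ⟩`. -/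
def innerW (x y : W ℝ) : ℝ := -(x.2 y.1 + y.2 x.1) / 2

/-- `a ∈ 𝔰𝔬(V ⊕ V*)`. -/
def IsSo (a : Module.End ℝ (W ℝ)) : Prop := ∀ x y : W ℝ, innerW (a x) y + innerW x (a y) = 0

/-- The spin representation of `𝔰𝔬(V ⊕ V*)`: the element `a` acts as the Clifford element
`½ ∑ᵢ ((a eᵢ) eⁱ + (a eⁱ) eᵢ)`. The half-density factor `(Λ⁶V)^{1/2}` is trivialized by the standard
basis of `V`. For `a = T ∈ End V` this is `(tr T)/2` minus the derivation defined by `T`; it is the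
representation for which the commutator of `spin a` with the action of `x ∈ V ⊕ V*` is the action of
`a x`. -/
def spin (a : Module.End ℝ (W ℝ)) (φ : Mixed ℝ) : Mixed ℝ :=
  (1 / 2 : ℝ) • ∑ i : Fin 6,
    (cliff (a (stdVec i, 0)) (cliff (0, stdCovec i) φ) +
      cliff (a (0, stdCovec i)) (cliff (stdVec i, 0) φ))

/-- `X` is the value at `ρ` of the moment map `μ(ρ)(a) = ½⟨σ(a)ρ, ρ⟩` of the spin representation,
`𝔰𝔬(V ⊕ V*)` being identified with its dual by `tr(XY)`. -/
def IsMoment (ρ : Mixed ℝ) (X : Module.End ℝ (W ℝ)) : Prop :=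
  IsSo X ∧ ∀ a : Module.End ℝ (W ℝ), IsSo a →
    LinearMap.trace ℝ (W ℝ) (X * a) = (1 / 2 : ℝ) * pairing (spin a ρ) ρ

/-- The moment map `μ(ρ) ∈ 𝔰𝔬(V ⊕ V*)`: the unique `X` with `IsMoment ρ X`. -/
def moment (ρ : Mixed ℝ) : Module.End ℝ (W ℝ) := Classical.epsilon (IsMoment ρ)

/-- The quartic invariant `q(ρ) = tr μ(ρ)²`. -/
def quartic (ρ : Mixed ℝ) : ℝ := LinearMap.trace ℝ (W ℝ) (moment ρ * moment ρ)

/-- The standard volume form `e¹ ∧ ⋯ ∧ e⁶` of `V = ℝ⁶`. -/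
def stdVol : V6 [⋀^Fin 6]→L[ℝ] ℝ := toCont (EuclideanSpace.basisFun (Fin 6) ℝ).toBasis.det

/-- The volume form `φ(ρ) = √(-q(ρ)/3) ∈ Λ⁶V*` (of interest where `q(ρ) < 0`). -/
def phi (ρ : Mixed ℝ) : V6 [⋀^Fin 6]→L[ℝ] ℝ := Real.sqrt (-quartic ρ / 3) • stdVol

/-! #### Pure spinors and the form `ρ̂` -/

open scoped TensorProduct in
theorem mul_summand {A : Type} [NormedCommRing A] [NormedAlgebra ℝ A] {k l : ℕ}
    (a : V6 [⋀^Fin k]→ₗ[ℝ] A) (b : V6 [⋀^Fin l]→ₗ[ℝ] A) (σ : Equiv.Perm (Fin k ⊕ Fin l))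
    (v : Fin k ⊕ Fin l → V6) :
    LinearMap.mul' ℝ A (AlternatingMap.domCoprod.summand a b (Quotient.mk'' σ) v) =
      (Equiv.Perm.sign σ : ℤ) •
        (a (fun i => v (σ (Sum.inl i))) * b (fun i => v (σ (Sum.inr i)))) := by
  change LinearMap.mul' ℝ A ((Equiv.Perm.sign σ : ℤ) •
    (a (fun i => v (σ (Sum.inl i))) ⊗ₜ[ℝ] b (fun i => v (σ (Sum.inr i))))) = _
  rw [map_zsmul, LinearMap.mul'_apply]

theorem wedge_apply {A : Type} [NormedCommRing A] [NormedAlgebra ℝ A] {k l n : ℕ} (h : k + l = n)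
    (a : V6 [⋀^Fin k]→L[ℝ] A) (b : V6 [⋀^Fin l]→L[ℝ] A) (v : Fin n → V6) :
    wedge h a b v = ∑ σ : Equiv.Perm.ModSumCongr (Fin k) (Fin l), LinearMap.mul' ℝ A
      (AlternatingMap.domCoprod.summand a.toAlternatingMap b.toAlternatingMap σ
        (fun i => v (finCongr h (finSumFinEquiv i)))) := by
  change (LinearMap.mul' ℝ A) (AlternatingMap.domCoprod _ _ _) = _
  rw [AlternatingMap.domCoprod_apply, sum_apply, map_sum]
  rfl

theorem wedge_smul_left {A : Type} [NormedCommRing A] [NormedAlgebra ℝ A] {k l n : ℕ} (h : k + l = n) (c : A)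
    (a : V6 [⋀^Fin k]→L[ℝ] A) (b : V6 [⋀^Fin l]→L[ℝ] A) :
    wedge h (c • a) b = c • wedge h a b := by
  ext v
  change _ = c • wedge h a b v
  rw [wedge_apply, wedge_apply, Finset.smul_sum]
  refine Finset.sum_congr rfl fun σ _ => ?_
  induction σ using Quotient.inductionOn' with | h σ => ?_
  rw [mul_summand, mul_summand, smul_comm c]
  congr 1
  exact mul_assoc _ _ _

theorem wedge_add_left {A : Type} [NormedCommRing A] [NormedAlgebra ℝ A] {k l n : ℕ} (h : k + l = n)
    (a a' : V6 [⋀^Fin k]→L[ℝ] A) (b : V6 [⋀^Fin l]→L[ℝ] A) :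
    wedge h (a + a') b = wedge h a b + wedge h a' b := by
  ext v
  change _ = wedge h a b v + wedge h a' b v
  rw [wedge_apply, wedge_apply, wedge_apply, ← Finset.sum_add_distrib]
  refine Finset.sum_congr rfl fun σ _ => ?_
  induction σ using Quotient.inductionOn' with | h σ => ?_
  rw [mul_summand, mul_summand, mul_summand, ← smul_add]
  congr 1
  exact add_mul _ _ _

theorem cliff_add {A : Type} [NormedCommRing A] [NormedAlgebra ℝ A] (w w' : W A) (φ : Mixed A) :
    cliff (w + w') φ = cliff w φ + cliff w' φ := by
  funext n
  ext v
  simp only [cliff, contract, wedgeMixed, Pi.add_apply, Prod.fst_add, Prod.snd_add,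
    PiLp.add_apply]
  have : ContinuousAlternatingMap.ofSubsingleton ℝ V6 A (0 : Fin 1) (w.2 + w'.2) = 
     ContinuousAlternatingMap.ofSubsingleton ℝ V6 A (0 : Fin 1) w.2 + ContinuousAlternatingMap.ofSubsingleton ℝ V6 A (0 : Fin 1) w'.2 := by ext; simp
  rw [this]
  split_ifs
  · rw [wedge_add_left]
    simp [add_mul, Finset.sum_add_distrib]
    ring
  · simp [add_mul, Finset.sum_add_distrib]

theorem cliff_smul {A : Type} [NormedCommRing A] [NormedAlgebra ℝ A] (c : A) (w : W A) (φ : Mixed A) :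
    cliff (c • w) φ = c • cliff w φ := by
  funext n
  ext v
  simp only [cliff, contract, wedgeMixed, Pi.add_apply, Pi.smul_apply, Prod.smul_fst, Prod.smul_snd,
    PiLp.smul_apply]
  have : ContinuousAlternatingMap.ofSubsingleton ℝ V6 A (0 : Fin 1) (c • w.2) = 
     c • ContinuousAlternatingMap.ofSubsingleton ℝ V6 A (0 : Fin 1) w.2 := by ext; simp
  rw [this]
  split_ifs
  · rw [wedge_smul_left]
    simp [mul_assoc, Finset.mul_sum]
  · simp [mul_assoc, Finset.mul_sum]

/-- The annihilator `E_ψ = {w ∈ (V ⊕ V*) ⊗ A : w·ψ = 0}` of a spinor. -/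
def annihilator {A : Type} [NormedCommRing A] [NormedAlgebra ℝ A] (ψ : Mixed A) :
    Submodule A (W A) where
  carrier := {w | cliff w ψ = 0}
  add_mem' {w w'} hw hw' := by
    change cliff (w + w') ψ = 0
    rw [cliff_add, show cliff w ψ = 0 from hw, show cliff w' ψ = 0 from hw', add_zero]
  zero_mem' := by
    change cliff (0 : W A) ψ = 0
    rw [← zero_smul A (0 : W A), cliff_smul]
    exact @zero_smul A (Mixed A) _ _ _ _
  smul_mem' c w hw := by
    change cliff (c • w) ψ = 0
    rw [cliff_smul, show cliff w ψ = 0 from hw]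
    exact @smul_zero A (Mixed A) _ _ c

/-- A complex pure spinor: its annihilator (which is always isotropic) has complex dimension
`dim V`. -/
def IsPure (ψ : Mixed ℂ) : Prop := Module.finrank ℂ (annihilator ψ) = 6

/-- The complex form `α + iβ`. -/
def toComplex (α β : Mixed ℝ) : Mixed ℂ := fun k =>
  Complex.ofRealCLM.compContinuousAlternatingMap (α k) +
    Complex.I • Complex.ofRealCLM.compContinuousAlternatingMap (β k)

/-- `χ = ρ̂`: the form `χ` has the parity of `ρ` and `ρ + iχ = 2ψ`, where `ψ` is a pure spinor
such that `-i⟨ψ, ψ̄⟩` is positive. (In particular `ρ = ψ + ψ̄`.) -/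
def IsHat (ρ χ : Mixed ℝ) : Prop :=
  (∀ p : ZMod 2, HasParity p ρ → HasParity p χ) ∧
    IsPure ((1 / 2 : ℂ) • toComplex ρ χ) ∧
    ∃ r : ℝ, 0 < r ∧
      pairing ((1 / 2 : ℂ) • toComplex ρ χ) ((1 / 2 : ℂ) • toComplex ρ (-χ)) = Complex.I * r

/-- The form `ρ̂`: the unique `χ` with `IsHat ρ χ` (for `ρ` even or odd with `q(ρ) < 0`). -/
def hat (ρ : Mixed ℝ) : Mixed ℝ := Classical.epsilon (IsHat ρ)

/-! ### Differential forms on a 6-manifold -/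

/-- The atlas of `M` is oriented: all changes of charts have positive Jacobian. Then the standard
orientations of the tangent spaces, which are identified with `ℝ⁶` by the charts, define an
orientation of `M`. -/
def OrientedAtlas (M : Type*) [TopologicalSpace M] [ChartedSpace V6 M] : Prop :=
  ∀ e ∈ atlas V6 M, ∀ e' ∈ atlas V6 M, ∀ y ∈ (e.symm ≫ₕ e').source,
    0 < (fderiv ℝ (e.symm ≫ₕ e') y).det

section Forms

variable {M : Type*} [TopologicalSpace M] [ChartedSpace V6 M]

/-- `k`-forms on `M` (without smoothness). -/
abbrev Form (M : Type*) [TopologicalSpace M] [ChartedSpace V6 M] (k : ℕ) : Type _ :=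
  (x : M) → TangentSpace (𝓡 6) x [⋀^Fin k]→L[ℝ] ℝ

/-- Forms of mixed degree on `M` (without smoothness). Note that `TangentSpace (𝓡 6) x` is by
definition the model space `V6`, through the preferred chart at `x`. -/
abbrev MixedForm (M : Type*) [TopologicalSpace M] [ChartedSpace V6 M] : Type _ := M → Mixed ℝ

/-- The component of degree `k` of a form of mixed degree. -/
def MixedForm.comp (ρ : MixedForm M) (k : ℕ) : Form M k := fun x => ρ x k

/-- The expression of a form in the chart at `x₀`: its pullback by the inverse of the chart. -/
def chartRep {k : ℕ} (η : Form M k) (x₀ : M) (y : V6) : V6 [⋀^Fin k]→L[ℝ] ℝ :=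
  (η ((extChartAt (𝓡 6) x₀).symm y)).compContinuousLinearMap
    (mfderiv 𝓘(ℝ, V6) (𝓡 6) (extChartAt (𝓡 6) x₀).symm y)

/-- Smooth forms. -/
def IsSmooth {k : ℕ} (η : Form M k) : Prop :=
  ∀ x₀ : M, ContDiffOn ℝ ∞ (chartRep η x₀) (extChartAt (𝓡 6) x₀).target

/-- The exterior derivative, computed at `x` in the chart at `x`. -/
def extD {k : ℕ} (η : Form M k) : Form M (k + 1) := fun x =>
  (extDeriv (chartRep η x) (extChartAt (𝓡 6) x x)).compContinuousLinearMap
    (mfderiv (𝓡 6) 𝓘(ℝ, V6) (extChartAt (𝓡 6) x) x)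

/-- Smooth forms of mixed degree. -/
def IsSmoothMixed (ρ : MixedForm M) : Prop := ∀ k : ℕ, IsSmooth (ρ.comp k)

/-- The exterior derivative of a form of mixed degree. -/
def extDMixed (ρ : MixedForm M) : MixedForm M := fun x k =>
  match k with
  | 0 => 0
  | k + 1 => extD (ρ.comp k) x

/-- The twisted differential `d_H α = dα + H ∧ α`. -/
def twistedD (H : Form M 3) (α : MixedForm M) : MixedForm M := fun x =>
  extDMixed α x + wedgeMixed (H x : V6 [⋀^Fin 3]→L[ℝ] ℝ) (α x)

/-- `ρ ∈ Ω^{ev}(M)` (`p = 0`) or `ρ ∈ Ω^{od}(M)` (`p = 1`): smooth forms of parity `p`. -/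
def IsOmega (p : ZMod 2) (ρ : MixedForm M) : Prop :=
  IsSmoothMixed ρ ∧ ∀ x, HasParity p (ρ x)

/-- A stable form: at each point it lies in the open set `q < 0`. -/
def IsStable (ρ : MixedForm M) : Prop := ∀ x, quartic (ρ x) < 0

/-- The form `ρ̂` on `M`. -/
def hatForm (ρ : MixedForm M) : MixedForm M := fun x => hat (ρ x)

variable [IsManifold (𝓡 6) ∞ M] [CompactSpace M] [T2Space M]

/-- A smooth partition of unity subordinate to the cover of `M` by the domains of the charts. -/
def chartPartition (M : Type*) [TopologicalSpace M] [ChartedSpace V6 M] [IsManifold (𝓡 6) ∞ M]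
    [CompactSpace M] [T2Space M] : SmoothPartitionOfUnity M (𝓡 6) M Set.univ :=
  (SmoothPartitionOfUnity.exists_isSubordinate_chartAt_source (𝓡 6) M).choose

/-- The integral of a 6-form over a compact manifold with oriented atlas, by means of a partition of
unity. The sum is finite, since `M` is compact. -/
def integral (η : Form M 6) : ℝ :=
  ∑ᶠ i : M, ∫ y in (extChartAt (𝓡 6) i).target,
    chartPartition M i ((extChartAt (𝓡 6) i).symm y) * chartRep η i y stdVec

/-- The volume functional `V(ρ) = ∫_M φ(ρ)`. -/
def volumeFunctional (ρ : MixedForm M) : ℝ := integral (M := M) fun x => phi (ρ x)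

/-- `ρ` (of parity `p`) is a critical point of the volume functional in its `d_H`-cohomology class
`{ρ + d_H α}`, where `α` runs over the smooth forms of the opposite parity: the first variation of
the functional in each direction `d_H α` exists and vanishes. -/
def IsCriticalInClass (H : Form M 3) (p : ZMod 2) (ρ : MixedForm M) : Prop :=
  ∀ α : MixedForm M, IsOmega (p + 1) α →
    HasDerivAt (fun t : ℝ => volumeFunctional (ρ + t • twistedD H α)) 0 0

end Forms

end GenCY

end

noncomputable section
namespace GenCY

/-! ### Bilinearity of the exterior product and its formula as a sum over all permutations -/

section Wedge

variable {A : Type} [NormedCommRing A] [NormedAlgebra ℝ A]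

/-! The first variation of the volume is `δV = ½ ∫ ⟨ρ̂, δρ⟩`. For `δρ = d_H α` Stokes' theorem turns
it into `-½ ∫ ⟨d_H ρ̂, α⟩`, because `d` and `H ∧ ·` are both skew for the integrated pairing. This
vanishes for all `α` of the parity opposite to `ρ` exactly when `d_H ρ̂ = 0`: the form `d_H ρ̂` has
that same parity, and the pairing is nondegenerate on forms of a given parity.

The pointwise input is an explicit formula for `ρ̂`. Write `g` for `gW`, so that the Clifford
relation is `xy + yx = g(x, y)`. Clifford multiplication is self-adjoint for the pairing, which is
skew-symmetric, and the moment map is `g(μ x, y) = ¼⟨x·y·ρ, ρ⟩`. A Fierz identity (`fierz`), applied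
to `ρ` and `w·ρ`, gives `w·(μ·ρ) = -3 (μ w)·ρ` (`cl_cub`), and hence `μ² = q/12` (`mom_mom`). If `q
< 0`, then `J = μ / √(-q/12)` is a complex structure on `V ⊕ V*`, and `ρ̂ = -μ·ρ / (3√(-q/12))`
satisfies `w·ρ̂ = (J w)·ρ`. So the annihilator of `ρ + iρ̂` is `{J y + i y}`, of complex dimension
six, and `⟨ρ̂, ρ⟩ > 0`. Conversely, any solution `χ` of the defining conditions yields a skew `K`
with `K² = -1` that commutes with `μ` and turns out to be a positive multiple of it; so `K = J` and
`χ = ρ̂` (`eq_hatE_of_skew`, `hat_eq`). The formula shows that `ρ̂` is smooth and equivariant under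
orientation-preserving linear maps. Since `dq(σ) = 2⟨μ·ρ, σ⟩`, the derivative of `√(-q/3)` is `½⟨ρ̂,
σ⟩` (`hasDerivAt_sqrt_quartic`).

The Fierz identity is verified on the constant form `1` and carried to all degrees by the Clifford
elements `e_i + e^i`, whose conjugation exchanges `e_i` with `e^i` up to signs on the remaining
basis.

On the manifold everything is expressed in charts. The volume is differentiated under the integral
on the compact supports of the partition functions (`hasDerivAt_volumeFunctional`). Stokes' theorem
(`prInt_twistedD`) follows from `d = ∑ e^i ∂_i`, the self-adjointness of `e^i`, and the skewness of
exterior multiplication by a 3-form. Nondegeneracy (`eq_zero_of_prInt`) uses test forms supported in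
a single chart. -/

theorem wedge_smul_right {k l n : ℕ} (h : k + l = n) (c : A)
    (a : V6 [⋀^Fin k]→L[ℝ] A) (b : V6 [⋀^Fin l]→L[ℝ] A) :
    wedge h a (c • b) = c • wedge h a b := by
  ext v
  change _ = c • wedge h a b v
  rw [wedge_apply, wedge_apply, Finset.smul_sum]
  refine Finset.sum_congr rfl fun σ _ => ?_
  induction σ using Quotient.inductionOn' with | h σ => ?_
  rw [mul_summand, mul_summand, smul_comm c]
  congr 1
  exact mul_left_comm _ _ _

theorem wedge_add_right {k l n : ℕ} (h : k + l = n)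
    (a : V6 [⋀^Fin k]→L[ℝ] A) (b b' : V6 [⋀^Fin l]→L[ℝ] A) :
    wedge h a (b + b') = wedge h a b + wedge h a b' := by
  ext v
  change _ = wedge h a b v + wedge h a b' v
  rw [wedge_apply, wedge_apply, wedge_apply, ← Finset.sum_add_distrib]
  refine Finset.sum_congr rfl fun σ _ => ?_
  induction σ using Quotient.inductionOn' with | h σ => ?_
  rw [mul_summand, mul_summand, mul_summand, ← smul_add]
  congr 1
  exact mul_add _ _ _

@[simp] theorem wedge_zero_left {k l n : ℕ} (h : k + l = n) (b : V6 [⋀^Fin l]→L[ℝ] A) :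
    wedge h (0 : V6 [⋀^Fin k]→L[ℝ] A) b = 0 := by
  have := wedge_add_left h (0 : V6 [⋀^Fin k]→L[ℝ] A) 0 b
  simpa using this

@[simp] theorem wedge_zero_right {k l n : ℕ} (h : k + l = n) (a : V6 [⋀^Fin k]→L[ℝ] A) :
    wedge h a (0 : V6 [⋀^Fin l]→L[ℝ] A) = 0 := by
  have := wedge_add_right h a (0 : V6 [⋀^Fin l]→L[ℝ] A) 0
  simpa using this

/-- The wedge product as an alternating sum over all permutations. -/
theorem factorial_smul_wedge_apply {k l n : ℕ} (h : k + l = n)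
    (a : V6 [⋀^Fin k]→L[ℝ] A) (b : V6 [⋀^Fin l]→L[ℝ] A) (v : Fin n → V6) :
    (k.factorial * l.factorial) • wedge h a b v =
      ∑ σ : Equiv.Perm (Fin n), (Equiv.Perm.sign σ : ℤ) •
        (a (fun i => v (σ (Fin.cast h (Fin.castAdd l i)))) *
          b (fun j => v (σ (Fin.cast h (Fin.natAdd k j))))) := by
  subst h
  have h1 := congrArg (fun f => LinearMap.mul' ℝ A (f (fun i => v (finSumFinEquiv i))))
    (MultilinearMap.domCoprod_alternization_eq a.toAlternatingMap b.toAlternatingMap)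
  simp only [Fintype.card_fin] at h1
  have h2 : (k.factorial * l.factorial) • wedge rfl a b v = LinearMap.mul' ℝ A
      (((k.factorial * l.factorial) • AlternatingMap.domCoprod a.toAlternatingMap
        b.toAlternatingMap) (fun i => v (finSumFinEquiv i))) := by
    rw [AlternatingMap.smul_apply, map_nsmul]
    rfl
  rw [h2, ← h1, MultilinearMap.alternatization_apply, map_sum]
  refine Fintype.sum_equiv (Equiv.permCongr finSumFinEquiv) _ _ fun σ => ?_
  rw [Equiv.Perm.sign_permCongr, Units.smul_def, map_zsmul]
  congr 1
  simp only [MultilinearMap.domDomCongr_apply, MultilinearMap.domCoprod_apply,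
    LinearMap.mul'_apply]
  simp [Equiv.permCongr_apply]

end Wedge

/-- Sum over permutations of `Fin (n+1)`, decomposed by the preimage of `0`. -/
theorem sum_perm_succ {X Y : Type*} [AddCommGroup X] {n : ℕ} (m : (Fin (n + 1) → Y) → X)
    (x : Y) (v : Fin n → Y) :
    ∑ σ : Equiv.Perm (Fin (n + 1)),
        (Equiv.Perm.sign σ : ℤ) • m (fun i => (Fin.cons x v : Fin (n + 1) → Y) (σ i)) =
      ∑ p : Fin (n + 1), (-1 : ℤ) ^ (p : ℕ) • ∑ e : Equiv.Perm (Fin n),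
        (Equiv.Perm.sign e : ℤ) • m (p.insertNth x (fun i => v (e i))) := by
  simp only [Finset.smul_sum]
  rw [← Fintype.sum_prod_type']
  symm
  -- A permutation is determined by the position `p` that it sends to `0` and the permutation it
  -- induces on the rest. `p.cycleRange` carries `p` to `0` without changing the order of the
  -- others, and has sign `(-1)^p`.
  let F : Fin (n + 1) × Equiv.Perm (Fin n) → Equiv.Perm (Fin (n + 1)) := fun q =>
    (Equiv.Perm.decomposeFin.symm (0, q.2)) * q.1.cycleRange
  have hF0 : ∀ q i, F q i = 0 ↔ i = q.1 := by
    intro q i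
    constructor
    · intro hi
      have : Equiv.Perm.decomposeFin.symm (0, q.2) (q.1.cycleRange i) =
        Equiv.Perm.decomposeFin.symm (0, q.2) (q.1.cycleRange q.1) := by
        rw [Fin.cycleRange_self]
        simpa [F] using hi
      exact q.1.cycleRange.injective ((Equiv.Perm.decomposeFin.symm (0, q.2)).injective this)
    · rintro rfl
      simp [F]
  have hinj : Function.Injective F := by
    rintro ⟨p, e⟩ ⟨p', e'⟩ hq
    have hp : p = p' := (hF0 (p', e') p).1 (by rw [← hq]; exact (hF0 (p, e) p).2 rfl)
    subst hp
    have := mul_right_cancel hq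
    simpa using this
  have hcard : Fintype.card (Fin (n + 1) × Equiv.Perm (Fin n)) =
      Fintype.card (Equiv.Perm (Fin (n + 1))) := by
    simp [Fintype.card_perm, Nat.factorial_succ]
  have hbij : Function.Bijective F := (Fintype.bijective_iff_injective_and_card F).2 ⟨hinj, hcard⟩
  refine Fintype.sum_bijective F hbij _ _ ?_
  rintro ⟨p, e⟩
  have hs : (Equiv.Perm.sign (F (p, e)) : ℤ) = (-1) ^ (p : ℕ) * (Equiv.Perm.sign e : ℤ) := by
    simp [F, Fin.sign_cycleRange, Equiv.Perm.decomposeFin.symm_sign, mul_comm]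
  rw [hs, mul_smul]
  congr 3
  rw [← Fin.cons_comp_cycleRange]
  funext i
  simp only [Function.comp, F, Equiv.Perm.mul_apply]
  refine Fin.cases ?_ (fun j => ?_) (p.cycleRange i)
  · simp
  · simp

end GenCY
end

noncomputable section
namespace GenCY

/-! ### Insertion of a vector into one of two blocks of arguments -/

section Shuffle

variable {Y : Type*} {k l n : ℕ}

/-- Inserting `x` at a position in one of the two blocks of a list of length `k + l` is an insertion
in that block and leaves the other block as it was. The four cases let each permutation in the
exterior product be read as a contraction of one factor only. -/
theorem insertNth_castAdd_left (h : k + 1 + l = n + 1) (h' : k + l = n) (q : Fin (k + 1)) (x : Y)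
    (w : Fin n → Y) (i : Fin (k + 1)) :
    (Fin.cast h (Fin.castAdd l q)).insertNth (α := fun _ => Y) x w (Fin.cast h (Fin.castAdd l i)) =
      q.insertNth (α := fun _ => Y) x (fun i => w (Fin.cast h' (Fin.castAdd l i))) i := by
  rcases eq_or_ne i q with rfl | hi
  · simp
  obtain ⟨i, rfl⟩ := Fin.exists_succAbove_eq hi
  rw [Fin.insertNth_apply_succAbove]
  have : Fin.cast h (Fin.castAdd l (q.succAbove i)) =
      (Fin.cast h (Fin.castAdd l q)).succAbove (Fin.cast h' (Fin.castAdd l i)) := by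
    ext
    simp only [Fin.succAbove, Fin.lt_def, Fin.val_castSucc, Fin.val_cast, Fin.val_castAdd]
    split_ifs <;> simp
  rw [this, Fin.insertNth_apply_succAbove]

theorem insertNth_castAdd_right (h : k + 1 + l = n + 1) (h' : k + l = n) (q : Fin (k + 1)) (x : Y)
    (w : Fin n → Y) (j : Fin l) :
    (Fin.cast h (Fin.castAdd l q)).insertNth (α := fun _ => Y) x w
      (Fin.cast h (Fin.natAdd (k + 1) j)) = w (Fin.cast h' (Fin.natAdd k j)) := by
  have : Fin.cast h (Fin.natAdd (k + 1) j) =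
      (Fin.cast h (Fin.castAdd l q)).succAbove (Fin.cast h' (Fin.natAdd k j)) := by
    ext
    simp only [Fin.succAbove, Fin.lt_def, Fin.val_castSucc, Fin.val_cast, Fin.val_castAdd,
      Fin.val_natAdd]
    have := q.isLt
    split_ifs <;> simp <;> omega
  rw [this, Fin.insertNth_apply_succAbove]

theorem insertNth_natAdd_left (h : k + (l + 1) = n + 1) (h' : k + l = n) (r : Fin (l + 1)) (x : Y)
    (w : Fin n → Y) (i : Fin k) :
    (Fin.cast h (Fin.natAdd k r)).insertNth (α := fun _ => Y) x w
      (Fin.cast h (Fin.castAdd (l + 1) i)) = w (Fin.cast h' (Fin.castAdd l i)) := by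
  have : Fin.cast h (Fin.castAdd (l + 1) i) =
      (Fin.cast h (Fin.natAdd k r)).succAbove (Fin.cast h' (Fin.castAdd l i)) := by
    ext
    simp only [Fin.succAbove, Fin.lt_def, Fin.val_castSucc, Fin.val_cast, Fin.val_castAdd,
      Fin.val_natAdd]
    have := i.isLt
    split_ifs <;> simp
    omega
  rw [this, Fin.insertNth_apply_succAbove]

theorem insertNth_natAdd_right (h : k + (l + 1) = n + 1) (h' : k + l = n) (r : Fin (l + 1)) (x : Y)
    (w : Fin n → Y) (j : Fin (l + 1)) :
    (Fin.cast h (Fin.natAdd k r)).insertNth (α := fun _ => Y) x w (Fin.cast h (Fin.natAdd k j)) =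
      r.insertNth (α := fun _ => Y) x (fun i => w (Fin.cast h' (Fin.natAdd k i))) j := by
  rcases eq_or_ne j r with rfl | hi
  · simp
  obtain ⟨j, rfl⟩ := Fin.exists_succAbove_eq hi
  rw [Fin.insertNth_apply_succAbove]
  have : Fin.cast h (Fin.natAdd k (r.succAbove j)) =
      (Fin.cast h (Fin.natAdd k r)).succAbove (Fin.cast h' (Fin.natAdd k j)) := by
    ext
    simp only [Fin.succAbove, Fin.lt_def, Fin.val_castSucc, Fin.val_cast, Fin.val_natAdd]
    split_ifs <;> simp <;> omega
  rw [this, Fin.insertNth_apply_succAbove]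

theorem sum_cast_add {X : Type*} [AddCommMonoid X] {k l n : ℕ} (h : k + l = n) (f : Fin n → X) :
    ∑ p, f p = ∑ q : Fin k, f (Fin.cast h (Fin.castAdd l q)) +
      ∑ r : Fin l, f (Fin.cast h (Fin.natAdd k r)) := by
  subst h
  exact Fin.sum_univ_add f

end Shuffle

/-! ### Contraction is an antiderivation of the exterior product -/

section Derivation

variable {k l n : ℕ}

/-- The alternating sum in the wedge product, restricted to the permutations placing the first
vector at the position `p`. -/
def wedgePart (h : k + l = n + 1) (a : V6 [⋀^Fin k]→L[ℝ] ℝ) (b : V6 [⋀^Fin l]→L[ℝ] ℝ) (x : V6)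
    (v : Fin n → V6) (p : Fin (n + 1)) : ℝ :=
  (-1 : ℤ) ^ (p : ℕ) • ∑ e : Equiv.Perm (Fin n), (Equiv.Perm.sign e : ℤ) •
    (a (fun i => p.insertNth (α := fun _ => V6) x (fun i => v (e i))
        (Fin.cast h (Fin.castAdd l i))) *
      b (fun j => p.insertNth (α := fun _ => V6) x (fun i => v (e i))
        (Fin.cast h (Fin.natAdd k j))))

/-- The permutations are sorted by the argument that receives `x`: one of the `k` arguments of `a`
or one of the `l` arguments of `b`. -/
theorem factorial_smul_wedge_cons (h : k + l = n + 1) (a : V6 [⋀^Fin k]→L[ℝ] ℝ)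
    (b : V6 [⋀^Fin l]→L[ℝ] ℝ) (x : V6) (v : Fin n → V6) :
    (k.factorial * l.factorial) • wedge h a b (Fin.cons x v) =
      ∑ q : Fin k, wedgePart h a b x v (Fin.cast h (Fin.castAdd l q)) +
        ∑ r : Fin l, wedgePart h a b x v (Fin.cast h (Fin.natAdd k r)) := by
  rw [factorial_smul_wedge_apply, ← sum_cast_add h (wedgePart h a b x v)]
  exact sum_perm_succ (fun w : Fin (n + 1) → V6 => a (fun i => w (Fin.cast h (Fin.castAdd l i))) *
          b (fun j => w (Fin.cast h (Fin.natAdd k j)))) x v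

/-- Moving `x` to the front of the arguments of `a` costs `(-1)^q`, which cancels the sign in
`wedgePart`; so every position in the left block contributes the same amount. -/
theorem wedgePart_left (h : k + 1 + l = n + 1) (h' : k + l = n) (a : V6 [⋀^Fin (k + 1)]→L[ℝ] ℝ)
    (b : V6 [⋀^Fin l]→L[ℝ] ℝ) (x : V6) (v : Fin n → V6) (q : Fin (k + 1)) :
    wedgePart h a b x v (Fin.cast h (Fin.castAdd l q)) =
      (k.factorial * l.factorial) • wedge h' (a.curryLeft x) b v := by
  rw [factorial_smul_wedge_apply, wedgePart, Finset.smul_sum]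
  refine Finset.sum_congr rfl fun e _ => ?_
  rw [smul_comm]
  congr 1
  simp only [insertNth_castAdd_left h h', insertNth_castAdd_right h h']
  rw [← smul_mul_assoc]
  congr 1
  exact AlternatingMap.neg_one_pow_smul_map_insertNth a.toAlternatingMap q x
    (fun i => v (e (Fin.cast h' (Fin.castAdd l i))))

/-- The sign of the position `k + r` splits: `(-1)^r` brings `x` to the front of the arguments of
`b`, and `(-1)^k` remains. -/
theorem wedgePart_right (h : k + (l + 1) = n + 1) (h' : k + l = n) (a : V6 [⋀^Fin k]→L[ℝ] ℝ)
    (b : V6 [⋀^Fin (l + 1)]→L[ℝ] ℝ) (x : V6) (v : Fin n → V6) (r : Fin (l + 1)) :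
    wedgePart h a b x v (Fin.cast h (Fin.natAdd k r)) =
      (-1 : ℝ) ^ k * ((k.factorial * l.factorial) • wedge h' a (b.curryLeft x) v) := by
  rw [factorial_smul_wedge_apply, wedgePart, Finset.smul_sum, Finset.mul_sum]
  refine Finset.sum_congr rfl fun e _ => ?_
  rw [smul_comm, mul_smul_comm]
  congr 1
  simp only [insertNth_natAdd_left h h', insertNth_natAdd_right h h']
  have h1 : (-1 : ℤ) ^ (r : ℕ) • b (r.insertNth (α := fun _ => V6) x
      (fun i => v (e (Fin.cast h' (Fin.natAdd k i))))) =
      b.curryLeft x (fun i => v (e (Fin.cast h' (Fin.natAdd k i)))) :=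
    AlternatingMap.neg_one_pow_smul_map_insertNth b.toAlternatingMap r x _
  rw [← h1, zsmul_eq_mul, zsmul_eq_mul]
  simp only [Fin.val_cast, Fin.val_natAdd, pow_add]
  push_cast
  change (-1 : ℝ) ^ k * (-1) ^ (r : ℕ) * (_ * b (r.insertNth (α := fun _ => V6) x _)) = _
  ring

/-- The `k + 1` equal left terms and the `l + 1` equal right terms supply exactly the factors that
complete the smaller factorials to `(k + 1)! (l + 1)!`. Factors of degree zero have no contraction
and are treated separately below. -/
theorem curryLeft_wedge_succ_succ (h : k + 1 + (l + 1) = n + 1) (a : V6 [⋀^Fin (k + 1)]→L[ℝ] ℝ)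
    (b : V6 [⋀^Fin (l + 1)]→L[ℝ] ℝ) (x : V6) :
    (wedge h a b).curryLeft x = wedge (by omega) (a.curryLeft x) b +
      (-1 : ℝ) ^ (k + 1) • wedge (by omega : k + 1 + l = n) a (b.curryLeft x) := by
  ext v
  have h1 := factorial_smul_wedge_cons h a b x v
  simp only [wedgePart_left h (by omega : k + (l + 1) = n),
    wedgePart_right h (by omega : k + 1 + l = n)] at h1
  simp only [Finset.sum_const, Finset.card_univ, Fintype.card_fin, nsmul_eq_mul,
    Nat.factorial_succ k, Nat.factorial_succ l, Nat.cast_mul] at h1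
  change wedge h a b (Fin.cons x v) = wedge _ (a.curryLeft x) b v +
    (-1 : ℝ) ^ (k + 1) * wedge _ a (b.curryLeft x) v
  have hk : (((k + 1 : ℕ) : ℝ) * (k.factorial : ℝ) * (((l + 1 : ℕ) : ℝ) * (l.factorial : ℝ))) ≠ 0 := by
    positivity
  apply mul_left_cancel₀ hk
  rw [h1]
  ring

theorem curryLeft_wedge_succ_zero (h : k + 1 + 0 = n + 1) (a : V6 [⋀^Fin (k + 1)]→L[ℝ] ℝ)
    (b : V6 [⋀^Fin 0]→L[ℝ] ℝ) (x : V6) :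
    (wedge h a b).curryLeft x = wedge (by omega) (a.curryLeft x) b := by
  ext v
  have h1 := factorial_smul_wedge_cons h a b x v
  simp only [wedgePart_left h (by omega : k + 0 = n)] at h1
  simp only [Finset.sum_const, Finset.card_univ, Fintype.card_fin, nsmul_eq_mul,
    Nat.factorial_succ k, Nat.cast_mul] at h1
  change wedge h a b (Fin.cons x v) = wedge _ (a.curryLeft x) b v
  have hk : (((k + 1 : ℕ) : ℝ) * (k.factorial : ℝ) * (Nat.factorial 0 : ℝ)) ≠ 0 := by
    positivity
  apply mul_left_cancel₀ hk
  rw [h1]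
  simp
  ring

theorem curryLeft_wedge_zero_succ (h : 0 + (l + 1) = n + 1) (a : V6 [⋀^Fin 0]→L[ℝ] ℝ)
    (b : V6 [⋀^Fin (l + 1)]→L[ℝ] ℝ) (x : V6) :
    (wedge h a b).curryLeft x = wedge (by omega) a (b.curryLeft x) := by
  ext v
  have h1 := factorial_smul_wedge_cons h a b x v
  simp only [wedgePart_right h (by omega : 0 + l = n)] at h1
  simp only [Finset.sum_const, Finset.card_univ, Fintype.card_fin, nsmul_eq_mul,
    Nat.factorial_succ l, Nat.cast_mul] at h1
  change wedge h a b (Fin.cons x v) = wedge _ a (b.curryLeft x) v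
  have hk : ((Nat.factorial 0 : ℝ) * (((l + 1 : ℕ) : ℝ) * (l.factorial : ℝ))) ≠ 0 := by
    positivity
  apply mul_left_cancel₀ hk
  rw [h1]
  simp
  ring

/-- A form of positive degree is determined by its contractions. -/
theorem ext_curryLeft {A : Type} [NormedCommRing A] [NormedAlgebra ℝ A]
    {a b : V6 [⋀^Fin (n + 1)]→L[ℝ] A} (h : ∀ x, a.curryLeft x = b.curryLeft x) : a = b := by
  ext v
  have := congrArg (fun f => f (Fin.tail v)) (h (v 0))
  change a (Fin.cons (v 0) (Fin.tail v)) = b (Fin.cons (v 0) (Fin.tail v)) at this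
  rwa [Fin.cons_self_tail] at this

theorem wedge_zero_zero (h : 0 + 0 = n) (a b : V6 [⋀^Fin 0]→L[ℝ] ℝ) (v : Fin n → V6) :
    wedge h a b v = a ![] * b ![] := by
  have h1 := factorial_smul_wedge_apply h a b v
  subst h
  simpa [Subsingleton.elim (fun i : Fin 0 => _) ![]] using h1

/-- Wedging with a `0`-form is scalar multiplication. -/
theorem wedge_zero_left_eq (h : 0 + l = l) (a : V6 [⋀^Fin 0]→L[ℝ] ℝ) (b : V6 [⋀^Fin l]→L[ℝ] ℝ) :
    wedge h a b = a ![] • b := by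
  induction l with
  | zero =>
    ext v
    rw [wedge_zero_zero]
    change _ = a ![] * b v
    rw [Subsingleton.elim v ![]]
  | succ l ih =>
    refine ext_curryLeft fun x => ?_
    rw [curryLeft_wedge_zero_succ, ih (by omega)]
    rfl

theorem wedge_zero_right_eq (h : k + 0 = k) (a : V6 [⋀^Fin k]→L[ℝ] ℝ) (b : V6 [⋀^Fin 0]→L[ℝ] ℝ) :
    wedge h a b = b ![] • a := by
  induction k with
  | zero =>
    ext v
    rw [wedge_zero_zero]
    change _ = b ![] * a v
    rw [Subsingleton.elim v ![], mul_comm]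
  | succ l ih =>
    refine ext_curryLeft fun x => ?_
    rw [curryLeft_wedge_succ_zero, ih (by omega)]
    rfl

end Derivation

end GenCY
end

noncomputable section
namespace GenCY

/-! ### The Clifford action of `V ⊕ V*` and the number operator -/

section MixedForms

/-- The Clifford action of `V ⊕ V*` on real mixed forms, as a bilinear map. -/
def cl : W ℝ →ₗ[ℝ] Mixed ℝ →ₗ[ℝ] Mixed ℝ :=
  LinearMap.mk₂ ℝ cliff cliff_add cliff_smul
    (fun w φ ψ => by
      funext n
      simp only [cliff, contract, wedgeMixed, Pi.add_apply]
      split_ifs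
      · rw [wedge_add_right]
        simp only [ContinuousAlternatingMap.curryLeft_add, _root_.add_apply, smul_add,
          Finset.sum_add_distrib]
        abel
      · simp only [ContinuousAlternatingMap.curryLeft_add, _root_.add_apply, smul_add,
          Finset.sum_add_distrib]
        abel)
    (fun c w φ => by
      funext n
      simp only [cliff, contract, wedgeMixed, Pi.add_apply, Pi.smul_apply]
      split_ifs
      · rw [wedge_smul_right]
        simp only [ContinuousAlternatingMap.curryLeft_smul, _root_.smul_apply,
          smul_comm _ c, Finset.smul_sum, smul_add]
      · simp only [ContinuousAlternatingMap.curryLeft_smul, _root_.smul_apply,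
          smul_comm _ c, Finset.smul_sum, smul_add, smul_zero])

theorem cl_apply (w : W ℝ) (φ : Mixed ℝ) : cl w φ = cliff w φ := rfl

/-- Contraction with a vector. -/
abbrev ann (v : V6) : Mixed ℝ →ₗ[ℝ] Mixed ℝ := cl (v, 0)

/-- Exterior multiplication by a covector. -/
abbrev cre (ξ : V6 →L[ℝ] ℝ) : Mixed ℝ →ₗ[ℝ] Mixed ℝ := cl (0, ξ)

theorem cl_eq (w : W ℝ) (φ : Mixed ℝ) : cl w φ = ann w.1 φ + cre w.2 φ := by
  rw [← LinearMap.add_apply, ← map_add]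
  simp

theorem wedgeMixed_apply {A : Type} [NormedCommRing A] [NormedAlgebra ℝ A] {k l n : ℕ}
    (h : k + l = n) (a : V6 [⋀^Fin k]→L[ℝ] A) (φ : Mixed A) :
    wedgeMixed a φ n = wedge h a (φ l) := by
  obtain rfl : l = n - k := by omega
  rw [wedgeMixed, dif_pos (by omega)]

theorem wedgeMixed_apply_of_lt {A : Type} [NormedCommRing A] [NormedAlgebra ℝ A] {k n : ℕ}
    (h : n < k) (a : V6 [⋀^Fin k]→L[ℝ] A) (φ : Mixed A) : wedgeMixed a φ n = 0 := by
  rw [wedgeMixed, dif_neg (by omega)]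

theorem ann_apply (v : V6) (φ : Mixed ℝ) (n : ℕ) : ann v φ n = (φ (n + 1)).curryLeft v := by
  have h0 : ContinuousAlternatingMap.ofSubsingleton ℝ V6 ℝ (0 : Fin 1) (0 : V6 →L[ℝ] ℝ) = 0 := by
    ext; simp
  rw [cl_apply, cliff, Pi.add_apply, contract, h0]
  have : wedgeMixed (0 : V6 [⋀^Fin 1]→L[ℝ] ℝ) φ n = 0 := by
    rw [wedgeMixed]; split_ifs <;> simp
  rw [this, add_zero]
  conv_rhs => rw [sum_stdVec v, map_sum]
  simp only [map_smul]

theorem cre_eq (ξ : V6 →L[ℝ] ℝ) (φ : Mixed ℝ) :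
    cre ξ φ = wedgeMixed (ContinuousAlternatingMap.ofSubsingleton ℝ V6 ℝ (0 : Fin 1) ξ) φ := by
  rw [cl_apply, cliff]
  have : contract (0 : V6) φ = 0 := by
    funext n
    simp [contract]
  rw [this, zero_add]

theorem cre_zero (ξ : V6 →L[ℝ] ℝ) (φ : Mixed ℝ) : cre ξ φ 0 = 0 := by
  rw [cre_eq, wedgeMixed_apply_of_lt (by omega)]

theorem cre_succ (ξ : V6 →L[ℝ] ℝ) (φ : Mixed ℝ) (n : ℕ) :
    cre ξ φ (n + 1) = wedge (add_comm 1 n)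
      (ContinuousAlternatingMap.ofSubsingleton ℝ V6 ℝ (0 : Fin 1) ξ) (φ n) := by
  rw [cre_eq, wedgeMixed_apply]

/-- Two mixed forms agree if their scalar parts and all contractions agree. -/
theorem mixed_ext_succ {φ ψ : Mixed ℝ} {n : ℕ} (h : ∀ v, ann v φ n = ann v ψ n) :
    φ (n + 1) = ψ (n + 1) := by
  refine ext_curryLeft fun v => ?_
  rw [← ann_apply, ← ann_apply, h]

/-- Polarization of `ι(v)² = 0`. -/
theorem ann_ann (v w : V6) (φ : Mixed ℝ) : ann v (ann w φ) + ann w (ann v φ) = 0 := by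
  have h : ∀ v φ, ann v (ann v φ) = 0 := fun v φ => by
    funext n
    rw [ann_apply, ann_apply, ContinuousAlternatingMap.curryLeft_same]
    rfl
  have h1 := h (v + w) φ
  have h2 : ann (v + w) = ann v + ann w := by
    rw [← map_add]; simp
  rw [h2] at h1
  simp only [LinearMap.add_apply, map_add, h, zero_add, add_zero] at h1
  rwa [add_comm] at h1

theorem curryLeft_ofSubsingleton (ξ : V6 →L[ℝ] ℝ) (v : V6) :
    ((ContinuousAlternatingMap.ofSubsingleton ℝ V6 ℝ (0 : Fin 1) ξ).curryLeft v) ![] = ξ v := by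
  simp

theorem ann_cre (v : V6) (ξ : V6 →L[ℝ] ℝ) (φ : Mixed ℝ) :
    ann v (cre ξ φ) + cre ξ (ann v φ) = ξ v • φ := by
  funext n
  rw [Pi.add_apply, Pi.smul_apply, ann_apply, cre_succ]
  cases n with
  | zero =>
    rw [cre_zero, add_zero, curryLeft_wedge_succ_zero (k := 0) (n := 0), wedge_zero_left_eq,
      curryLeft_ofSubsingleton]
  | succ n =>
    rw [cre_succ, curryLeft_wedge_succ_succ (k := 0) (n := n + 1), wedge_zero_left_eq,
      curryLeft_ofSubsingleton, ann_apply]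
    simp

/-- A component of positive degree is determined by its contractions. Moving `ann v` through both
products by `ann_cre`, the scalar terms cancel and the same anticommutator remains, applied to `ann
v φ` in one degree less. -/
theorem cre_cre (ξ η : V6 →L[ℝ] ℝ) (φ : Mixed ℝ) : cre ξ (cre η φ) + cre η (cre ξ φ) = 0 := by
  funext n
  induction n generalizing φ with
  | zero => rw [Pi.add_apply, cre_zero, cre_zero, add_zero]; rfl
  | succ n ih =>
    refine mixed_ext_succ fun v => ?_
    have e1 : ∀ ζ χ, ann v (cre ζ χ) = ζ v • χ - cre ζ (ann v χ) := fun ζ χ =>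
      eq_sub_of_add_eq (ann_cre v ζ χ)
    rw [map_add, e1, e1, e1, e1, map_zero]
    simp only [map_sub, map_smul]
    rw [← ih (ann v φ)]
    refine congrFun ?_ n
    module

/-- The polarized quadratic form of the Clifford relations; it is `-2` times `innerW`. -/
def gW : W ℝ →ₗ[ℝ] W ℝ →ₗ[ℝ] ℝ :=
  LinearMap.mk₂ ℝ (fun x y => x.2 y.1 + y.2 x.1)
    (fun x x' y => by
      simp only [Prod.fst_add, Prod.snd_add, _root_.add_apply, map_add]; ring)
    (fun c x y => by
      simp only [Prod.smul_fst, Prod.smul_snd, _root_.smul_apply, map_smul,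
        smul_eq_mul]; ring)
    (fun x x' y => by
      simp only [Prod.fst_add, Prod.snd_add, _root_.add_apply, map_add]; ring)
    (fun c x y => by
      simp only [Prod.smul_fst, Prod.smul_snd, _root_.smul_apply, map_smul,
        smul_eq_mul]; ring)

theorem gW_apply (x y : W ℝ) : gW x y = x.2 y.1 + y.2 x.1 := rfl

theorem gW_comm (x y : W ℝ) : gW x y = gW y x := by
  rw [gW_apply, gW_apply, add_comm]

theorem innerW_eq (x y : W ℝ) : innerW x y = -gW x y / 2 := rfl

/-- The Clifford relations. -/
theorem cl_cl (x y : W ℝ) (φ : Mixed ℝ) : cl x (cl y φ) + cl y (cl x φ) = gW x y • φ := by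
  simp only [cl_eq x, cl_eq y, map_add]
  have h1 := ann_ann x.1 y.1 φ
  have h2 := cre_cre x.2 y.2 φ
  have h3 := ann_cre x.1 y.2 φ
  have h4 := ann_cre y.1 x.2 φ
  rw [gW_apply, add_smul, ← h3, ← h4]
  linear_combination (norm := module) h1 + h2

theorem cl_cl_swap (x y : W ℝ) (φ : Mixed ℝ) : cl x (cl y φ) = gW x y • φ - cl y (cl x φ) :=
  eq_sub_of_add_eq (cl_cl x y φ)

/-- The contraction operators of the standard basis. -/
abbrev anni (i : Fin 6) : Mixed ℝ →ₗ[ℝ] Mixed ℝ := ann (stdVec i)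

/-- Exterior multiplication by the standard covectors. -/
abbrev crei (i : Fin 6) : Mixed ℝ →ₗ[ℝ] Mixed ℝ := cre (stdCovec i)

theorem stdCovec_apply (i : Fin 6) (v : V6) : stdCovec i v = v i := rfl

theorem stdCovec_stdVec (i j : Fin 6) : stdCovec i (stdVec j) = if i = j then 1 else 0 := by
  rw [stdCovec_apply, stdVec]
  simp

theorem ann_sum (v : V6) (φ : Mixed ℝ) : ann v φ = ∑ i, v i • anni i φ := by
  conv_lhs => rw [sum_stdVec v]
  have : ((∑ i, v i • stdVec i, 0) : W ℝ) = ∑ i, v i • ((stdVec i, 0) : W ℝ) := by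
    ext <;> simp [Prod.fst_sum, Prod.snd_sum]
  rw [ann, this, map_sum, LinearMap.sum_apply]
  simp only [map_smul, LinearMap.smul_apply]

/-- The number operator. -/
theorem sum_cre_ann (φ : Mixed ℝ) (n : ℕ) : (∑ i, crei i (anni i φ)) n = (n : ℝ) • φ n := by
  induction n generalizing φ with
  | zero =>
    rw [Finset.sum_apply]
    simp [cre_zero]
  | succ n ih =>
    refine mixed_ext_succ (ψ := ((n + 1 : ℕ) : ℝ) • φ) fun v => ?_
    rw [map_sum, map_smul]
    have e1 : ∀ i, ann v (crei i (anni i φ)) = v i • anni i φ + crei i (anni i (ann v φ)) := by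
      intro i
      rw [eq_sub_of_add_eq (ann_cre v (stdCovec i) _), eq_neg_of_add_eq_zero_left (ann_ann v _ φ),
        map_neg, sub_neg_eq_add]
      rfl
    simp only [e1, Finset.sum_add_distrib, ← ann_sum]
    rw [Pi.add_apply, ih, Pi.smul_apply]
    push_cast
    rw [add_smul, one_smul, add_comm]

/-- The six relations `e_i e^i + e^i e_i = 1` add up to `6`, so the opposite ordering of the number
operator counts the missing degrees. In degree below six it exhibits a form as a combination of
contractions, which drives the inductions for the pairing. -/
theorem sum_ann_cre (φ : Mixed ℝ) (n : ℕ) :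
    (∑ i, anni i (crei i φ)) n = (6 - n : ℝ) • φ n := by
  have e1 : ∀ i, anni i (crei i φ) = φ - crei i (anni i φ) := by
    intro i
    rw [eq_sub_of_add_eq (ann_cre (stdVec i) (stdCovec i) φ), stdCovec_stdVec, if_pos rfl, one_smul]
  simp only [e1, Finset.sum_sub_distrib]
  rw [Pi.sub_apply, sum_cre_ann, sub_smul]
  simp only [Finset.sum_const, Finset.card_univ, Fintype.card_fin, Pi.smul_apply]
  congr 1
  exact (Nat.cast_smul_eq_nsmul ℝ 6 (φ n)).symm

theorem form_eq_zero_of_lt {n : ℕ} (hn : 6 < n) (a : V6 [⋀^Fin n]→L[ℝ] ℝ) : a = 0 := by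
  ext v
  refine AlternatingMap.map_linearDependent a.toAlternatingMap v fun h => ?_
  have := h.fintype_card_le_finrank
  simp at this
  omega

/-- `φ` is homogeneous of degree `k`. -/
def Hom (k : ℕ) (φ : Mixed ℝ) : Prop := ∀ j, j ≠ k → φ j = 0

/-- The homogeneous component of degree `k`, as a mixed form. -/
def homPart (k : ℕ) (φ : Mixed ℝ) : Mixed ℝ := Pi.single k (φ k)

theorem hom_homPart (k : ℕ) (φ : Mixed ℝ) : Hom k (homPart k φ) := fun j hj => by
  simp [homPart, hj]

theorem homPart_self (k : ℕ) (φ : Mixed ℝ) : homPart k φ k = φ k := by simp [homPart]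

theorem sum_homPart (φ : Mixed ℝ) : φ = ∑ k ∈ Finset.range 7, homPart k φ := by
  funext n
  rw [Finset.sum_apply]
  by_cases hn : n < 7
  · rw [Finset.sum_eq_single n]
    · rw [homPart_self]
    · intro b _ hb
      exact hom_homPart b φ n hb.symm
    · simp [hn]
  · rw [form_eq_zero_of_lt (by omega) (φ n), Finset.sum_eq_zero]
    intro k _
    exact form_eq_zero_of_lt (by omega) _

theorem Hom.ann {k : ℕ} {φ : Mixed ℝ} (h : Hom (k + 1) φ) (v : V6) : Hom k (ann v φ) := by
  intro j hj
  rw [ann_apply, h (j + 1) (by omega)]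
  simp

theorem Hom.ann_zero {φ : Mixed ℝ} (h : Hom 0 φ) (v : V6) : GenCY.ann v φ = 0 := by
  funext j
  rw [ann_apply, h (j + 1) (by omega)]
  simp

theorem Hom.cre {k : ℕ} {φ : Mixed ℝ} (h : Hom k φ) (ξ : V6 →L[ℝ] ℝ) : Hom (k + 1) (cre ξ φ) := by
  intro j hj
  cases j with
  | zero => exact cre_zero _ _
  | succ j => rw [cre_succ, h j (by omega)]; simp

theorem Hom.sum_ann_cre {k : ℕ} {φ : Mixed ℝ} (h : Hom k φ) :
    ∑ i, anni i (crei i φ) = (6 - k : ℝ) • φ := by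
  funext n
  rw [GenCY.sum_ann_cre, Pi.smul_apply]
  by_cases hn : n = k
  · rw [hn]
  · rw [h n hn, smul_zero, smul_zero]

theorem Hom.sum_cre_ann {k : ℕ} {φ : Mixed ℝ} (h : Hom k φ) :
    ∑ i, crei i (anni i φ) = (k : ℝ) • φ := by
  funext n
  rw [GenCY.sum_cre_ann, Pi.smul_apply]
  by_cases hn : n = k
  · rw [hn]
  · rw [h n hn, smul_zero, smul_zero]

theorem HasParity.cl {p : ZMod 2} {φ : Mixed ℝ} (h : HasParity p φ) (x : W ℝ) :
    HasParity (p + 1) (cl x φ) := by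
  intro k hk
  rw [cl_eq, Pi.add_apply, ann_apply, h (k + 1) (by
    push_cast
    intro e
    apply hk
    rw [← e, add_assoc, CharTwo.add_self_eq_zero, add_zero])]
  cases k with
  | zero => rw [cre_zero]; simp
  | succ k => rw [cre_succ, h k (by
      intro e; apply hk; rw [← e]; push_cast; rfl)]; simp

end MixedForms

end GenCY
end

noncomputable section
namespace GenCY

/-! ### The pairing: self-adjointness of the Clifford action, skewness, nondegeneracy -/

section Pairing

theorem pairing_eq_sum {A : Type} [NormedCommRing A] [NormedAlgebra ℝ A] (φ ψ : Mixed A) :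
    pairing φ ψ = ∑ k : Fin 7, (-1 : A) ^ ((k : ℕ) / 2) *
      wedge (Nat.add_sub_of_le (Nat.lt_succ_iff.mp k.isLt)) (φ k) (ψ (6 - k)) stdVec := by
  rw [pairing, ContinuousAlternatingMap.sum_apply]
  rfl

/-- The pairing of real mixed forms, as a bilinear form. -/
def pr : Mixed ℝ →ₗ[ℝ] Mixed ℝ →ₗ[ℝ] ℝ :=
  LinearMap.mk₂ ℝ pairing
    (fun φ φ' ψ => by
      simp only [pairing_eq_sum, Pi.add_apply, wedge_add_left, ← Finset.sum_add_distrib, ← mul_add]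
      rfl)
    (fun c φ ψ => by
      simp only [pairing_eq_sum, Pi.smul_apply, wedge_smul_left, Finset.smul_sum]
      exact Finset.sum_congr rfl fun k _ => mul_left_comm _ _ _)
    (fun φ ψ ψ' => by
      simp only [pairing_eq_sum, Pi.add_apply, wedge_add_right, ← Finset.sum_add_distrib, ← mul_add]
      rfl)
    (fun c φ ψ => by
      simp only [pairing_eq_sum, Pi.smul_apply, wedge_smul_right, Finset.smul_sum]
      exact Finset.sum_congr rfl fun k _ => mul_left_comm _ _ _)

theorem pr_apply (φ ψ : Mixed ℝ) : pr φ ψ = pairing φ ψ := rfl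

theorem pr_of_hom {k l : ℕ} (h : k + l = 6) {φ : Mixed ℝ} (hφ : Hom k φ) (ψ : Mixed ℝ) :
    pr φ ψ = (-1) ^ (k / 2) * wedge h (φ k) (ψ l) stdVec := by
  obtain rfl : l = 6 - k := by omega
  rw [pr_apply, pairing_eq_sum, Finset.sum_eq_single (⟨k, by omega⟩ : Fin 7)]
  · intro b _ hb
    rw [hφ b (fun e => hb (Fin.ext e)), wedge_zero_left]
    simp
  · simp

theorem pr_hom_eq_zero {k l : ℕ} (h : k + l ≠ 6) {φ ψ : Mixed ℝ} (hφ : Hom k φ) (hψ : Hom l ψ) :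
    pr φ ψ = 0 := by
  rw [pr_apply, pairing_eq_sum, Finset.sum_eq_zero]
  intro b _
  by_cases hb : (b : ℕ) = k
  · rw [hψ (6 - b) (by omega), wedge_zero_right]
    simp
  · rw [hφ b hb, wedge_zero_left]
    simp

/-- A bilinear form on mixed forms vanishes if it vanishes on homogeneous forms. -/
theorem bilin_eq_zero_of_hom {X : Type*} [AddCommGroup X] [Module ℝ X]
    {F : Mixed ℝ →ₗ[ℝ] Mixed ℝ →ₗ[ℝ] X}
    (h : ∀ l k φ ψ, Hom k φ → Hom l ψ → F φ ψ = 0) : F = 0 := by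
  refine LinearMap.ext₂ fun φ ψ => ?_
  change F φ ψ = 0
  rw [sum_homPart φ, map_sum, LinearMap.sum_apply]
  refine Finset.sum_eq_zero fun k _ => ?_
  rw [sum_homPart ψ, map_sum]
  exact Finset.sum_eq_zero fun l _ => h l k _ _ (hom_homPart _ _) (hom_homPart _ _)

theorem hom_eq_zero {k : ℕ} (hk : 6 < k) {φ : Mixed ℝ} (h : Hom k φ) : φ = 0 := by
  funext j
  by_cases hj : j = k
  · subst hj; exact form_eq_zero_of_lt hk _
  · exact h j hj

/-- In complementary degrees the product `φ ∧ ψ` has degree seven and vanishes. Contracting it gives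
`ι(v)φ ∧ ψ = ± φ ∧ ι(v)ψ`, and the sign is the one by which `σ` changes from degree `k` to `k + 1`.
-/
theorem pr_ann (v : V6) (φ ψ : Mixed ℝ) : pr (ann v φ) ψ = pr φ (ann v ψ) := by
  suffices h : pr ∘ₗ ann v - pr.compl₂ (ann v) = 0 by
    have := LinearMap.congr_fun₂ h φ ψ
    simpa [sub_eq_zero] using this
  refine bilin_eq_zero_of_hom fun l k φ ψ hφ hψ => ?_
  simp only [LinearMap.sub_apply, LinearMap.comp_apply, LinearMap.compl₂_apply, sub_eq_zero]
  cases k with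
  | zero =>
    rw [hφ.ann_zero, map_zero, LinearMap.zero_apply]
    cases l with
    | zero => rw [hψ.ann_zero, map_zero]
    | succ l =>
      by_cases hl : l = 6
      · subst hl
        rw [hom_eq_zero (by omega) hψ, map_zero, map_zero]
      · rw [pr_hom_eq_zero (by omega) hφ (hψ.ann v)]
  | succ k =>
    cases l with
    | zero =>
      rw [hψ.ann_zero, map_zero]
      by_cases hl : k = 6
      · subst hl
        rw [hom_eq_zero (by omega) hφ, map_zero, map_zero, LinearMap.zero_apply]
      · rw [pr_hom_eq_zero (by omega) (hφ.ann v) hψ]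
    | succ l =>
      by_cases hkl : k + l = 5
      · rw [pr_of_hom (by omega : k + (l + 1) = 6) (hφ.ann v),
          pr_of_hom (by omega : k + 1 + l = 6) hφ, ann_apply, ann_apply]
        have h7 : wedge (by omega : k + 1 + (l + 1) = 7) (φ (k + 1)) (ψ (l + 1)) = 0 :=
          form_eq_zero_of_lt (by omega) _
        have h8 := curryLeft_wedge_succ_succ (by omega : k + 1 + (l + 1) = 6 + 1) (φ (k + 1))
          (ψ (l + 1)) v
        rw [h7] at h8
        have h9 := congrArg (fun f => f stdVec) h8
        change (0 : ℝ) = wedge _ _ _ stdVec + (-1 : ℝ) ^ (k + 1) * wedge _ _ _ stdVec at h9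
        rw [eq_neg_of_add_eq_zero_left h9.symm]
        have : k ≤ 5 := by omega
        interval_cases k <;> norm_num
      · rw [pr_hom_eq_zero (by omega) (hφ.ann v) hψ, pr_hom_eq_zero (by omega) hφ (hψ.ann v)]

theorem hom_eq_sum_ann {k : ℕ} (hk : k < 6) {φ : Mixed ℝ} (h : Hom k φ) :
    φ = (6 - k : ℝ)⁻¹ • ∑ i, anni i (crei i φ) := by
  have : (6 - k : ℝ) ≠ 0 := by
    have : (k : ℝ) < 6 := by exact_mod_cast hk
    linarith
  rw [h.sum_ann_cre, smul_smul, inv_mul_cancel₀ this, one_smul]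

/-- A bilinear form on mixed forms for which the contractions are self-adjoint up to a sign vanishes
if it vanishes on pairs of a form of degree at least `6` or of other than complementary degree, and
a form of degree zero. -/
theorem bilin_eq_zero_of_ann {F : Mixed ℝ →ₗ[ℝ] Mixed ℝ →ₗ[ℝ] ℝ} (d : ℕ) (hd : d ≤ 6) (ε : ℝ)
    (h1 : ∀ i φ ψ, F (anni i φ) ψ = ε * F φ (anni i ψ))
    (h2 : ∀ k l φ ψ, k + l ≠ d → Hom k φ → Hom l ψ → F φ ψ = 0)
    (h3 : ∀ φ ψ, d = 6 → Hom 6 φ → Hom 0 ψ → F φ ψ = 0) : F = 0 := by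
  -- Induction on the degree of the second argument: a first argument of degree below six is a
  -- combination of contractions, and these are moved to the second argument until its degree is
  -- zero and they kill it. Only the degrees `(6, 0)` escape this.
  refine bilin_eq_zero_of_hom fun l => ?_
  induction l with
  | zero =>
    intro k φ ψ hφ hψ
    by_cases hk : k + 0 = d
    · by_cases hd6 : d = 6
      · obtain rfl : k = 6 := by omega
        exact h3 φ ψ hd6 hφ hψ
      · rw [hom_eq_sum_ann (by omega) hφ, map_smul, map_sum, LinearMap.smul_apply,
          LinearMap.sum_apply, Finset.sum_eq_zero, smul_zero]
        intro i _
        rw [h1, hψ.ann_zero, map_zero, mul_zero]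
    · exact h2 _ _ _ _ hk hφ hψ
  | succ l ih =>
    intro k φ ψ hφ hψ
    by_cases hk : k + (l + 1) = d
    · rw [hom_eq_sum_ann (by omega) hφ, map_smul, map_sum, LinearMap.smul_apply,
        LinearMap.sum_apply, Finset.sum_eq_zero, smul_zero]
      intro i _
      rw [h1, ih (k + 1) _ _ (hφ.cre _) (hψ.ann _), mul_zero]
    · exact h2 _ _ _ _ hk hφ hψ

theorem pr_crei (i : Fin 6) (φ ψ : Mixed ℝ) : pr (crei i φ) ψ = pr φ (crei i ψ) := by
  suffices h : pr ∘ₗ crei i - pr.compl₂ (crei i) = 0 by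
    have := LinearMap.congr_fun₂ h φ ψ
    simpa [sub_eq_zero] using this
  -- The defect of self-adjointness pairs degrees with sum five, so no case with a top-degree form
  -- occurs. The sign is `-1` because `e^i` anticommutes with contractions up to scalars, which
  -- cancel between the two terms.
  refine bilin_eq_zero_of_ann 5 (by omega) (-1) ?_ ?_ (by omega)
  · intro j φ ψ
    have e : ∀ φ, crei i (anni j φ) = stdCovec i (stdVec j) • φ - anni j (crei i φ) := fun φ =>
      eq_sub_of_add_eq' (ann_cre (stdVec j) (stdCovec i) φ)
    simp only [LinearMap.sub_apply, LinearMap.comp_apply, LinearMap.compl₂_apply, e, map_sub,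
      map_smul, LinearMap.smul_apply, pr_ann]
    ring
  · intro k l φ ψ hkl hφ hψ
    simp only [LinearMap.sub_apply, LinearMap.comp_apply, LinearMap.compl₂_apply]
    rw [pr_hom_eq_zero (by omega) (hφ.cre _) hψ, pr_hom_eq_zero (by omega) hφ (hψ.cre _), sub_zero]

theorem cre_sum (ξ : V6 →L[ℝ] ℝ) (φ : Mixed ℝ) : cre ξ φ = ∑ i, ξ (stdVec i) • crei i φ := by
  have : ((0, ξ) : W ℝ) = ∑ i, ξ (stdVec i) • ((0, stdCovec i) : W ℝ) := by
    ext v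
    · simp [Prod.fst_sum]
    · simp only [Prod.snd_sum, Prod.smul_snd, _root_.sum_apply, _root_.smul_apply, stdCovec_apply]
      conv_lhs => rw [sum_stdVec v, map_sum]
      simp [mul_comm]
  rw [cre, this, map_sum, LinearMap.sum_apply]
  simp only [map_smul, LinearMap.smul_apply]

/-- The Clifford action is self-adjoint for the pairing. -/
theorem pr_cl (x : W ℝ) (φ ψ : Mixed ℝ) : pr (cl x φ) ψ = pr φ (cl x ψ) := by
  rw [cl_eq x φ, cl_eq x ψ, cre_sum, cre_sum]
  simp only [map_add, LinearMap.add_apply, pr_ann, map_sum, map_smul, LinearMap.sum_apply,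
    LinearMap.smul_apply, pr_crei]

/-- Contractions are self-adjoint for the symmetric part as well, so it is decided in degrees `(6,
0)`. There `σ` contributes `(-1)³` to one order of the arguments and `1` to the other. -/
theorem pr_skew (φ ψ : Mixed ℝ) : pr φ ψ = -pr ψ φ := by
  suffices h : pr + pr.flip = 0 by
    have := LinearMap.congr_fun₂ h φ ψ
    simpa [add_eq_zero_iff_eq_neg] using this
  refine bilin_eq_zero_of_ann 6 le_rfl 1 ?_ ?_ ?_
  · intro j φ ψ
    simp only [LinearMap.add_apply, LinearMap.flip_apply, pr_ann, one_mul]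
  · intro k l φ ψ hkl hφ hψ
    simp only [LinearMap.add_apply, LinearMap.flip_apply]
    rw [pr_hom_eq_zero hkl hφ hψ, pr_hom_eq_zero (by omega) hψ hφ, zero_add]
  · intro φ ψ _ hφ hψ
    simp only [LinearMap.add_apply, LinearMap.flip_apply]
    rw [pr_of_hom (by omega : 6 + 0 = 6) hφ, pr_of_hom (by omega : 0 + 6 = 6) hψ,
      wedge_zero_left_eq, wedge_zero_right_eq]
    norm_num

theorem pr_self (φ : Mixed ℝ) : pr φ φ = 0 := by
  have := pr_skew φ φ
  linarith

theorem stdVol_stdVec : stdVol stdVec = 1 := by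
  have : (stdVec : Fin 6 → V6) = (EuclideanSpace.basisFun (Fin 6) ℝ).toBasis := by
    funext i
    simp [stdVec]
  change (EuclideanSpace.basisFun (Fin 6) ℝ).toBasis.det stdVec = 1
  rw [this, Module.Basis.det_self]

/-- The standard volume form as a mixed form. -/
def volMixed : Mixed ℝ := Pi.single 6 stdVol

theorem hom_volMixed : Hom 6 volMixed := fun j hj => by simp [volMixed, hj]

theorem pr_volMixed (φ : Mixed ℝ) : pr φ volMixed = φ 0 ![] := by
  rw [pr_skew, pr_of_hom (by omega : 6 + 0 = 6) hom_volMixed, wedge_zero_right_eq]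
  have : volMixed 6 = stdVol := by simp [volMixed]
  rw [this]
  change -((-1) ^ (6 / 2) * (φ 0 ![] * stdVol stdVec)) = _
  rw [stdVol_stdVec]
  norm_num

/-- Pairing with the volume form detects the scalar component. Contractions preserve the radical by
self-adjointness, so the higher components vanish by induction. -/
theorem pr_nondeg {φ : Mixed ℝ} (h : ∀ ψ, pr φ ψ = 0) : φ = 0 := by
  funext n
  induction n generalizing φ with
  | zero =>
    ext v
    rw [Subsingleton.elim v ![]]
    exact (pr_volMixed φ).symm.trans (h _)
  | succ n ih =>
    refine mixed_ext_succ (ψ := 0) fun v => ?_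
    rw [map_zero]
    exact ih fun ψ => by rw [pr_cl, h]

end Pairing

/-! ### Exterior multiplication by a form of arbitrary degree -/

section WedgeAction

/-- Exterior multiplication by a homogeneous form. -/
def wm {m : ℕ} (a : V6 [⋀^Fin m]→L[ℝ] ℝ) : Mixed ℝ →ₗ[ℝ] Mixed ℝ where
  toFun := wedgeMixed a
  map_add' φ ψ := by
    funext n
    simp only [wedgeMixed, Pi.add_apply]
    split_ifs
    · exact wedge_add_right _ _ _ _
    · rw [add_zero]
  map_smul' c φ := by
    funext n
    simp only [wedgeMixed, Pi.smul_apply, RingHom.id_apply]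
    split_ifs
    · exact wedge_smul_right _ _ _ _
    · rw [smul_zero]

theorem wm_apply {m : ℕ} (a : V6 [⋀^Fin m]→L[ℝ] ℝ) (φ : Mixed ℝ) : wm a φ = wedgeMixed a φ := rfl

theorem wm_zero (a : V6 [⋀^Fin 0]→L[ℝ] ℝ) (φ : Mixed ℝ) : wm a φ = a ![] • φ := by
  funext n
  rw [wm_apply, wedgeMixed_apply (zero_add n), wedge_zero_left_eq]
  rfl

theorem wm_neg {m : ℕ} (a : V6 [⋀^Fin m]→L[ℝ] ℝ) (φ : Mixed ℝ) : wm (-a) φ = -wm a φ := by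
  funext n
  simp only [wm_apply, wedgeMixed, Pi.neg_apply]
  split_ifs
  · rw [← neg_one_smul ℝ a, wedge_smul_left, neg_one_smul]
  · rw [neg_zero]

theorem wm_add {m : ℕ} (a b : V6 [⋀^Fin m]→L[ℝ] ℝ) (φ : Mixed ℝ) :
    wm (a + b) φ = wm a φ + wm b φ := by
  funext n
  simp only [wm_apply, wedgeMixed, Pi.add_apply]
  split_ifs
  · rw [wedge_add_left]
  · rw [zero_add]

theorem ann_wm {m : ℕ} (v : V6) (a : V6 [⋀^Fin (m + 1)]→L[ℝ] ℝ) (φ : Mixed ℝ) :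
    ann v (wm a φ) = wm (a.curryLeft v) φ + (-1 : ℝ) ^ (m + 1) • wm a (ann v φ) := by
  funext n
  rw [Pi.add_apply, Pi.smul_apply, ann_apply]
  simp only [wm_apply]
  by_cases h : m ≤ n
  · obtain ⟨l, rfl⟩ := Nat.exists_eq_add_of_le h
    rw [wedgeMixed_apply (by omega : m + 1 + l = m + l + 1), wedgeMixed_apply rfl]
    cases l with
    | zero =>
      rw [curryLeft_wedge_succ_zero, wedgeMixed_apply_of_lt (by omega), smul_zero]
      exact (add_zero _).symm
    | succ l =>
      rw [curryLeft_wedge_succ_succ (n := m + (l + 1)),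
        wedgeMixed_apply (by omega : m + 1 + l = m + (l + 1)), ann_apply]
  · rw [wedgeMixed_apply_of_lt (by omega), wedgeMixed_apply_of_lt (by omega),
      wedgeMixed_apply_of_lt (by omega)]
    simp

theorem curryLeft_swap {m : ℕ} (a : V6 [⋀^Fin (m + 2)]→L[ℝ] ℝ) (v w : V6) :
    (a.curryLeft v).curryLeft w = -(a.curryLeft w).curryLeft v := by
  have h := ContinuousAlternatingMap.curryLeft_same a (v + w)
  simp only [map_add, ContinuousAlternatingMap.curryLeft_add, _root_.add_apply,
    ContinuousAlternatingMap.curryLeft_same, zero_add, add_zero] at h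
  exact eq_neg_of_add_eq_zero_right h

theorem curryLeft_sum {m : ℕ} (a : V6 [⋀^Fin (m + 1)]→L[ℝ] ℝ) (v : V6) :
    a.curryLeft v = ∑ i, v i • a.curryLeft (stdVec i) := by
  conv_lhs => rw [sum_stdVec v, map_sum]
  simp only [map_smul]

/-- Euler's identity `(m + 1) a = ∑ e^i ∧ ι(e_i) a` at the level of operators. It reduces statements
on multiplication by an `m`-form to the covectors `e^i`, by induction on `m`. -/
theorem smul_wm_succ {m : ℕ} (a : V6 [⋀^Fin (m + 1)]→L[ℝ] ℝ) (φ : Mixed ℝ) :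
    (m + 1 : ℝ) • wm a φ = ∑ i, crei i (wm (a.curryLeft (stdVec i)) φ) := by
  induction m generalizing φ with
  | zero =>
    funext n
    induction n generalizing φ with
    | zero =>
      rw [Finset.sum_apply, Finset.sum_eq_zero fun i _ => cre_zero _ _, Pi.smul_apply, wm_apply,
        wedgeMixed_apply_of_lt (by omega), smul_zero]
    | succ n ih =>
      refine mixed_ext_succ fun v => ?_
      rw [map_smul, ann_wm, map_sum]
      have e : ∀ i, ann v (crei i (wm (a.curryLeft (stdVec i)) φ)) =
          v i • wm (a.curryLeft (stdVec i)) φ - crei i (wm (a.curryLeft (stdVec i)) (ann v φ)) := by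
        intro i
        rw [eq_sub_of_add_eq (ann_cre v (stdCovec i) _), wm_zero, wm_zero, map_smul]
        rfl
      simp only [e, Finset.sum_sub_distrib, smul_add, Pi.add_apply, Pi.sub_apply]
      rw [← ih (ann v φ)]
      have : ∑ i, v i • wm (a.curryLeft (stdVec i)) φ = wm (a.curryLeft v) φ := by
        rw [curryLeft_sum a v]
        simp only [wm_zero, ContinuousAlternatingMap.sum_apply, ContinuousAlternatingMap.smul_apply,
          Finset.sum_smul, smul_assoc]
      rw [this]
      simp [sub_eq_add_neg]
  | succ m ihm =>
    funext n
    induction n generalizing φ with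
    | zero =>
      rw [Finset.sum_apply, Finset.sum_eq_zero fun i _ => cre_zero _ _, Pi.smul_apply, wm_apply,
        wedgeMixed_apply_of_lt (by omega), smul_zero]
    | succ n ih =>
      refine mixed_ext_succ fun v => ?_
      rw [map_smul, ann_wm, map_sum]
      have e : ∀ i, ann v (crei i (wm (a.curryLeft (stdVec i)) φ)) =
          v i • wm (a.curryLeft (stdVec i)) φ + crei i (wm ((a.curryLeft v).curryLeft (stdVec i)) φ)
            + (-1 : ℝ) ^ (m + 2) • crei i (wm (a.curryLeft (stdVec i)) (ann v φ)) := by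
        intro i
        rw [eq_sub_of_add_eq (ann_cre v (stdCovec i) _), ann_wm, curryLeft_swap, wm_neg,
          stdCovec_apply, map_add, map_neg, map_smul, pow_succ]
        module
      simp only [e, Finset.sum_add_distrib]
      rw [← ihm (a.curryLeft v) φ, ← Finset.smul_sum, Pi.add_apply _ ((-1 : ℝ) ^ (m + 2) • _),
        Pi.smul_apply ((-1 : ℝ) ^ (m + 2)), ← ih (ann v φ)]
      have : ∑ i, v i • wm (a.curryLeft (stdVec i)) φ = wm (a.curryLeft v) φ := by
        rw [curryLeft_sum a v]
        have h1 : ∀ b : V6 [⋀^Fin (m + 1)]→L[ℝ] ℝ, ∀ c : ℝ, wm (c • b) φ = c • wm b φ := by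
          intro b c
          funext n
          simp only [wm_apply, wedgeMixed, Pi.smul_apply]
          split_ifs
          · rw [wedge_smul_left]
          · rw [smul_zero]
        let L : (V6 [⋀^Fin (m + 1)]→L[ℝ] ℝ) →ₗ[ℝ] Mixed ℝ :=
          { toFun := fun b => wm b φ, map_add' := fun b b' => wm_add b b' φ,
            map_smul' := fun c b => h1 b c }
        change _ = L (∑ i, v i • a.curryLeft (stdVec i))
        rw [map_sum]
        simp only [map_smul]
        rfl
      rw [this]
      simp only [Pi.add_apply, Pi.smul_apply]
      push_cast
      module

theorem cre_wm {m : ℕ} (a : V6 [⋀^Fin m]→L[ℝ] ℝ) (ξ : V6 →L[ℝ] ℝ) (φ : Mixed ℝ) :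
    cre ξ (wm a φ) = (-1 : ℝ) ^ m • wm a (cre ξ φ) := by
  induction m generalizing φ with
  | zero => rw [wm_zero, wm_zero, map_smul, pow_zero, one_smul]
  | succ m ih =>
    have hm : (m + 1 : ℝ) ≠ 0 := by positivity
    have h1 := congrArg (cre ξ) (smul_wm_succ a φ)
    have h2 := smul_wm_succ a (cre ξ φ)
    rw [map_smul, map_sum] at h1
    have e : ∀ i, cre ξ (crei i (wm (a.curryLeft (stdVec i)) φ)) =
        (-1 : ℝ) ^ (m + 1) • crei i (wm (a.curryLeft (stdVec i)) (cre ξ φ)) := by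
      intro i
      rw [eq_neg_of_add_eq_zero_left (cre_cre ξ (stdCovec i) _), ih, map_smul, pow_succ]
      module
    simp only [e, ← Finset.smul_sum, ← h2] at h1
    rw [smul_comm] at h1
    exact smul_right_injective (Mixed ℝ) hm h1

/-- The sign of the reversal of `m` letters. -/
def revSign : ℕ → ℝ
  | 0 => 1
  | m + 1 => revSign m * (-1) ^ m

theorem pr_wm {m : ℕ} (a : V6 [⋀^Fin m]→L[ℝ] ℝ) (φ ψ : Mixed ℝ) :
    pr (wm a φ) ψ = revSign m * pr φ (wm a ψ) := by
  induction m generalizing φ ψ with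
  | zero => simp [wm_zero, revSign]
  | succ m ih =>
    have hm : (m + 1 : ℝ) ≠ 0 := by positivity
    apply mul_left_cancel₀ hm
    have h1 : (m + 1 : ℝ) * pr (wm a φ) ψ = pr ((m + 1 : ℝ) • wm a φ) ψ := by
      rw [map_smul]; rfl
    have h2 : (m + 1 : ℝ) * (revSign (m + 1) * pr φ (wm a ψ)) =
        revSign (m + 1) * pr φ ((m + 1 : ℝ) • wm a ψ) := by
      rw [map_smul, smul_eq_mul]; ring
    rw [h1, h2, smul_wm_succ, smul_wm_succ]
    simp only [map_sum, LinearMap.sum_apply, Finset.mul_sum]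
    refine Finset.sum_congr rfl fun i _ => ?_
    rw [pr_cl, ih, cre_wm, map_smul, smul_eq_mul, revSign, mul_assoc, ← mul_assoc ((-1 : ℝ) ^ m),
      ← mul_pow]
    norm_num

/-- The adjoint of a product of covectors is the reversed product, and reversing three letters is an
odd permutation. Under the integral `d` is skew for the pairing too, which is why `d_H` satisfies
the same Stokes formula. -/
theorem pr_wm_three (a : V6 [⋀^Fin 3]→L[ℝ] ℝ) (φ ψ : Mixed ℝ) :
    pr (wm a φ) ψ = -pr φ (wm a ψ) := by
  rw [pr_wm]
  norm_num [revSign]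

end WedgeAction

end GenCY
end

noncomputable section
namespace GenCY

/-! ### The Fierz identity for half-spinors -/

section Fierz

/-- The index set of the null basis of `V ⊕ V*`. -/
abbrev NIdx : Type := Fin 6 × Bool

/-- The null basis `e_i, e^i` of `V ⊕ V*`. -/
def eW (a : NIdx) : W ℝ := if a.2 then (0, stdCovec a.1) else (stdVec a.1, 0)

/-- The index of the dual basis vector. -/
def dualIdx (a : NIdx) : NIdx := (a.1, !a.2)

theorem dualIdx_dualIdx (a : NIdx) : dualIdx (dualIdx a) = a := by
  simp [dualIdx]

theorem dualIdx_involutive : Function.Involutive dualIdx := dualIdx_dualIdx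

theorem sum_nIdx {X : Type*} [AddCommMonoid X] (f : NIdx → X) :
    ∑ a, f a = ∑ i, (f (i, false) + f (i, true)) := by
  rw [Fintype.sum_prod_type]
  refine Finset.sum_congr rfl fun i _ => ?_
  rw [Fintype.sum_bool, add_comm]

theorem gW_eW (a b : NIdx) : gW (eW a) (eW (dualIdx b)) = if a = b then 1 else 0 := by
  obtain ⟨i, s⟩ := a
  obtain ⟨j, t⟩ := b
  cases s <;> cases t <;> simp [gW_apply, eW, dualIdx, stdCovec_stdVec, eq_comm]

/-- Expansion of an element of `V ⊕ V*` in the null basis. -/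
theorem sum_gW_eW (x : W ℝ) : ∑ a, gW x (eW (dualIdx a)) • eW a = x := by
  rw [sum_nIdx]
  have e : ∀ i : Fin 6, gW x (eW (dualIdx (i, false))) • eW (i, false) +
      gW x (eW (dualIdx (i, true))) • eW (i, true) = (x.1 i • stdVec i, x.2 (stdVec i) • stdCovec i) := by
    intro i
    simp [gW_apply, eW, dualIdx, stdCovec_apply]
  simp only [e]
  ext v
  · rw [Prod.fst_sum]
    simp only
    rw [← sum_stdVec]
  · rw [Prod.snd_sum]
    simp only [_root_.sum_apply, _root_.smul_apply, stdCovec_apply]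
    conv_rhs => rw [sum_stdVec v, map_sum]
    simp [mul_comm]

theorem gW_ext {x y : W ℝ} (h : ∀ z, gW x z = gW y z) : x = y := by
  rw [← sum_gW_eW x, ← sum_gW_eW y]
  simp only [h]

/-- The reflection of a single creation/annihilation pair. -/
def flipU (i : Fin 6) : W ℝ := eW (i, false) + eW (i, true)

theorem flipU_flipU (i : Fin 6) (φ : Mixed ℝ) : cl (flipU i) (cl (flipU i) φ) = φ := by
  have h := cl_cl (flipU i) (flipU i) φ
  have hg : gW (flipU i) (flipU i) = 2 := by
    simp [flipU, gW_apply, eW, stdCovec_stdVec]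
    norm_num
  rw [hg, ← two_smul ℝ] at h
  exact smul_right_injective _ (two_ne_zero (α := ℝ)) h

/-- The permutation of the null basis induced by `flipU i`. -/
def flipIdx (i : Fin 6) (a : NIdx) : NIdx := if a.1 = i then dualIdx a else a

/-- The signs of the action of `flipU i` on the null basis. -/
def flipSign (i : Fin 6) (a : NIdx) : ℝ := if a.1 = i then 1 else -1

theorem flipIdx_dualIdx (i : Fin 6) (a : NIdx) :
    flipIdx i (dualIdx a) = dualIdx (flipIdx i a) := by
  unfold flipIdx
  by_cases h : a.1 = i
  · rw [if_pos h, if_pos (show (dualIdx a).1 = i from h)]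
  · rw [if_neg h, if_neg (show ¬(dualIdx a).1 = i from h)]

theorem flipSign_dualIdx (i : Fin 6) (a : NIdx) : flipSign i (dualIdx a) = flipSign i a := rfl

theorem flipSign_mul_self (i : Fin 6) (a : NIdx) : flipSign i a * flipSign i a = 1 := by
  unfold flipSign
  split_ifs <;> norm_num

theorem flipIdx_involutive (i : Fin 6) : Function.Involutive (flipIdx i) := by
  intro a
  unfold flipIdx
  by_cases h : a.1 = i
  · rw [if_pos h, if_pos (show (dualIdx a).1 = i from h), dualIdx_dualIdx]
  · rw [if_neg h, if_neg h]

/-- A basis vector orthogonal to `u = e_i + e^i` anticommutes with it. For the other two, `e_i u =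
e_i e^i = u e^i`, and likewise with `e_i` and `e^i` exchanged, since both are null. -/
theorem eW_flipU (i : Fin 6) (a : NIdx) (φ : Mixed ℝ) :
    cl (eW a) (cl (flipU i) φ) = flipSign i a • cl (flipU i) (cl (eW (flipIdx i a)) φ) := by
  rw [cl_cl_swap]
  by_cases h : a.1 = i
  · have hg : gW (eW a) (flipU i) = 1 := by
      subst h
      obtain ⟨j, s⟩ := a
      cases s <;> simp [flipU, gW_apply, eW, stdCovec_stdVec]
    have hu : flipU i = eW a + eW (dualIdx a) := by
      subst h
      obtain ⟨j, s⟩ := a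
      cases s <;> simp [flipU, eW, dualIdx]
    rw [hg, flipSign, if_pos h, flipIdx, if_pos h, one_smul, one_smul]
    conv_lhs => rw [← flipU_flipU i φ]
    rw [← map_sub, flipU_flipU]
    congr 1
    rw [hu, map_add, LinearMap.add_apply]
    abel
  · have hg : gW (eW a) (flipU i) = 0 := by
      obtain ⟨j, s⟩ := a
      have h' : ¬ i = j := fun e => h e.symm
      cases s <;> simp_all [flipU, gW_apply, eW, stdCovec_stdVec]
    rw [hg, flipSign, if_neg h, flipIdx, if_neg h, zero_smul, zero_sub, neg_one_smul]

theorem pr_flipU (i : Fin 6) (φ ψ : Mixed ℝ) :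
    pr (cl (flipU i) φ) (cl (flipU i) ψ) = pr φ ψ := by
  rw [pr_cl, flipU_flipU]

/-- The cubic expression `∑ ⟨e_a e^b ρ, ρ⟩ e_b e^a σ`. -/
def fierzL (ρ : Mixed ℝ) : Mixed ℝ →ₗ[ℝ] Mixed ℝ :=
  ∑ a, ∑ b, pr (cl (eW a) (cl (eW (dualIdx b)) ρ)) ρ • (cl (eW b) ∘ₗ cl (eW (dualIdx a)))

/-- The cubic expression `∑ ⟨e^a σ, ρ⟩ e_a ρ`. -/
def fierzR (ρ : Mixed ℝ) : Mixed ℝ →ₗ[ℝ] Mixed ℝ :=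
  ∑ a, ((pr.flip ρ) ∘ₗ cl (eW (dualIdx a))).smulRight (cl (eW a) ρ)

theorem fierzL_apply (ρ σ : Mixed ℝ) : fierzL ρ σ = ∑ a, ∑ b,
    pr (cl (eW a) (cl (eW (dualIdx b)) ρ)) ρ • cl (eW b) (cl (eW (dualIdx a)) σ) := by
  simp [fierzL, LinearMap.sum_apply]

theorem fierzR_apply (ρ σ : Mixed ℝ) :
    fierzR ρ σ = ∑ a, pr (cl (eW (dualIdx a)) σ) ρ • cl (eW a) ρ := by
  simp [fierzR, LinearMap.sum_apply]

/-- Multiplication by `u = flipU i` squares to one and preserves the pairing; conjugation by it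
permutes the null basis up to signs, compatibly with duality. After reindexing, each index occurs
twice and its signs multiply to one. The same holds for `fierzR`. -/
theorem fierzL_flipU (i : Fin 6) (ρ σ : Mixed ℝ) :
    fierzL (cl (flipU i) ρ) (cl (flipU i) σ) = cl (flipU i) (fierzL ρ σ) := by
  simp only [fierzL_apply, map_sum, map_smul]
  rw [← Equiv.sum_comp (flipIdx_involutive i).toPerm]
  refine Finset.sum_congr rfl fun a _ => ?_
  rw [← Equiv.sum_comp (flipIdx_involutive i).toPerm]
  refine Finset.sum_congr rfl fun b _ => ?_
  simp only [Function.Involutive.coe_toPerm, eW_flipU, map_smul,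
    (flipIdx_involutive i) _, LinearMap.smul_apply, smul_smul, pr_flipU, ← flipIdx_dualIdx,
    smul_eq_mul]
  congr 1
  rw [flipIdx_dualIdx, flipSign_dualIdx, flipIdx_dualIdx, flipSign_dualIdx]
  linear_combination (pr (cl (eW a) (cl (eW (dualIdx b)) ρ)) ρ) *
    (flipSign_mul_self i (flipIdx i a) * flipSign i (flipIdx i b) ^ 2 +
      flipSign_mul_self i (flipIdx i b))

theorem fierzR_flipU (i : Fin 6) (ρ σ : Mixed ℝ) :
    fierzR (cl (flipU i) ρ) (cl (flipU i) σ) = cl (flipU i) (fierzR ρ σ) := by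
  simp only [fierzR_apply, map_sum, map_smul]
  rw [← Equiv.sum_comp (flipIdx_involutive i).toPerm]
  refine Finset.sum_congr rfl fun a _ => ?_
  simp only [Function.Involutive.coe_toPerm, eW_flipU, map_smul,
    (flipIdx_involutive i) _, LinearMap.smul_apply, smul_smul, pr_flipU, ← flipIdx_dualIdx,
    smul_eq_mul]
  congr 1
  rw [flipIdx_dualIdx, flipSign_dualIdx]
  linear_combination (pr (cl (eW (dualIdx a)) σ) ρ) * flipSign_mul_self i (flipIdx i a)

/-- The unit scalar as a mixed form. -/
def oneMixed : Mixed ℝ := Pi.single 0 (ContinuousAlternatingMap.constOfIsEmpty ℝ V6 (Fin 0) 1)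

theorem hom_oneMixed : Hom 0 oneMixed := fun j hj => by simp [oneMixed, hj]

theorem Hom.eq_smul_oneMixed {φ : Mixed ℝ} (h : Hom 0 φ) : φ = pr φ volMixed • oneMixed := by
  funext j
  by_cases hj : j = 0
  · subst hj
    ext v
    rw [pr_volMixed, Subsingleton.elim v ![]]
    change _ = φ 0 ![] * (oneMixed 0 ![])
    simp [oneMixed]
  · rw [h j hj, Pi.smul_apply, hom_oneMixed j hj, smul_zero]

theorem Hom.eq_smul_volMixed {φ : Mixed ℝ} (h : Hom 6 φ) : φ = pr oneMixed φ • volMixed := by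
  have h0 : ∀ ψ, pr φ ψ = pr (pr oneMixed φ • volMixed) ψ := by
    intro ψ
    have e : ∀ χ : Mixed ℝ, Hom 6 χ → pr χ ψ = pr χ (homPart 0 ψ) := by
      intro χ hχ
      rw [pr_of_hom (by omega : 6 + 0 = 6) hχ, pr_of_hom (by omega : 6 + 0 = 6) hχ, homPart_self]
    rw [map_smul, LinearMap.smul_apply, e φ h, e _ hom_volMixed,
      (hom_homPart 0 ψ).eq_smul_oneMixed]
    simp only [map_smul, smul_eq_mul]
    have h1 : pr oneMixed volMixed = 1 := by
      rw [pr_volMixed]; simp [oneMixed]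
    rw [pr_skew φ, pr_skew volMixed, h1]
    ring
  rw [← sub_eq_zero]
  exact pr_nondeg fun ψ => by rw [map_sub, LinearMap.sub_apply, h0, sub_self]

theorem eW_false (i : Fin 6) : eW (i, false) = (stdVec i, 0) := rfl
theorem eW_true (i : Fin 6) : eW (i, true) = (0, stdCovec i) := rfl

theorem odd_eq_sum {ρ : Mixed ℝ} (h : HasParity 1 ρ) :
    ρ = homPart 1 ρ + homPart 3 ρ + homPart 5 ρ := by
  have e : ∀ k : ℕ, (k : ZMod 2) ≠ 1 → homPart k ρ = 0 := by
    intro k hk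
    simp [homPart, h k hk]
  conv_lhs => rw [sum_homPart ρ]
  simp only [Finset.sum_range_succ, Finset.sum_range_zero]
  rw [e 0 (by decide), e 2 (by decide), e 4 (by decide), e 6 (by decide)]
  abel

theorem anni_crei_hom_zero {σ : Mixed ℝ} (h : Hom 0 σ) (i j : Fin 6) :
    anni j (crei i σ) = if i = j then σ else 0 := by
  rw [eq_sub_of_add_eq (ann_cre (stdVec j) (stdCovec i) σ), h.ann_zero, map_zero, sub_zero,
    stdCovec_stdVec]
  split_ifs <;> simp

/-- The Fierz identity on the vacuum. -/
theorem fierz_oneMixed {ρ : Mixed ℝ} (h : HasParity 1 ρ) :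
    fierzL ρ oneMixed = (4 : ℝ) • fierzR ρ oneMixed := by
  obtain ⟨x1, hx1⟩ : ∃ x, x = homPart 1 ρ := ⟨_, rfl⟩
  obtain ⟨x3, hx3⟩ : ∃ x, x = homPart 3 ρ := ⟨_, rfl⟩
  obtain ⟨x5, hx5⟩ : ∃ x, x = homPart 5 ρ := ⟨_, rfl⟩
  have h1 : Hom 1 x1 := hx1 ▸ hom_homPart _ _
  have h3 : Hom 3 x3 := hx3 ▸ hom_homPart _ _
  have h5 : Hom 5 x5 := hx5 ▸ hom_homPart _ _
  have hρ : ρ = x1 + x3 + x5 := by rw [hx1, hx3, hx5]; exact odd_eq_sum h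
  have hz : ∀ i, anni i oneMixed = 0 := fun i => hom_oneMixed.ann_zero _
  -- Every 5-form is the contraction of the volume form with a vector. Through `v` the right side of
  -- the identity becomes the contraction of `ρ`, in which the component `x5` drops out.
  set v : V6 := ∑ i, pr oneMixed (crei i x5) • stdVec i with hv
  have hvi : ∀ i, v i = pr oneMixed (crei i x5) := by
    intro i
    have := congrArg (fun w : V6 => w i) (sum_stdVec v)
    rw [hv]
    simp [stdVec, Pi.single_apply]
  have hv5 : x5 = ann v volMixed := by
    have e := h5.sum_ann_cre
    norm_num at e
    rw [ann_sum, ← e]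
    refine Finset.sum_congr rfl fun i _ => ?_
    rw [(h5.cre (stdCovec i)).eq_smul_volMixed, map_smul, hvi]
  have hvv : ∀ φ, ann v (ann v φ) = 0 := by
    intro φ
    have := ann_ann v v φ
    rw [← two_smul ℝ] at this
    exact (smul_eq_zero.1 this).resolve_left two_ne_zero
  have hR : fierzR ρ oneMixed = ann v x1 + ann v x3 := by
    rw [fierzR_apply, sum_nIdx]
    have e : ∀ i : Fin 6, pr (cl (eW (dualIdx (i, false))) oneMixed) ρ • cl (eW (i, false)) ρ +
        pr (cl (eW (dualIdx (i, true))) oneMixed) ρ • cl (eW (i, true)) ρ =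
        v i • anni i ρ := by
      intro i
      have e1 : cl (eW (dualIdx (i, true))) oneMixed = 0 := hz i
      have e2 : pr (cl (eW (dualIdx (i, false))) oneMixed) ρ = v i := by
        change pr (crei i oneMixed) ρ = _
        rw [hρ, hvi, map_add, map_add, pr_hom_eq_zero (by omega) (hom_oneMixed.cre _) h1,
          pr_hom_eq_zero (by omega) (hom_oneMixed.cre _) h3, pr_cl]
        ring
      rw [e1, e2, map_zero, LinearMap.zero_apply, zero_smul, add_zero, eW_false]
    simp only [e]
    rw [← ann_sum, hρ, map_add, map_add, hv5, hvv, add_zero]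
  -- The operator has the eigenvalues `5`, `3`, `1` in degrees `1`, `3`, `5`. The degree-three term
  -- pairs to zero with itself, and skewness turns the rest into `(5 - 1)⟨x1, x5⟩`.
  have hN : ∑ i, pr (anni i (crei i ρ)) ρ = 4 * pr x1 x5 := by
    have e : ∑ i, pr (anni i (crei i ρ)) ρ = pr (∑ i, anni i (crei i ρ)) ρ := by
      rw [map_sum, LinearMap.sum_apply]
    have e2 : ∑ i, anni i (crei i ρ) = (5 : ℝ) • x1 + (3 : ℝ) • x3 + x5 := by
      conv_lhs => rw [hρ]
      simp only [map_add, Finset.sum_add_distrib]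
      rw [h1.sum_ann_cre, h3.sum_ann_cre, h5.sum_ann_cre]
      norm_num
    rw [e, e2]
    conv_lhs => rw [hρ]
    simp only [map_add, map_smul, LinearMap.add_apply, LinearMap.smul_apply, smul_eq_mul]
    rw [pr_self, pr_self, pr_self, pr_hom_eq_zero (by omega) h1 h3,
      pr_hom_eq_zero (by omega) h3 h1, pr_hom_eq_zero (by omega) h3 h5,
      pr_hom_eq_zero (by omega) h5 h3, pr_skew x5 x1]
    ring
  -- Two contractions leave only the cross terms between degrees three and five, and these two are
  -- equal.
  have hQ : ∀ i j, pr (anni i (anni j ρ)) ρ = 2 * pr (ann v (anni i (anni j x3))) volMixed := by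
    intro i j
    have e1 : anni i (anni j x1) = 0 := (h1.ann _).ann_zero _
    have e2 : pr (anni i (anni j x5)) x3 = pr (anni i (anni j x3)) x5 := by
      rw [pr_ann, pr_ann, pr_skew, eq_neg_of_add_eq_zero_left (ann_ann (stdVec j) (stdVec i) x3)]
      simp
    have e3 : pr (anni i (anni j x3)) x1 = 0 := pr_hom_eq_zero (by omega) ((h3.ann _).ann _) h1
    have e4 : pr (anni i (anni j x3)) x3 = 0 := pr_hom_eq_zero (by omega) ((h3.ann _).ann _) h3
    have e5 : pr (anni i (anni j x5)) x1 = 0 := pr_hom_eq_zero (by omega) ((h5.ann _).ann _) h1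
    have e6 : pr (anni i (anni j x5)) x5 = 0 := pr_hom_eq_zero (by omega) ((h5.ann _).ann _) h5
    have e7 : pr (ann v (anni i (anni j x3))) volMixed = pr (anni i (anni j x3)) x5 := by
      rw [pr_ann, ← hv5]
    rw [e7, hρ]
    simp only [map_add, LinearMap.add_apply, e1, e2, e3, e4, e5, e6, map_zero,
      LinearMap.zero_apply]
    ring
  -- Contractions kill the constant form, so its first Clifford factor must create. The second
  -- either creates again, giving a 2-form, or annihilates the same covector, giving a scalar on the
  -- diagonal.
  have hL : fierzL ρ oneMixed = (∑ i, ∑ j, pr (anni i (anni j ρ)) ρ • crei j (crei i oneMixed)) +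
      (∑ i, pr (anni i (crei i ρ)) ρ) • oneMixed := by
    rw [fierzL_apply, sum_nIdx, Finset.sum_smul, ← Finset.sum_add_distrib]
    refine Finset.sum_congr rfl fun i _ => ?_
    have e1 : ∀ b, cl (eW b) (cl (eW (dualIdx (i, true))) oneMixed) = 0 := fun b => by
      rw [show cl (eW (dualIdx (i, true))) oneMixed = 0 from hz i, map_zero]
    simp only [e1, smul_zero, Finset.sum_const_zero, add_zero]
    rw [sum_nIdx, Finset.sum_add_distrib, add_comm]
    refine congrArg₂ (· + ·) (Finset.sum_congr rfl fun j _ => rfl) ?_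
    rw [Finset.sum_eq_single i]
    · change pr (anni i (crei i ρ)) ρ • anni i (crei i oneMixed) = _
      rw [anni_crei_hom_zero hom_oneMixed, if_pos rfl]
    · intro j _ hj
      change pr (anni i (crei j ρ)) ρ • anni j (crei i oneMixed) = _
      rw [anni_crei_hom_zero hom_oneMixed, if_neg hj.symm, smul_zero]
    · simp
  -- The constant `4` is the factor `2` from `hQ` times `2 · 1`, the number operator applied to the
  -- 2-form `ι(v)x3` and then to its contractions.
  have hA : (∑ i, ∑ j, pr (anni i (anni j ρ)) ρ • crei j (crei i oneMixed)) =
      (4 : ℝ) • ann v x3 := by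
    have e : ∀ i j, pr (anni i (anni j ρ)) ρ • crei j (crei i oneMixed) =
        (2 : ℝ) • crei j (crei i (anni i (anni j (ann v x3)))) := by
      intro i j
      have e1 : anni i (anni j (ann v x3)) = ann v (anni i (anni j x3)) := by
        rw [eq_neg_of_add_eq_zero_left (ann_ann (stdVec j) v x3), map_neg,
          eq_neg_of_add_eq_zero_left (ann_ann (stdVec i) v _), neg_neg]
      rw [e1, (((h3.ann _).ann _).ann v : Hom 0 (ann v (anni i (anni j x3)))).eq_smul_oneMixed, hQ]
      simp only [map_smul]
      rw [mul_smul]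
    simp only [e]
    rw [Finset.sum_comm]
    have e3 : Hom 2 (ann v x3) := h3.ann v
    have e2 : ∀ j, ∑ i, (2 : ℝ) • crei j (crei i (anni i (anni j (ann v x3)))) =
        (2 : ℝ) • crei j (anni j (ann v x3)) := by
      intro j
      rw [← Finset.smul_sum, ← map_sum, (e3.ann _ : Hom 1 (anni j (ann v x3))).sum_cre_ann]
      simp
    simp only [e2]
    rw [← Finset.smul_sum, e3.sum_cre_ann, smul_smul]
    norm_num
  rw [hL, hA, hN, hR, smul_add, add_comm]
  congr 1
  conv_rhs => rw [(h1.ann v : Hom 0 (ann v x1)).eq_smul_oneMixed, pr_ann, ← hv5]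
  rw [smul_smul]

/-- Since `(e_i + e^i) ι(e_i) = e^i ι(e_i)`, the number operator writes `σ` as a combination of the
forms `u_i ι(e_i)σ`. Equivariance under `u_i` replaces the pair `(ρ, σ)` by `(u_i ρ, ι(e_i)σ)`,
which lowers the degree of `σ` and switches the parity of `ρ`, down to the constant form. -/
theorem fierz_of_hom {k : ℕ} {σ : Mixed ℝ} (hσ : Hom k σ) {ρ : Mixed ℝ}
    (hρ : HasParity (k + 1) ρ) : fierzL ρ σ = (4 : ℝ) • fierzR ρ σ := by
  induction k generalizing σ ρ with
  | zero =>
    rw [hσ.eq_smul_oneMixed, map_smul, map_smul, fierz_oneMixed (by simpa using hρ), smul_comm]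
  | succ k ih =>
    have hk : ((k + 1 : ℕ) : ℝ) ≠ 0 := by positivity
    have e : σ = ((k + 1 : ℕ) : ℝ)⁻¹ • ∑ i, cl (flipU i) (anni i σ) := by
      have : ∀ i, cl (flipU i) (anni i σ) = crei i (anni i σ) := by
        intro i
        have h0 := ann_ann (stdVec i) (stdVec i) σ
        rw [← two_smul ℝ] at h0
        rw [flipU, map_add, LinearMap.add_apply, eW_false, eW_true,
          (smul_eq_zero.1 h0).resolve_left two_ne_zero, zero_add]
      simp only [this]
      rw [hσ.sum_cre_ann, smul_smul, inv_mul_cancel₀ hk, one_smul]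
    rw [e, map_smul, map_smul, map_sum, map_sum, smul_comm, Finset.smul_sum (r := (4 : ℝ))]
    congr 1
    refine Finset.sum_congr rfl fun i _ => ?_
    have h2 : HasParity (k + 1) (cl (flipU i) ρ) := by
      have := hρ.cl (flipU i)
      have h3 : ((k + 1 : ℕ) : ZMod 2) + 1 + 1 = k + 1 := by
        push_cast
        rw [add_assoc _ (1 : ZMod 2) 1, CharTwo.add_self_eq_zero, add_zero]
      rwa [h3] at this
    have h4 := ih (hσ.ann (stdVec i)) h2
    rw [← flipU_flipU i ρ, fierzL_flipU, fierzR_flipU, h4, map_smul]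

/-- The Fierz identity for half-spinors of opposite parity. -/
theorem fierz {p : ZMod 2} {ρ σ : Mixed ℝ} (hρ : HasParity p ρ) (hσ : HasParity (p + 1) σ) :
    fierzL ρ σ = (4 : ℝ) • fierzR ρ σ := by
  rw [sum_homPart σ, map_sum, map_sum, Finset.smul_sum]
  refine Finset.sum_congr rfl fun k _ => ?_
  by_cases hk : (k : ZMod 2) = p + 1
  · refine fierz_of_hom (hom_homPart k σ) ?_
    rwa [hk, add_assoc, CharTwo.add_self_eq_zero, add_zero]
  · have : homPart k σ = 0 := by simp [homPart, hσ k hk]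
    rw [this, map_zero, map_zero, smul_zero]

end Fierz

end GenCY
end

noncomputable section
namespace GenCY

/-! ### The moment map, the quartic invariant and the explicit form of `ρ̂` -/

section Moment

theorem sum_gW_dual (y : W ℝ) : ∑ a, gW y (eW a) • eW (dualIdx a) = y := by
  rw [← Equiv.sum_comp dualIdx_involutive.toPerm]
  simpa [dualIdx_dualIdx] using sum_gW_eW y

theorem trace_eq_sum (T : Module.End ℝ (W ℝ)) :
    LinearMap.trace ℝ (W ℝ) T = ∑ a, gW (T (eW a)) (eW (dualIdx a)) := by
  have h : T = ∑ a, (gW.flip (eW (dualIdx a))).smulRight (T (eW a)) := by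
    refine LinearMap.ext fun x => ?_
    conv_lhs => rw [← sum_gW_eW x, map_sum]
    simp [LinearMap.sum_apply]
  conv_lhs => rw [h, map_sum]
  refine Finset.sum_congr rfl fun a _ => ?_
  rw [LinearMap.trace_smulRight]
  rfl

/-- The polarized moment map. -/
def mom₂ (ρ σ : Mixed ℝ) : Module.End ℝ (W ℝ) :=
  (1 / 4 : ℝ) • ∑ b, ((pr.flip σ) ∘ₗ (cl.flip (cl (eW (dualIdx b)) ρ))).smulRight (eW b)

/-- The moment map of the spin representation. -/
abbrev mom (ρ : Mixed ℝ) : Module.End ℝ (W ℝ) := mom₂ ρ ρ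

theorem mom₂_apply (ρ σ : Mixed ℝ) (x : W ℝ) :
    mom₂ ρ σ x = (1 / 4 : ℝ) • ∑ b, pr (cl x (cl (eW (dualIdx b)) ρ)) σ • eW b := by
  simp [mom₂, LinearMap.sum_apply]

/-- As `gW` is nondegenerate, this formula characterizes `mom₂`; most identities for the moment map
are checked through it by `gW_ext`. -/
theorem gW_mom₂ (ρ σ : Mixed ℝ) (x y : W ℝ) :
    gW (mom₂ ρ σ x) y = (1 / 4 : ℝ) * pr (cl x (cl y ρ)) σ := by
  rw [mom₂_apply]
  simp only [map_smul, map_sum, LinearMap.smul_apply, LinearMap.sum_apply, smul_eq_mul]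
  congr 1
  conv_rhs => rw [← sum_gW_dual y]
  simp only [map_smul, map_sum, LinearMap.smul_apply, LinearMap.sum_apply, smul_eq_mul]
  exact Finset.sum_congr rfl fun a _ => by rw [gW_comm y, mul_comm]

/-- Skew endomorphisms of `V ⊕ V*`. -/
def Skew (a : Module.End ℝ (W ℝ)) : Prop := ∀ x y, gW (a x) y = -gW x (a y)

theorem isSo_iff (a : Module.End ℝ (W ℝ)) : IsSo a ↔ Skew a := by
  unfold IsSo Skew
  simp only [innerW_eq]
  refine forall₂_congr fun x y => ⟨fun h => by linarith, fun h => by linarith⟩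

theorem pr_cl_cl_swap (x y : W ℝ) (ρ : Mixed ℝ) :
    pr (cl x (cl y ρ)) ρ = -pr (cl y (cl x ρ)) ρ := by
  rw [cl_cl_swap, map_sub, map_smul, LinearMap.sub_apply, LinearMap.smul_apply, pr_self]
  simp

theorem skew_mom (ρ : Mixed ℝ) : Skew (mom ρ) := by
  intro x y
  rw [gW_mom₂, gW_comm, gW_mom₂, pr_cl_cl_swap]
  ring

theorem spin_eq (a : Module.End ℝ (W ℝ)) (φ : Mixed ℝ) :
    spin a φ = (1 / 2 : ℝ) • ∑ b, cl (a (eW b)) (cl (eW (dualIdx b)) φ) := by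
  rw [sum_nIdx]
  rfl

/-- The spin action of an endomorphism as a linear map. -/
def spinL (a : Module.End ℝ (W ℝ)) : Mixed ℝ →ₗ[ℝ] Mixed ℝ :=
  (1 / 2 : ℝ) • ∑ b, cl (a (eW b)) ∘ₗ cl (eW (dualIdx b))

theorem spinL_apply (a : Module.End ℝ (W ℝ)) (φ : Mixed ℝ) :
    spinL a φ = (1 / 2 : ℝ) • ∑ b, cl (a (eW b)) (cl (eW (dualIdx b)) φ) := by
  simp [spinL, LinearMap.sum_apply]

theorem spin_eq_spinL (a : Module.End ℝ (W ℝ)) (φ : Mixed ℝ) : spin a φ = spinL a φ := by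
  rw [spin_eq, spinL_apply]

theorem spinL_smul (c : ℝ) (a : Module.End ℝ (W ℝ)) (φ : Mixed ℝ) :
    spinL (c • a) φ = c • spinL a φ := by
  rw [spinL_apply, spinL_apply, smul_comm c, Finset.smul_sum (r := c)]
  simp

theorem trace_mom₂_mul (ρ σ : Mixed ℝ) (a : Module.End ℝ (W ℝ)) :
    LinearMap.trace ℝ (W ℝ) (mom₂ ρ σ * a) = (1 / 2 : ℝ) * pr (spinL a ρ) σ := by
  rw [trace_eq_sum, spinL_apply]
  simp only [Module.End.mul_apply, gW_mom₂, map_smul, map_sum, LinearMap.smul_apply,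
    LinearMap.sum_apply, smul_eq_mul, Finset.mul_sum]
  refine Finset.sum_congr rfl fun b _ => ?_
  ring

theorem isMoment_mom (ρ : Mixed ℝ) : IsMoment ρ (mom ρ) :=
  ⟨(isSo_iff _).2 (skew_mom ρ), fun a _ => by rw [trace_mom₂_mul, spin_eq_spinL, pr_apply]⟩

/-- The elementary skew endomorphism `x ∧ y`. -/
def wedgeEnd (x y : W ℝ) : Module.End ℝ (W ℝ) := (gW x).smulRight y - (gW y).smulRight x

theorem wedgeEnd_apply (x y z : W ℝ) : wedgeEnd x y z = gW x z • y - gW y z • x := rfl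

theorem skew_wedgeEnd (x y : W ℝ) : Skew (wedgeEnd x y) := by
  intro z w
  rw [wedgeEnd_apply, wedgeEnd_apply]
  simp only [map_sub, map_smul, LinearMap.sub_apply, LinearMap.smul_apply, smul_eq_mul]
  rw [gW_comm z x, gW_comm z y]
  ring

/-- The trace form is nondegenerate on skew endomorphisms: for skew `Z`, the trace of `Z` times `x ∧
y` is `2 g(x, Z y)`, so testing on elementary elements recovers all entries. This pins down the
choice made in `moment`. -/
theorem isMoment_unique {ρ : Mixed ℝ} {X Y : Module.End ℝ (W ℝ)} (hX : IsMoment ρ X)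
    (hY : IsMoment ρ Y) : X = Y := by
  have hs : Skew (X - Y) := by
    intro x y
    have h1 := (isSo_iff X).1 hX.1 x y
    have h2 := (isSo_iff Y).1 hY.1 x y
    simp only [LinearMap.sub_apply, map_sub]
    linarith
  rw [← sub_eq_zero]
  refine LinearMap.ext fun y => gW_ext fun x => ?_
  have h1 := hX.2 (wedgeEnd x y) ((isSo_iff _).2 (skew_wedgeEnd x y))
  have h2 := hY.2 (wedgeEnd x y) ((isSo_iff _).2 (skew_wedgeEnd x y))
  have h3 : LinearMap.trace ℝ (W ℝ) ((X - Y) * wedgeEnd x y) = 0 := by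
    rw [sub_mul, map_sub, h1, h2, sub_self]
  have h4 : (X - Y) * wedgeEnd x y =
      (gW x).smulRight ((X - Y) y) - (gW y).smulRight ((X - Y) x) := by
    refine LinearMap.ext fun z => ?_
    rw [Module.End.mul_apply, wedgeEnd_apply, map_sub, map_smul, map_smul]
    rfl
  rw [h4, map_sub, LinearMap.trace_smulRight, LinearMap.trace_smulRight, gW_comm y, hs] at h3
  rw [LinearMap.zero_apply, map_zero, LinearMap.zero_apply, gW_comm]
  linarith

theorem moment_eq (ρ : Mixed ℝ) : moment ρ = mom ρ :=
  isMoment_unique (Classical.epsilon_spec (p := IsMoment ρ) ⟨_, isMoment_mom ρ⟩) (isMoment_mom ρ)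

/-- The cubic covariant `μ(ρ)·ρ`. -/
def cub (ρ : Mixed ℝ) : Mixed ℝ := spinL (mom ρ) ρ

theorem quartic_eq_trace (ρ : Mixed ℝ) : quartic ρ = LinearMap.trace ℝ (W ℝ) (mom ρ * mom ρ) := by
  rw [quartic, moment_eq]

theorem quartic_eq (ρ : Mixed ℝ) : quartic ρ = (1 / 2 : ℝ) * pr (cub ρ) ρ := by
  rw [quartic_eq_trace, trace_mom₂_mul, cub]

theorem trace_skew {a : Module.End ℝ (W ℝ)} (ha : Skew a) :
    ∑ b, gW (eW (dualIdx b)) (a (eW b)) = 0 := by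
  have h : ∑ b, gW (eW (dualIdx b)) (a (eW b)) = -∑ b, gW (eW (dualIdx b)) (a (eW b)) := by
    conv_lhs => rw [← Equiv.sum_comp dualIdx_involutive.toPerm]
    rw [← Finset.sum_neg_distrib]
    refine Finset.sum_congr rfl fun b _ => ?_
    simp only [Function.Involutive.coe_toPerm, dualIdx_dualIdx]
    rw [gW_comm, ha]
  linarith

theorem spinL_cl {a : Module.End ℝ (W ℝ)} (ha : Skew a) (x : W ℝ) (φ : Mixed ℝ) :
    spinL a (cl x φ) = cl x (spinL a φ) + cl (a x) φ := by
  have h1 : ∑ b, gW (eW (dualIdx b)) x • cl (a (eW b)) φ = cl (a x) φ := by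
    conv_rhs => rw [← sum_gW_eW x]
    simp only [map_sum, map_smul, LinearMap.sum_apply, LinearMap.smul_apply, gW_comm x]
  have h2 : ∑ b, gW (a (eW b)) x • cl (eW (dualIdx b)) φ = -cl (a x) φ := by
    conv_rhs => rw [← sum_gW_dual (a x)]
    simp only [map_sum, map_smul, LinearMap.sum_apply, LinearMap.smul_apply, gW_comm (a x)]
    rw [← Finset.sum_neg_distrib]
    exact Finset.sum_congr rfl fun b _ => by rw [ha, neg_smul]
  have h3 : ∀ b, cl (a (eW b)) (cl (eW (dualIdx b)) (cl x φ)) =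
      gW (eW (dualIdx b)) x • cl (a (eW b)) φ - gW (a (eW b)) x • cl (eW (dualIdx b)) φ +
        cl x (cl (a (eW b)) (cl (eW (dualIdx b)) φ)) := by
    intro b
    rw [cl_cl_swap (eW (dualIdx b)) x, map_sub, map_smul, cl_cl_swap (a (eW b)) x]
    abel
  rw [spinL_apply, spinL_apply]
  simp only [h3, Finset.sum_add_distrib, Finset.sum_sub_distrib, h1, h2, map_smul, map_sum]
  module

/-- The adjoint of `½ ∑ a(e_b) e^b` has the two factors reversed. Restoring the order changes the
sign and adds a multiple of the trace of `a`, which is zero. -/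
theorem pr_spinL {a : Module.End ℝ (W ℝ)} (ha : Skew a) (φ ψ : Mixed ℝ) :
    pr (spinL a φ) ψ = -pr φ (spinL a ψ) := by
  rw [spinL_apply, spinL_apply]
  simp only [map_smul, map_sum, LinearMap.smul_apply, LinearMap.sum_apply, pr_cl, smul_eq_mul]
  have h : ∀ b, pr φ (cl (eW (dualIdx b)) (cl (a (eW b)) ψ)) =
      gW (eW (dualIdx b)) (a (eW b)) * pr φ ψ -
        pr φ (cl (a (eW b)) (cl (eW (dualIdx b)) ψ)) := by
    intro b
    rw [cl_cl_swap, map_sub, map_smul, smul_eq_mul]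
  simp only [h, Finset.sum_sub_distrib, ← Finset.sum_mul, trace_skew ha]
  ring

theorem fierzL_eq_spinL (ρ σ : Mixed ℝ) : fierzL ρ σ = (8 : ℝ) • spinL (mom ρ) σ := by
  rw [fierzL_apply, spinL_apply, smul_smul, Finset.smul_sum]
  refine Finset.sum_congr rfl fun a _ => ?_
  rw [mom₂_apply, map_smul, map_sum, LinearMap.smul_apply, LinearMap.sum_apply, smul_smul]
  norm_num

theorem fierzR_cl (ρ : Mixed ℝ) (w : W ℝ) : fierzR ρ (cl w ρ) = -(4 : ℝ) • cl (mom ρ w) ρ := by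
  rw [fierzR_apply, mom₂_apply, map_smul, map_sum, LinearMap.smul_apply, LinearMap.sum_apply,
    smul_smul, Finset.smul_sum]
  refine Finset.sum_congr rfl fun a _ => ?_
  rw [map_smul, LinearMap.smul_apply, smul_smul, pr_cl_cl_swap]
  congr 1
  ring

/-- The cubic identity for half-spinors. -/
theorem cl_cub {p : ZMod 2} {ρ : Mixed ℝ} (hρ : HasParity p ρ) (w : W ℝ) :
    cl w (cub ρ) = -(3 : ℝ) • cl (mom ρ w) ρ := by
  -- With `σ = w·ρ` the identity reads `8 (w·(μ·ρ) + (μ w)·ρ) = -16 (μ w)·ρ`, which is the source of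
  -- the factor `-3`.
  have h1 := fierz hρ (hρ.cl w)
  rw [fierzL_eq_spinL, fierzR_cl, spinL_cl (skew_mom ρ)] at h1
  have h2 : (8 : ℝ) • cl w (cub ρ) = (8 : ℝ) • (-(3 : ℝ) • cl (mom ρ w) ρ) := by
    rw [smul_add] at h1
    rw [cub, eq_sub_of_add_eq h1]
    module
  exact smul_right_injective _ (by norm_num : (8 : ℝ) ≠ 0) h2

/-- By `cl_cub`, `g(μ² w, y)` is `⟨y·w·(μ·ρ), ρ⟩ / 12`. It is symmetric in `w` and `y` because `μ`
is skew, so it equals its own symmetrization, which the Clifford relation evaluates as `g(w, y)⟨μ·ρ,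
ρ⟩ / 24 = q g(w, y) / 12`. -/
theorem mom_mom {p : ZMod 2} {ρ : Mixed ℝ} (hρ : HasParity p ρ) (w : W ℝ) :
    mom ρ (mom ρ w) = (quartic ρ / 12) • w := by
  have h1 : ∀ w y, gW (mom ρ (mom ρ w)) y = (1 / 12 : ℝ) * pr (cl y (cl w (cub ρ))) ρ := by
    intro w y
    rw [gW_mom₂, pr_cl_cl_swap, cl_cub hρ, map_smul, map_smul, LinearMap.smul_apply, smul_eq_mul]
    ring
  refine gW_ext fun y => ?_
  have h2 : gW (mom ρ (mom ρ w)) y = gW (mom ρ (mom ρ y)) w := by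
    rw [skew_mom, skew_mom, neg_neg, gW_comm]
  have h3 := congrArg (fun φ => pr φ ρ) (cl_cl y w (cub ρ))
  simp only [map_add, map_smul, LinearMap.add_apply, LinearMap.smul_apply, smul_eq_mul] at h3
  have h4 := h1 w y
  have h5 := h1 y w
  rw [map_smul, LinearMap.smul_apply, smul_eq_mul, quartic_eq, gW_comm w y]
  linarith

/-- If `w·ρ = 0`, then `μ w = 0`, while `μ²` is a nonzero scalar. -/
theorem cl_injective {p : ZMod 2} {ρ : Mixed ℝ} (hρ : HasParity p ρ) (hq : quartic ρ ≠ 0)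
    {w : W ℝ} (hw : cl w ρ = 0) : w = 0 := by
  have h1 : mom ρ w = 0 := by
    refine gW_ext fun y => ?_
    rw [gW_mom₂, pr_cl_cl_swap, hw, map_zero]
    simp
  have h2 := mom_mom hρ w
  rw [h1, map_zero] at h2
  exact (smul_eq_zero.1 h2.symm).resolve_left (by
    intro h; apply hq; linarith)

/-- The explicit formula for `ρ̂`. -/
def hatE (ρ : Mixed ℝ) : Mixed ℝ := -(1 / (3 * Real.sqrt (-quartic ρ / 12))) • cub ρ

/-- The complex structure defined by a stable form. -/
def cpx (ρ : Mixed ℝ) : Module.End ℝ (W ℝ) := (1 / Real.sqrt (-quartic ρ / 12)) • mom ρ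

variable {p : ZMod 2} {ρ : Mixed ℝ}

theorem sqrt_pos_of_stable (hq : quartic ρ < 0) : 0 < Real.sqrt (-quartic ρ / 12) :=
  Real.sqrt_pos.2 (by linarith)

/-- A rescaling of `cl_cub`. Together with `cpx_cpx` it says that `J y + i y` annihilates `ρ + iρ̂`
for every `y`, where `J = cpx ρ`. -/
theorem cl_hatE (hρ : HasParity p ρ) (w : W ℝ) : cl w (hatE ρ) = cl (cpx ρ w) ρ := by
  rw [hatE, cpx, map_smul, cl_cub hρ, LinearMap.smul_apply, map_smul, LinearMap.smul_apply,
    smul_smul]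
  congr 1
  rw [one_div, one_div, mul_inv]
  ring

theorem cpx_cpx (hρ : HasParity p ρ) (hq : quartic ρ < 0) (w : W ℝ) : cpx ρ (cpx ρ w) = -w := by
  have hs := sqrt_pos_of_stable hq
  have hs2 : Real.sqrt (-quartic ρ / 12) ^ 2 = -quartic ρ / 12 := Real.sq_sqrt (by linarith)
  rw [cpx, LinearMap.smul_apply, LinearMap.smul_apply, map_smul, mom_mom hρ, smul_smul, smul_smul,
    ← neg_one_smul ℝ w]
  congr 1
  have h : quartic ρ / 12 = -Real.sqrt (-quartic ρ / 12) ^ 2 := by rw [hs2]; ring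
  rw [h]
  generalize Real.sqrt (-quartic ρ / 12) = s at hs
  field_simp

/-- Here `⟨μ·ρ, ρ⟩ = 2q` is negative; the minus sign in `hatE` is the choice between `ρ̂` and `-ρ̂`
imposed by positivity. -/
theorem pr_hatE_pos (hq : quartic ρ < 0) : 0 < pr (hatE ρ) ρ := by
  have hs := sqrt_pos_of_stable hq
  have h : pr (cub ρ) ρ = 2 * quartic ρ := by rw [quartic_eq]; ring
  rw [hatE, map_smul, LinearMap.smul_apply, smul_eq_mul, h]
  have : 0 < 1 / (3 * Real.sqrt (-quartic ρ / 12)) := by positivity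
  nlinarith

theorem spinL_cpx (ρ : Mixed ℝ) : spinL (cpx ρ) ρ = -(3 : ℝ) • hatE ρ := by
  rw [cpx, spinL_smul, hatE, smul_smul, cub]
  congr 1
  rw [one_div, one_div, mul_inv]
  ring

theorem HasParity.smul (h : HasParity p ρ) (c : ℝ) : HasParity p (c • ρ) := fun k hk => by
  rw [Pi.smul_apply, h k hk, smul_zero]

theorem HasParity.add {σ : Mixed ℝ} (h : HasParity p ρ) (h' : HasParity p σ) :
    HasParity p (ρ + σ) := fun k hk => by
  rw [Pi.add_apply, h k hk, h' k hk, add_zero]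

theorem HasParity.spinL (h : HasParity p ρ) (a : Module.End ℝ (W ℝ)) :
    HasParity p (spinL a ρ) := by
  rw [spinL_apply]
  refine HasParity.smul ?_ _
  intro k hk
  rw [Finset.sum_apply]
  refine Finset.sum_eq_zero fun b _ => ?_
  refine ((h.cl _).cl _) k ?_
  rwa [add_assoc, CharTwo.add_self_eq_zero, add_zero]

theorem HasParity.hatE (h : HasParity p ρ) : HasParity p (hatE ρ) :=
  (h.spinL _).smul _

/-- A second solution `χ` of the equations characterizing `ρ̂` agrees with it. -/
theorem eq_hatE_of_skew (hρ : HasParity p ρ) (hq : quartic ρ < 0) {χ : Mixed ℝ}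
    {K : Module.End ℝ (W ℝ)} (hK : Skew K) (h1 : ∀ y, cl y χ = cl (K y) ρ)
    (h2 : ∀ y, cl (K y) χ = -cl y ρ) (hpos : 0 < pr χ ρ) : χ = hatE ρ := by
  have hinj : ∀ {w}, cl w ρ = 0 → w = 0 := cl_injective hρ hq.ne
  have hKK : ∀ y, K (K y) = -y := by
    intro y
    have : cl (K (K y) + y) ρ = 0 := by
      rw [map_add, LinearMap.add_apply, ← h1, h2]; simp
    exact eq_neg_of_add_eq_zero_left (hinj this)
  have hsum : ∀ φ, ∑ b, cl (eW (dualIdx b)) (cl (eW b) φ) = (6 : ℝ) • φ := by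
    intro φ
    have e : ∑ b, cl (eW (dualIdx b)) (cl (eW b) φ) = ∑ b, cl (eW b) (cl (eW (dualIdx b)) φ) := by
      rw [← Equiv.sum_comp dualIdx_involutive.toPerm]
      simp [dualIdx_dualIdx]
    have e2 : ∑ b, cl (eW (dualIdx b)) (cl (eW b) φ) + ∑ b, cl (eW b) (cl (eW (dualIdx b)) φ) =
        (12 : ℝ) • φ := by
      rw [← Finset.sum_add_distrib]
      have : ∀ b, cl (eW (dualIdx b)) (cl (eW b) φ) + cl (eW b) (cl (eW (dualIdx b)) φ) = φ := by
        intro b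
        rw [add_comm, cl_cl, gW_eW, if_pos rfl, one_smul]
      simp only [this, Finset.sum_const, Finset.card_univ]
      rw [← Nat.cast_smul_eq_nsmul ℝ]
      simp
    rw [← e, ← two_smul ℝ] at e2
    apply smul_right_injective _ (two_ne_zero (α := ℝ))
    simp only [e2, smul_smul]
    norm_num
  have hspin : ∀ φ φ', (∀ y, cl (K y) φ = cl y φ') → spinL K φ = -(3 : ℝ) • φ' := by
    intro φ φ' h
    rw [spinL_apply]
    have e : ∀ b, cl (K (eW b)) (cl (eW (dualIdx b)) φ) =
        gW (eW (dualIdx b)) (K (eW b)) • φ - cl (eW (dualIdx b)) (cl (eW b) φ') := by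
      intro b
      rw [cl_cl_swap, h, gW_comm]
    simp only [e, Finset.sum_sub_distrib, ← Finset.sum_smul, trace_skew hK, hsum]
    module
  -- Both `χ` and `ρ̂` are recovered from their complex structures as `-⅓` of the spin action on
  -- `ρ`, so it remains to prove `K = cpx ρ`.
  have hsρ : spinL K ρ = -(3 : ℝ) • χ := hspin ρ χ fun y => (h1 y).symm
  have hP : ∀ y z, gW (mom ρ z) y = (1 / 4 : ℝ) * pr (cl y ρ) (cl z ρ) := by
    intro y z
    rw [gW_mom₂, pr_cl]
  have hcl : ∀ y, spinL K (cl y ρ) = -(2 : ℝ) • cl (K y) ρ := by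
    intro y
    rw [spinL_cl hK, hsρ, map_smul, h1]
    module
  -- The spin action of `K` multiplies `y·ρ` into `-2 (K y)·ρ`; invariance of the pairing on `y·ρ`
  -- and `z·ρ` then makes `K` skew for the bilinear form of `μ`.
  have hcomm : ∀ z, mom ρ (K z) = K (mom ρ z) := by
    intro z
    refine gW_ext fun y => ?_
    have h3 := pr_spinL hK (cl y ρ) (cl z ρ)
    rw [hcl, hcl, map_smul, map_smul, LinearMap.smul_apply, smul_eq_mul, smul_eq_mul] at h3
    rw [hK, hP, hP]
    linarith
  -- The bilinear form `g(μ K z, y)` is symmetric since `μ` and `K` are skew and commute. The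
  -- Clifford relation, paired with `χ`, evaluates its symmetrization, so `μ K` is a scalar.
  have hanti : ∀ z, mom ρ (K z) = (pr ρ χ / 8) • z := by
    intro z
    refine gW_ext fun y => ?_
    have h3 := congrArg (fun φ => pr φ χ) (cl_cl z y ρ)
    simp only [map_add, map_smul, LinearMap.add_apply, LinearMap.smul_apply, smul_eq_mul] at h3
    rw [pr_cl z, pr_cl y (cl z ρ), h1, h1] at h3
    have h4 : gW (mom ρ (K y)) z = gW (mom ρ (K z)) y := by
      rw [hcomm, hK, skew_mom, neg_neg, gW_comm]
    rw [hP] at h4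
    have h5 := hP y (K z)
    rw [map_smul, LinearMap.smul_apply, smul_eq_mul]
    linarith
  -- Apply `μ` to `μ K z = (⟨ρ, χ⟩/8) z` and use `μ² = q/12`. The factor is positive because `⟨ρ,
  -- χ⟩` and `q` are both negative.
  obtain ⟨c, hc, hcK⟩ : ∃ c : ℝ, 0 < c ∧ K = c • mom ρ := by
    refine ⟨12 * (pr ρ χ / 8) / quartic ρ, ?_, LinearMap.ext fun z => ?_⟩
    · rw [pr_skew]
      apply div_pos_of_neg_of_neg _ hq
      linarith
    · have h3 := congrArg (mom ρ) (hanti z)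
      rw [mom_mom hρ, map_smul] at h3
      have h4 := congrArg (fun x => (12 / quartic ρ) • x) h3
      simp only [smul_smul] at h4
      have h5 : 12 / quartic ρ * (quartic ρ / 12) = 1 := by
        have := hq.ne
        field_simp
      rw [h5, one_smul] at h4
      rw [h4, LinearMap.smul_apply]
      congr 1
      ring
  -- `K² = -1` and `μ² = q/12` determine `c²`, evaluated on one nonzero basis vector.
  have hc2 : c = 1 / Real.sqrt (-quartic ρ / 12) := by
    have hs := sqrt_pos_of_stable hq
    have hs2 : Real.sqrt (-quartic ρ / 12) ^ 2 = -quartic ρ / 12 := Real.sq_sqrt (by linarith)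
    have h3 := hKK (eW (0, false))
    rw [hcK, LinearMap.smul_apply, LinearMap.smul_apply, map_smul, mom_mom hρ, smul_smul,
      smul_smul] at h3
    have h4 := congrArg (fun x => gW x (eW (dualIdx (0, false)))) h3
    simp only [map_smul, map_neg, LinearMap.smul_apply, LinearMap.neg_apply, smul_eq_mul, gW_eW,
      if_true] at h4
    have h5 : (c * Real.sqrt (-quartic ρ / 12)) ^ 2 = 1 := by
      rw [mul_pow, hs2]; linarith
    rw [eq_div_iff hs.ne']
    exact (pow_eq_one_iff_of_nonneg (by positivity) two_ne_zero).1 h5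
  have h3 : spinL K ρ = -(3 : ℝ) • hatE ρ := by
    rw [← spinL_cpx, cpx, ← hc2, ← hcK]
  rw [hsρ] at h3
  exact smul_right_injective _ (by norm_num : -(3 : ℝ) ≠ 0) h3

end Moment

end GenCY
end

noncomputable section
namespace GenCY

/-! ### Complex pure spinors in terms of real forms, and the uniqueness of `ρ̂` -/

section Complexification

/-- Complexification of a real form. -/
abbrev ofR {k : ℕ} (a : V6 [⋀^Fin k]→L[ℝ] ℝ) : V6 [⋀^Fin k]→L[ℝ] ℂ :=
  Complex.ofRealCLM.compContinuousAlternatingMap a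

theorem wedge_ofR {k l n : ℕ} (h : k + l = n) (a : V6 [⋀^Fin k]→L[ℝ] ℝ)
    (b : V6 [⋀^Fin l]→L[ℝ] ℝ) : wedge h (ofR a) (ofR b) = ofR (wedge h a b) := by
  ext v
  change _ = ((wedge h a b v : ℝ) : ℂ)
  rw [wedge_apply, wedge_apply, Complex.ofReal_sum]
  refine Finset.sum_congr rfl fun σ _ => ?_
  induction σ using Quotient.inductionOn' with | h σ => ?_
  rw [mul_summand, mul_summand, zsmul_eq_mul, zsmul_eq_mul]
  push_cast
  rfl

/-- The complex form `a + ib`. -/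
def cplx {k : ℕ} (a b : V6 [⋀^Fin k]→L[ℝ] ℝ) : V6 [⋀^Fin k]→L[ℝ] ℂ := ofR a + Complex.I • ofR b

theorem toComplex_apply (α β : Mixed ℝ) (k : ℕ) : toComplex α β k = cplx (α k) (β k) := rfl

theorem cplx_apply {k : ℕ} (a b : V6 [⋀^Fin k]→L[ℝ] ℝ) (v : Fin k → V6) :
    cplx a b v = ⟨a v, b v⟩ := by
  change (a v : ℂ) + Complex.I * (b v : ℂ) = _
  rw [Complex.mk_eq_add_mul_I, mul_comm]

theorem cplx_inj {k : ℕ} {a b a' b' : V6 [⋀^Fin k]→L[ℝ] ℝ} (h : cplx a b = cplx a' b') :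
    a = a' ∧ b = b' := by
  constructor
  · ext v
    have := congrArg (fun f => (f v).re) h
    simpa only [cplx_apply] using this
  · ext v
    have := congrArg (fun f => (f v).im) h
    simpa only [cplx_apply] using this

theorem wedge_cplx {k l n : ℕ} (h : k + l = n) (a a' : V6 [⋀^Fin k]→L[ℝ] ℝ)
    (b b' : V6 [⋀^Fin l]→L[ℝ] ℝ) :
    wedge h (cplx a a') (cplx b b') =
      cplx (wedge h a b - wedge h a' b') (wedge h a b' + wedge h a' b) := by
  rw [cplx, cplx, wedge_add_left, wedge_add_right, wedge_add_right, wedge_smul_left,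
    wedge_smul_left, wedge_smul_right, wedge_smul_right]
  simp only [wedge_ofR]
  ext v
  rw [cplx_apply]
  change (wedge h a b v : ℂ) + Complex.I * (wedge h a b' v : ℂ) +
    (Complex.I * (wedge h a' b v : ℂ) + Complex.I * (Complex.I * (wedge h a' b' v : ℂ))) =
    ⟨wedge h a b v - wedge h a' b' v, wedge h a b' v + wedge h a' b v⟩
  apply Complex.ext <;> simp [sub_eq_add_neg]

/-- The element `x + iy` of the complexification of `V ⊕ V*`. -/
def mkW (x y : W ℝ) : W ℂ :=
  (WithLp.toLp 2 fun i => (⟨x.1 i, y.1 i⟩ : ℂ),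
    Complex.ofRealCLM.comp x.2 + Complex.I • Complex.ofRealCLM.comp y.2)

/-- The real part of an element of the complexification. -/
def reW (w : W ℂ) : W ℝ := (WithLp.toLp 2 fun i => (w.1 i).re, Complex.reCLM.comp w.2)

/-- The imaginary part of an element of the complexification. -/
def imW (w : W ℂ) : W ℝ := (WithLp.toLp 2 fun i => (w.1 i).im, Complex.imCLM.comp w.2)

theorem mkW_re_im (w : W ℂ) : mkW (reW w) (imW w) = w := by
  refine Prod.ext ?_ ?_
  · ext i
    rfl
  · refine ContinuousLinearMap.ext fun v => ?_
    change ((w.2 v).re : ℂ) + Complex.I * ((w.2 v).im : ℂ) = w.2 v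
    rw [mul_comm]
    exact Complex.re_add_im _

theorem reW_mkW (x y : W ℝ) : reW (mkW x y) = x := by
  refine Prod.ext ?_ ?_
  · ext i
    rfl
  · refine ContinuousLinearMap.ext fun v => ?_
    change ((x.2 v : ℂ) + Complex.I * (y.2 v : ℂ)).re = x.2 v
    simp

theorem imW_mkW (x y : W ℝ) : imW (mkW x y) = y := by
  refine Prod.ext ?_ ?_
  · ext i
    rfl
  · refine ContinuousLinearMap.ext fun v => ?_
    change ((x.2 v : ℂ) + Complex.I * (y.2 v : ℂ)).im = y.2 v
    simp

theorem mkW_add (x y x' y' : W ℝ) : mkW (x + x') (y + y') = mkW x y + mkW x' y' := by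
  refine Prod.ext ?_ ?_
  · ext i
    apply Complex.ext <;> rfl
  · refine ContinuousLinearMap.ext fun v => ?_
    change ((x.2 v + x'.2 v : ℝ) : ℂ) + Complex.I * ((y.2 v + y'.2 v : ℝ) : ℂ) =
      ((x.2 v : ℂ) + Complex.I * (y.2 v : ℂ)) + ((x'.2 v : ℂ) + Complex.I * (y'.2 v : ℂ))
    push_cast
    ring

theorem ofSubsingleton_mkW (x y : W ℝ) :
    ContinuousAlternatingMap.ofSubsingleton ℝ V6 ℂ (0 : Fin 1) (mkW x y).2 =
      cplx (ContinuousAlternatingMap.ofSubsingleton ℝ V6 ℝ (0 : Fin 1) x.2)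
        (ContinuousAlternatingMap.ofSubsingleton ℝ V6 ℝ (0 : Fin 1) y.2) := rfl

theorem cplx_zero {k : ℕ} : cplx (0 : V6 [⋀^Fin k]→L[ℝ] ℝ) 0 = 0 := by
  ext v
  rw [cplx_apply]
  rfl

theorem cplx_add {k : ℕ} (a b a' b' : V6 [⋀^Fin k]→L[ℝ] ℝ) :
    cplx a b + cplx a' b' = cplx (a + a') (b + b') := by
  ext v
  change cplx a b v + cplx a' b' v = _
  simp only [cplx_apply]
  rfl

theorem cplx_sum {k : ℕ} {ι : Type*} (s : Finset ι) (a b : ι → V6 [⋀^Fin k]→L[ℝ] ℝ) :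
    ∑ i ∈ s, cplx (a i) (b i) = cplx (∑ i ∈ s, a i) (∑ i ∈ s, b i) := by
  classical
  induction s using Finset.induction_on with
  | empty => simp [cplx_zero]
  | insert i s hi ih => rw [Finset.sum_insert hi, Finset.sum_insert hi, Finset.sum_insert hi, ih,
      cplx_add]

/-- The complex Clifford action in terms of the real one. -/
theorem cliff_mkW (x y : W ℝ) (α β : Mixed ℝ) :
    cliff (mkW x y) (toComplex α β) =
      toComplex (cl x α - cl y β) (cl x β + cl y α) := by
  funext n
  have h1 : contract (mkW x y).1 (toComplex α β) n =
      cplx (contract x.1 α n - contract y.1 β n) (contract x.1 β n + contract y.1 α n) := by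
    simp only [contract]
    rw [← Finset.sum_sub_distrib, ← Finset.sum_add_distrib, ← cplx_sum]
    refine Finset.sum_congr rfl fun i _ => ?_
    ext v
    rw [cplx_apply]
    change (⟨x.1 i, y.1 i⟩ : ℂ) * (cplx (α (n + 1)) (β (n + 1)) (Matrix.vecCons (stdVec i) v)) = _
    rw [cplx_apply]
    apply Complex.ext
    · rfl
    · rfl
  have h2 : wedgeMixed (ContinuousAlternatingMap.ofSubsingleton ℝ V6 ℂ (0 : Fin 1) (mkW x y).2)
      (toComplex α β) n = cplx
        (wedgeMixed (ContinuousAlternatingMap.ofSubsingleton ℝ V6 ℝ (0 : Fin 1) x.2) α n -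
          wedgeMixed (ContinuousAlternatingMap.ofSubsingleton ℝ V6 ℝ (0 : Fin 1) y.2) β n)
        (wedgeMixed (ContinuousAlternatingMap.ofSubsingleton ℝ V6 ℝ (0 : Fin 1) x.2) β n +
          wedgeMixed (ContinuousAlternatingMap.ofSubsingleton ℝ V6 ℝ (0 : Fin 1) y.2) α n) := by
    rw [ofSubsingleton_mkW]
    simp only [wedgeMixed]
    split_ifs with h
    · rw [toComplex_apply, wedge_cplx]
    · rw [sub_zero, add_zero, cplx_zero]
  rw [cliff, Pi.add_apply, h1, h2, cplx_add, toComplex_apply]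
  congr 1
  · change _ = (contract x.1 α n + _) - (contract y.1 β n + _)
    abel
  · change _ = (contract x.1 β n + _) + (contract y.1 α n + _)
    abel

theorem half_toComplex (α β : Mixed ℝ) :
    (1 / 2 : ℂ) • toComplex α β = toComplex ((1 / 2 : ℝ) • α) ((1 / 2 : ℝ) • β) := by
  funext k
  ext v
  change (1 / 2 : ℂ) * (cplx (α k) (β k) v) = cplx ((1 / 2 : ℝ) • α k) ((1 / 2 : ℝ) • β k) v
  rw [cplx_apply, cplx_apply]
  apply Complex.ext
  · simp
  · simp

theorem toComplex_eq_zero {α β : Mixed ℝ} : toComplex α β = 0 ↔ α = 0 ∧ β = 0 := by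
  constructor
  · intro h
    have : ∀ k, α k = 0 ∧ β k = 0 := fun k => by
      have h2 := congrFun h k
      rw [toComplex_apply, Pi.zero_apply, ← cplx_zero] at h2
      exact cplx_inj h2
    exact ⟨funext fun k => (this k).1, funext fun k => (this k).2⟩
  · rintro ⟨rfl, rfl⟩
    funext k
    exact cplx_zero

theorem pairing_toComplex (α β α' β' : Mixed ℝ) :
    pairing (toComplex α β) (toComplex α' β') =
      ⟨pr α α' - pr β β', pr α β' + pr β α'⟩ := by
  simp only [pairing_eq_sum, pr_apply, toComplex_apply, wedge_cplx, cplx_apply]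
  apply Complex.ext
  · simp only [Complex.re_sum, ← Finset.sum_sub_distrib, ← mul_sub]
    refine Finset.sum_congr rfl fun k _ => ?_
    rcases neg_one_pow_eq_or ℂ ((k : ℕ) / 2) with h | h <;>
      rcases neg_one_pow_eq_or ℝ ((k : ℕ) / 2) with h' | h'
    · rw [h, h', one_mul, one_mul]; rfl
    · exact absurd (congrArg Complex.re h) (by
        rw [show ((-1 : ℂ) ^ ((k : ℕ) / 2)) = (((-1 : ℝ) ^ ((k : ℕ) / 2) : ℝ) : ℂ) by push_cast; rfl, h']
        norm_num)
    · exact absurd (congrArg Complex.re h) (by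
        rw [show ((-1 : ℂ) ^ ((k : ℕ) / 2)) = (((-1 : ℝ) ^ ((k : ℕ) / 2) : ℝ) : ℂ) by push_cast; rfl, h']
        norm_num)
    · rw [h, h', neg_one_mul, neg_one_mul]; rfl
  · simp only [Complex.im_sum, ← Finset.sum_add_distrib, ← mul_add]
    refine Finset.sum_congr rfl fun k _ => ?_
    rw [show ((-1 : ℂ) ^ ((k : ℕ) / 2)) = (((-1 : ℝ) ^ ((k : ℕ) / 2) : ℝ) : ℂ) by push_cast; rfl,
      Complex.im_ofReal_mul]
    rfl

theorem mem_annihilator_iff (α β : Mixed ℝ) (w : W ℂ) :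
    w ∈ annihilator ((1 / 2 : ℂ) • toComplex α β) ↔
      cl (reW w) α = cl (imW w) β ∧ cl (reW w) β = -cl (imW w) α := by
  change cliff w _ = 0 ↔ _
  conv_lhs => rw [← mkW_re_im w]
  rw [half_toComplex, cliff_mkW, toComplex_eq_zero]
  simp only [map_smul]
  rw [← smul_sub, ← smul_add, smul_eq_zero, smul_eq_zero, sub_eq_zero, add_eq_zero_iff_eq_neg]
  norm_num

/-- Skewness removes the diagonal terms, so the positivity required of the pure spinor is `⟨χ, ρ⟩ >
0`. -/
theorem pairing_half (ρ χ : Mixed ℝ) :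
    pairing ((1 / 2 : ℂ) • toComplex ρ χ) ((1 / 2 : ℂ) • toComplex ρ (-χ)) =
      Complex.I * ((1 / 2 * pr χ ρ : ℝ) : ℂ) := by
  rw [half_toComplex, half_toComplex, pairing_toComplex]
  simp only [map_smul, map_neg, LinearMap.smul_apply, pr_self, smul_eq_mul, smul_neg]
  rw [pr_skew ρ χ]
  apply Complex.ext
  · simp
  · simp
    ring

theorem isHat_pos {ρ χ : Mixed ℝ} (h : IsHat ρ χ) : 0 < pr χ ρ := by
  obtain ⟨-, -, r, hr, he⟩ := h
  rw [pairing_half] at he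
  have := mul_left_cancel₀ Complex.I_ne_zero he
  have h2 : (1 / 2 * pr χ ρ : ℝ) = r := by exact_mod_cast this
  linarith

/-- The imaginary part, as a real-linear map on the annihilator. -/
def imAnn (ψ : Mixed ℂ) : annihilator ψ →ₗ[ℝ] W ℝ where
  toFun w := imW w
  map_add' _ _ := rfl
  map_smul' c w := by
    refine Prod.ext ?_ ?_
    · ext i
      exact Complex.smul_im c _
    · refine ContinuousLinearMap.ext fun v => ?_
      exact Complex.smul_im c _

/-- The real part, as a real-linear map on the annihilator. -/
def reAnn (ψ : Mixed ℂ) : annihilator ψ →ₗ[ℝ] W ℝ where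
  toFun w := reW w
  map_add' _ _ := rfl
  map_smul' c w := by
    refine Prod.ext ?_ ?_
    · ext i
      exact Complex.smul_re c _
    · refine ContinuousLinearMap.ext fun v => ?_
      exact Complex.smul_re c _

theorem finrank_W : Module.finrank ℝ (W ℝ) = 12 := by
  have h : Module.finrank ℝ (V6 →L[ℝ] ℝ) = 6 := by
    rw [← (LinearMap.toContinuousLinearMap : (V6 →ₗ[ℝ] ℝ) ≃ₗ[ℝ] _).finrank_eq,
      Module.finrank_linearMap]
    simp
  rw [Module.finrank_prod, h]
  simp

theorem finrank_annihilator (ψ : Mixed ℂ) :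
    Module.finrank ℝ (annihilator ψ) = 2 * Module.finrank ℂ (annihilator ψ) := by
  have : Module.Free ℂ (annihilator ψ) :=
    @Module.Free.of_divisionRing ℂ (annihilator ψ) _ (Submodule.addCommGroup _) (Submodule.module _)
  rw [← Module.finrank_mul_finrank ℝ ℂ (annihilator ψ), Complex.finrank_real_complex]

variable {p : ZMod 2} {ρ : Mixed ℝ}

/-- A real element of the annihilator kills `ρ` and is therefore zero. Hence the annihilator is a
graph over its imaginary parts. -/
theorem ext_of_imW (hρ : HasParity p ρ) (hq : quartic ρ ≠ 0) (χ : Mixed ℝ) :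
    Function.Injective (imAnn ((1 / 2 : ℂ) • toComplex ρ χ)) := by
  rw [injective_iff_map_eq_zero]
  rintro ⟨w, hw⟩ h0
  have h0 : imW w = 0 := h0
  have h1 := ((mem_annihilator_iff _ _ _).1 hw).1
  rw [h0, map_zero, LinearMap.zero_apply] at h1
  have h2 := cl_injective hρ hq h1
  apply Subtype.ext
  change w = 0
  rw [← mkW_re_im w, h0, h2]
  have := mkW_add 0 0 0 0
  rw [add_zero] at this
  exact left_eq_add.1 this

theorem isHat_hatE (hρ : HasParity p ρ) (hq : quartic ρ < 0) : IsHat ρ (hatE ρ) := by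
  refine ⟨fun p' hp' => hp'.hatE, ?_, 1 / 2 * pr (hatE ρ) ρ, ?_, pairing_half _ _⟩
  · have hsurj : Function.Surjective (imAnn ((1 / 2 : ℂ) • toComplex ρ (hatE ρ))) := by
      intro y
      refine ⟨⟨mkW (cpx ρ y) y, ?_⟩, imW_mkW _ _⟩
      rw [mem_annihilator_iff, reW_mkW, imW_mkW, cl_hatE hρ, cl_hatE hρ, cpx_cpx hρ hq]
      simp
    have e := LinearEquiv.ofBijective _ ⟨ext_of_imW hρ hq.ne _, hsurj⟩
    have h1 := e.finrank_eq
    rw [finrank_W, finrank_annihilator] at h1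
    rw [IsPure]
    omega
  · have := pr_hatE_pos hq
    positivity

/-- Complex dimension six is real dimension twelve, so taking imaginary parts is a bijection onto `V
⊕ V*` and the annihilator is the graph `{K y + i y}` of some `K`. Its isotropy makes `K` skew, as
`eq_hatE_of_skew` requires. -/
theorem eq_hatE_of_isHat (hρ : HasParity p ρ) (hq : quartic ρ < 0) {χ : Mixed ℝ}
    (h : IsHat ρ χ) : χ = hatE ρ := by
  set ψ := (1 / 2 : ℂ) • toComplex ρ χ with hψ
  have hfin : Module.finrank ℝ (annihilator ψ) = Module.finrank ℝ (W ℝ) := by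
    rw [finrank_annihilator, finrank_W, h.2.1]
  have hinj := ext_of_imW hρ hq.ne χ
  have hbij : Function.Bijective (imAnn ψ) :=
    ⟨hinj, LinearMap.range_eq_top.1 (Submodule.eq_top_of_finrank_eq
      ((LinearMap.finrank_range_of_inj hinj).trans hfin))⟩
  let e := LinearEquiv.ofBijective _ hbij
  let K : Module.End ℝ (W ℝ) := reAnn ψ ∘ₗ e.symm.toLinearMap
  have hK : ∀ y, cl (K y) ρ = cl y χ ∧ cl (K y) χ = -cl y ρ := by
    intro y
    have h1 := (mem_annihilator_iff ρ χ _).1 (e.symm y).2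
    have h2 : imW (e.symm y : W ℂ) = y := e.apply_symm_apply y
    rw [h2] at h1
    exact h1
  refine eq_hatE_of_skew hρ hq (K := K) ?_ (fun y => (hK y).1.symm) (fun y => (hK y).2)
    (isHat_pos h)
  have hρ0 : ρ ≠ 0 := by
    rintro rfl
    have := isHat_pos h
    simp at this
  intro x y
  have h1 := cl_cl (K x) y ρ
  have h2 := cl_cl x (K y) ρ
  have h3 := cl_cl x y χ
  have h4 := cl_cl (K x) (K y) χ
  rw [(hK x).1] at h1
  rw [(hK y).1] at h2
  rw [(hK x).2, (hK y).2, map_neg, map_neg] at h4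
  -- The Clifford relations make these scalar multiples of `ρ` and `χ` equal. Pairing with `ρ` kills
  -- the left side and forces the coefficient of `χ` to vanish; then the coefficient of `ρ` vanishes
  -- as `ρ ≠ 0`.
  have h5 : (gW (K x) y + gW x (K y)) • ρ = (gW x y - gW (K x) (K y)) • χ := by
    rw [add_smul, sub_smul, ← h1, ← h2, ← h3, ← h4]
    abel
  have h6 := congrArg (fun φ => pr φ ρ) h5
  simp only [map_smul, LinearMap.smul_apply, pr_self, smul_eq_mul, mul_zero] at h6
  rw [(mul_eq_zero.1 h6.symm).resolve_right (isHat_pos h).ne', zero_smul] at h5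
  exact eq_neg_of_add_eq_zero_left ((smul_eq_zero.1 h5).resolve_right hρ0)

theorem hat_eq (hρ : HasParity p ρ) (hq : quartic ρ < 0) : hat ρ = hatE ρ :=
  eq_hatE_of_isHat hρ hq (Classical.epsilon_spec (p := IsHat ρ) ⟨_, isHat_hatE hρ hq⟩)

end Complexification

end GenCY
end

noncomputable section
namespace GenCY

/-! ### Equivariance under linear isomorphisms of `V` -/

section Pull

/-- The pullback of mixed forms by a linear map. -/
def pull (A : V6 →L[ℝ] V6) : Mixed ℝ →ₗ[ℝ] Mixed ℝ where
  toFun φ := fun k => (φ k).compContinuousLinearMap A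
  map_add' _ _ := rfl
  map_smul' _ _ := rfl

theorem pull_apply (A : V6 →L[ℝ] V6) (φ : Mixed ℝ) (k : ℕ) :
    pull A φ k = (φ k).compContinuousLinearMap A := rfl

theorem wedge_comp {k l n : ℕ} (h : k + l = n) (a : V6 [⋀^Fin k]→L[ℝ] ℝ)
    (b : V6 [⋀^Fin l]→L[ℝ] ℝ) (A : V6 →L[ℝ] V6) :
    wedge h (a.compContinuousLinearMap A) (b.compContinuousLinearMap A) =
      (wedge h a b).compContinuousLinearMap A := by
  ext v
  have hne : (k.factorial * l.factorial) ≠ 0 := by positivity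
  refine smul_right_injective ℝ hne ?_
  change (k.factorial * l.factorial) • _ = (k.factorial * l.factorial) • wedge h a b (A ∘ v)
  rw [factorial_smul_wedge_apply, factorial_smul_wedge_apply]
  rfl

theorem wm_pull {m : ℕ} (a : V6 [⋀^Fin m]→L[ℝ] ℝ) (A : V6 →L[ℝ] V6) (φ : Mixed ℝ) :
    wm (a.compContinuousLinearMap A) (pull A φ) = pull A (wm a φ) := by
  funext n
  rw [pull_apply, wm_apply, wm_apply]
  by_cases h : m ≤ n
  · rw [wedgeMixed_apply (Nat.add_sub_of_le h), wedgeMixed_apply (Nat.add_sub_of_le h), pull_apply,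
      wedge_comp]
  · rw [wedgeMixed_apply_of_lt (by omega), wedgeMixed_apply_of_lt (by omega)]
    rfl

theorem ann_pull (A : V6 →L[ℝ] V6) (v : V6) (φ : Mixed ℝ) :
    ann v (pull A φ) = pull A (ann (A v) φ) := by
  funext n
  rw [pull_apply, ann_apply, ann_apply, pull_apply]
  ext w
  change φ (n + 1) (A ∘ Matrix.vecCons v w) = φ (n + 1) (Matrix.vecCons (A v) (A ∘ w))
  congr 1
  funext i
  refine Fin.cases rfl (fun _ => rfl) i

theorem cre_pull (A : V6 →L[ℝ] V6) (ξ : V6 →L[ℝ] ℝ) (φ : Mixed ℝ) :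
    cre (ξ.comp A) (pull A φ) = pull A (cre ξ φ) := by
  rw [cre_eq, cre_eq]
  exact wm_pull (ContinuousAlternatingMap.ofSubsingleton ℝ V6 ℝ (0 : Fin 1) ξ) A φ

theorem form_six_comp (f : V6 [⋀^Fin 6]→L[ℝ] ℝ) (A : V6 →L[ℝ] V6) :
    f.compContinuousLinearMap A stdVec = A.det * f stdVec := by
  let e := (EuclideanSpace.basisFun (Fin 6) ℝ).toBasis
  have he : (e : Fin 6 → V6) = stdVec := by
    funext i
    simp [e, stdVec]
  have h : ∀ v, f v = f stdVec * e.det v := by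
    intro v
    have := congrArg (fun g => g v) (AlternatingMap.eq_smul_basis_det e f.toAlternatingMap)
    rw [← he]
    exact this
  change f (A ∘ stdVec) = _
  have h1 := Module.Basis.det_comp e (A : V6 →ₗ[ℝ] V6) stdVec
  have h2 : e.det stdVec = 1 := by rw [← he, e.det_self]
  rw [h, show (A ∘ stdVec) = ((A : V6 →ₗ[ℝ] V6) : V6 → V6) ∘ stdVec from rfl, h1, h2, mul_one,
    mul_comm]

theorem pr_pull (A : V6 →L[ℝ] V6) (φ ψ : Mixed ℝ) :
    pr (pull A φ) (pull A ψ) = A.det * pr φ ψ := by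
  rw [pr_apply, pr_apply, pairing_eq_sum, pairing_eq_sum, Finset.mul_sum]
  refine Finset.sum_congr rfl fun k _ => ?_
  rw [pull_apply, pull_apply, wedge_comp, form_six_comp]
  ring

theorem HasParity.pull {p : ZMod 2} {ρ : Mixed ℝ} (h : HasParity p ρ) (A : V6 →L[ℝ] V6) :
    HasParity p (pull A ρ) := fun k hk => by
  rw [pull_apply, h k hk]
  rfl

/-- The orthogonal transformation of `V ⊕ V*` induced by a linear isomorphism of `V`. -/
def wMap (A : V6 ≃L[ℝ] V6) : W ℝ ≃ₗ[ℝ] W ℝ where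
  toFun w := (A w.1, w.2.comp (A.symm : V6 →L[ℝ] V6))
  map_add' x y := Prod.ext (map_add A _ _) rfl
  map_smul' c x := Prod.ext (map_smul A _ _) rfl
  invFun w := (A.symm w.1, w.2.comp (A : V6 →L[ℝ] V6))
  left_inv x := Prod.ext (A.symm_apply_apply _) (by ext v; simp)
  right_inv x := Prod.ext (A.apply_symm_apply _) (by ext v; simp)

theorem wMap_apply (A : V6 ≃L[ℝ] V6) (w : W ℝ) :
    wMap A w = (A w.1, w.2.comp (A.symm : V6 →L[ℝ] V6)) := rfl

theorem cl_pull (A : V6 ≃L[ℝ] V6) (w : W ℝ) (φ : Mixed ℝ) :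
    cl w (pull A φ) = pull A (cl (wMap A w) φ) := by
  rw [cl_eq w, cl_eq (wMap A w), map_add, ann_pull, ← cre_pull, wMap_apply]
  congr 3
  ext v
  simp

theorem gW_wMap (A : V6 ≃L[ℝ] V6) (x y : W ℝ) : gW (wMap A x) (wMap A y) = gW x y := by
  rw [gW_apply, gW_apply, wMap_apply, wMap_apply]
  simp

theorem mom_pull (A : V6 ≃L[ℝ] V6) (ρ : Mixed ℝ) :
    mom (pull A ρ) = (A : V6 →L[ℝ] V6).det • (wMap A).symm.conj (mom ρ) := by
  refine LinearMap.ext fun x => gW_ext fun y => ?_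
  rw [gW_mom₂, cl_pull, cl_pull, pr_pull, LinearMap.smul_apply, map_smul, LinearMap.smul_apply,
    ← gW_wMap A (((wMap A).symm.conj (mom ρ)) x) y, LinearEquiv.conj_apply]
  simp only [LinearMap.comp_apply, LinearEquiv.coe_coe, LinearEquiv.apply_symm_apply,
    LinearEquiv.symm_symm, gW_mom₂, smul_eq_mul]
  ring

theorem quartic_pull (A : V6 ≃L[ℝ] V6) (ρ : Mixed ℝ) :
    quartic (pull A ρ) = (A : V6 →L[ℝ] V6).det ^ 2 * quartic ρ := by
  rw [quartic_eq_trace, quartic_eq_trace, mom_pull]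
  have : (wMap A).symm.conj (mom ρ) * (wMap A).symm.conj (mom ρ) =
      (wMap A).symm.conj (mom ρ * mom ρ) := ((wMap A).symm.conj_comp (mom ρ) (mom ρ)).symm
  rw [smul_mul_smul_comm, this, map_smul, LinearMap.trace_conj', smul_eq_mul, pow_two]

/-- One dual pair with `e_0 e^0 + e^0 e_0 = 1` already recovers a form from its Clifford products.
-/
theorem ext_cl {φ ψ : Mixed ℝ} (h : ∀ w, cl w φ = cl w ψ) : φ = ψ := by
  have h1 := cl_cl (stdVec 0, 0) (0, stdCovec 0) φ
  have h2 := cl_cl (stdVec 0, 0) (0, stdCovec 0) ψ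
  have h3 : gW (stdVec 0, 0) (0, stdCovec 0) = 1 := by
    rw [gW_apply]
    simp [stdVec, stdCovec]
  rw [h3, one_smul] at h1 h2
  rw [← h1, ← h2]
  simp only [h]

variable {p : ZMod 2} {ρ : Mixed ℝ}

/-- The action of `w` on both sides is known from `cl_cub` and `mom_pull`; the determinant enters
through the values of the pairing in `Λ⁶V*`. -/
theorem cub_pull (hρ : HasParity p ρ) (A : V6 ≃L[ℝ] V6) :
    cub (pull A ρ) = (A : V6 →L[ℝ] V6).det • pull A (cub ρ) := by
  refine ext_cl fun w => ?_
  rw [cl_cub (hρ.pull _), mom_pull, LinearMap.smul_apply, map_smul, map_smul, LinearMap.smul_apply,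
    cl_pull, cl_pull, cl_cub hρ, LinearEquiv.conj_apply]
  simp only [LinearMap.comp_apply, LinearEquiv.coe_coe, LinearEquiv.apply_symm_apply,
    LinearEquiv.symm_symm, map_smul]
  rw [smul_comm]

/-- The square root scales by `|det A|` and the cubic covariant by `det A`; they cancel precisely
because the orientation is preserved. -/
theorem hatE_pull (hρ : HasParity p ρ) (A : V6 ≃L[ℝ] V6) (hA : 0 < (A : V6 →L[ℝ] V6).det) :
    hatE (pull A ρ) = pull A (hatE ρ) := by
  rw [hatE, hatE, cub_pull hρ, quartic_pull, map_smul, smul_smul]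
  set d := (A : V6 →L[ℝ] V6).det
  have h : Real.sqrt (-(d ^ 2 * quartic ρ) / 12) = d * Real.sqrt (-quartic ρ / 12) := by
    rw [show -(d ^ 2 * quartic ρ) / 12 = d ^ 2 * (-quartic ρ / 12) by ring,
      Real.sqrt_mul (sq_nonneg d), Real.sqrt_sq hA.le]
  rw [h]
  congr 1
  generalize Real.sqrt (-quartic ρ / 12) = s
  rcases eq_or_ne s 0 with rfl | hs
  · simp
  · field_simp

theorem phi_comp (A : V6 ≃L[ℝ] V6) (hA : 0 < (A : V6 →L[ℝ] V6).det) (ρ : Mixed ℝ) :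
    (phi ρ).compContinuousLinearMap (A : V6 →L[ℝ] V6) stdVec =
      Real.sqrt (-quartic (pull A ρ) / 3) := by
  rw [form_six_comp, quartic_pull]
  set d := (A : V6 →L[ℝ] V6).det
  rw [show -(d ^ 2 * quartic ρ) / 3 = d ^ 2 * (-quartic ρ / 3) by ring,
      Real.sqrt_mul (sq_nonneg d), Real.sqrt_sq hA.le]
  rw [phi, ContinuousAlternatingMap.smul_apply, stdVol_stdVec, smul_eq_mul, mul_one]

end Pull

/-! ### The derivative of the volume density -/

section Derivative

theorem mom₂_add_left (ρ ρ' σ : Mixed ℝ) : mom₂ (ρ + ρ') σ = mom₂ ρ σ + mom₂ ρ' σ := by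
  refine LinearMap.ext fun x => gW_ext fun y => ?_
  rw [LinearMap.add_apply, map_add, LinearMap.add_apply]
  simp only [gW_mom₂, map_add, LinearMap.add_apply]
  ring

theorem mom₂_add_right (ρ σ σ' : Mixed ℝ) : mom₂ ρ (σ + σ') = mom₂ ρ σ + mom₂ ρ σ' := by
  refine LinearMap.ext fun x => gW_ext fun y => ?_
  rw [LinearMap.add_apply, map_add, LinearMap.add_apply]
  simp only [gW_mom₂, map_add]
  ring

theorem mom₂_smul_left (c : ℝ) (ρ σ : Mixed ℝ) : mom₂ (c • ρ) σ = c • mom₂ ρ σ := by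
  refine LinearMap.ext fun x => gW_ext fun y => ?_
  rw [LinearMap.smul_apply, map_smul, LinearMap.smul_apply]
  simp only [gW_mom₂, map_smul, LinearMap.smul_apply, smul_eq_mul]
  ring

theorem mom₂_smul_right (c : ℝ) (ρ σ : Mixed ℝ) : mom₂ ρ (c • σ) = c • mom₂ ρ σ := by
  refine LinearMap.ext fun x => gW_ext fun y => ?_
  rw [LinearMap.smul_apply, map_smul, LinearMap.smul_apply]
  simp only [gW_mom₂, map_smul, smul_eq_mul]
  ring

theorem trace_mom_mul_mom₂ (ρ σ : Mixed ℝ) :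
    LinearMap.trace ℝ (W ℝ) (mom₂ ρ σ * mom ρ) = 1 / 2 * pr (cub ρ) σ := by
  rw [trace_mom₂_mul]
  rfl

theorem trace_mom_mul_mom₂' (ρ σ : Mixed ℝ) :
    LinearMap.trace ℝ (W ℝ) (mom₂ σ ρ * mom ρ) = 1 / 2 * pr (cub ρ) σ := by
  rw [trace_mom₂_mul, pr_spinL (skew_mom ρ), pr_skew]
  simp [cub]

/-- The coefficients of `t ↦ quartic (ρ + t • σ)`. -/
theorem exists_quartic_add_smul (ρ σ : Mixed ℝ) : ∃ c₂ c₃ c₄ : ℝ, ∀ t : ℝ,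
    quartic (ρ + t • σ) =
      quartic ρ + t * (2 * pr (cub ρ) σ) + t ^ 2 * c₂ + t ^ 3 * c₃ + t ^ 4 * c₄ := by
  set T := LinearMap.trace ℝ (W ℝ)
  set X := mom ρ with hX
  set Y := mom₂ ρ σ + mom₂ σ ρ
  set Z := mom σ
  refine ⟨T (Y * Y) + 2 * T (Z * X), 2 * T (Z * Y), T (Z * Z), fun t => ?_⟩
  have h1 : mom (ρ + t • σ) = X + t • Y + t ^ 2 • Z := by
    simp only [mom, mom₂_add_left, mom₂_add_right, mom₂_smul_left, mom₂_smul_right, X, Y, Z]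
    module
  have h2 : T (Y * X) = pr (cub ρ) σ := by
    rw [add_mul, map_add, trace_mom_mul_mom₂, trace_mom_mul_mom₂']
    ring
  have h3 : T (X * Y) = T (Y * X) := LinearMap.trace_mul_comm ℝ X Y
  have h4 : T (X * Z) = T (Z * X) := LinearMap.trace_mul_comm ℝ X Z
  have h5 : T (Y * Z) = T (Z * Y) := LinearMap.trace_mul_comm ℝ Y Z
  rw [quartic_eq_trace, quartic_eq_trace, h1, ← h2]
  simp only [add_mul, mul_add, map_add, smul_mul_assoc, mul_smul_comm, map_smul, smul_eq_mul]
  rw [h3, h4, h5]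
  ring

theorem hasDerivAt_quartic (ρ σ : Mixed ℝ) :
    HasDerivAt (fun t : ℝ => quartic (ρ + t • σ)) (2 * pr (cub ρ) σ) 0 := by
  obtain ⟨c₂, c₃, c₄, h⟩ := exists_quartic_add_smul ρ σ
  have h0 := ((((hasDerivAt_const (0 : ℝ) (quartic ρ)).add
    ((hasDerivAt_id (0 : ℝ)).mul_const (2 * pr (cub ρ) σ))).add
    (((hasDerivAt_id (0 : ℝ)).pow 2).mul_const c₂)).add
    (((hasDerivAt_id (0 : ℝ)).pow 3).mul_const c₃)).add
    (((hasDerivAt_id (0 : ℝ)).pow 4).mul_const c₄)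
  refine (h0.congr_of_eventuallyEq (.of_forall fun t => ?_)).congr_deriv ?_
  · rw [h t]
    rfl
  · norm_num

/-- Since `√(-q/3) = 2√(-q/12)` and `q` has derivative `2⟨μ·ρ, σ⟩`, the chain rule gives `-⟨μ·ρ, σ⟩
/ (6√(-q/12))`, which is half the pairing with the normalized covariant `ρ̂`. -/
theorem hasDerivAt_sqrt_quartic {ρ : Mixed ℝ} (hq : quartic ρ < 0) (σ : Mixed ℝ) :
    HasDerivAt (fun t : ℝ => Real.sqrt (-quartic (ρ + t • σ) / 3)) (1 / 2 * pr (hatE ρ) σ) 0 := by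
  have h1 := ((hasDerivAt_quartic ρ σ).neg.div_const 3).sqrt (by
    rw [Pi.neg_apply, zero_smul, add_zero]
    intro h
    linarith)
  refine h1.congr_deriv ?_
  rw [hatE, map_smul, LinearMap.smul_apply, smul_eq_mul, Pi.neg_apply, zero_smul, add_zero,
    show -quartic ρ / 3 = 2 ^ 2 * (-quartic ρ / 12) by ring,
    Real.sqrt_mul (by norm_num), Real.sqrt_sq (by norm_num)]
  have h2 := (sqrt_pos_of_stable hq).ne'
  generalize Real.sqrt (-quartic ρ / 12) = s at h2 ⊢
  field_simp

/-- The derivative along a line of stable forms. -/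
theorem hasDerivAt_sqrt_quartic_line {ρ σ : Mixed ℝ} {t : ℝ} (hq : quartic (ρ + t • σ) < 0) :
    HasDerivAt (fun t : ℝ => Real.sqrt (-quartic (ρ + t • σ) / 3))
      (1 / 2 * pr (hatE (ρ + t • σ)) σ) t := by
  have h1 := hasDerivAt_sqrt_quartic hq σ
  rw [← sub_self t] at h1
  refine (h1.comp_sub_const t t).congr_of_eventuallyEq (.of_forall fun s => ?_)
  beta_reduce
  rw [add_assoc, ← add_smul, add_sub_cancel]

end Derivative

end GenCY
end

noncomputable section
namespace GenCY

/-! ### Smoothness of the algebraic operations on local forms -/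

section LocalForms

instance finiteDimensional_forms (k : ℕ) : FiniteDimensional ℝ (V6 [⋀^Fin k]→L[ℝ] ℝ) := by
  let T : (V6 [⋀^Fin k]→L[ℝ] ℝ) →ₗ[ℝ] ((Fin k → Fin 6) → ℝ) :=
    { toFun := fun f r => f fun i => stdVec (r i)
      map_add' := fun _ _ => rfl
      map_smul' := fun _ _ => rfl }
  refine FiniteDimensional.of_injective T fun f g h => ?_
  refine ContinuousAlternatingMap.toAlternatingMap_injective
    (Module.Basis.ext_alternating (EuclideanSpace.basisFun (Fin 6) ℝ).toBasis fun r _ => ?_)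
  have := congrFun h r
  simpa [T, stdVec] using this

variable {X : Type*} [NormedAddCommGroup X] [NormedSpace ℝ X]

theorem contDiffOn_bilin {E F G : Type*} [NormedAddCommGroup E] [NormedSpace ℝ E]
    [FiniteDimensional ℝ E] [NormedAddCommGroup F] [NormedSpace ℝ F] [FiniteDimensional ℝ F]
    [NormedAddCommGroup G] [NormedSpace ℝ G] (b : E →ₗ[ℝ] F →ₗ[ℝ] G) {f : X → E} {g : X → F}
    {U : Set X} (hf : ContDiffOn ℝ ∞ f U) (hg : ContDiffOn ℝ ∞ g U) :
    ContDiffOn ℝ ∞ (fun y => b (f y) (g y)) U :=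
  ((LinearMap.toContinuousLinearMap
    ((LinearMap.toContinuousLinearMap (𝕜 := ℝ) (E := F) (F' := G)).toLinearMap ∘ₗ b)).contDiff.comp_contDiffOn
      hf).clm_apply hg

/-- A local mixed form is smooth on a set if all its components are. -/
def SmoothOn (R : X → Mixed ℝ) (U : Set X) : Prop := ∀ k, ContDiffOn ℝ ∞ (fun y => R y k) U

variable {R S : X → Mixed ℝ} {U : Set X}

theorem SmoothOn.add (hR : SmoothOn R U) (hS : SmoothOn S U) : SmoothOn (fun y => R y + S y) U :=
  fun k => (hR k).add (hS k)

theorem SmoothOn.smul {f : X → ℝ} (hf : ContDiffOn ℝ ∞ f U) (hR : SmoothOn R U) :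
    SmoothOn (fun y => f y • R y) U := fun k => hf.smul (hR k)

theorem SmoothOn.const_smul (c : ℝ) (hR : SmoothOn R U) : SmoothOn (fun y => c • R y) U :=
  SmoothOn.smul contDiffOn_const hR

theorem smoothOn_const (φ : Mixed ℝ) : SmoothOn (fun _ => φ) U := fun _ => contDiffOn_const

theorem SmoothOn.sum {ι : Type*} {s : Finset ι} {R : ι → X → Mixed ℝ}
    (h : ∀ i ∈ s, SmoothOn (R i) U) : SmoothOn (fun y => ∑ i ∈ s, R i y) U := fun k => by
  simp only [Finset.sum_apply]
  exact ContDiffOn.sum fun i hi => h i hi k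

theorem SmoothOn.mono {U' : Set X} (hR : SmoothOn R U) (h : U' ⊆ U) : SmoothOn R U' :=
  fun k => (hR k).mono h

theorem SmoothOn.congr (hR : SmoothOn R U) (h : ∀ y ∈ U, S y = R y) : SmoothOn S U :=
  fun k => (hR k).congr fun y hy => by rw [h y hy]

/-- The exterior product as a bilinear map. -/
def wedgeL {k l n : ℕ} (h : k + l = n) :
    (V6 [⋀^Fin k]→L[ℝ] ℝ) →ₗ[ℝ] (V6 [⋀^Fin l]→L[ℝ] ℝ) →ₗ[ℝ] (V6 [⋀^Fin n]→L[ℝ] ℝ) :=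
  LinearMap.mk₂ ℝ (wedge h) (wedge_add_left h) (wedge_smul_left h) (wedge_add_right h)
    (wedge_smul_right h)

theorem contDiffOn_wedge {k l n : ℕ} (h : k + l = n) {f : X → V6 [⋀^Fin k]→L[ℝ] ℝ}
    {g : X → V6 [⋀^Fin l]→L[ℝ] ℝ} (hf : ContDiffOn ℝ ∞ f U) (hg : ContDiffOn ℝ ∞ g U) :
    ContDiffOn ℝ ∞ (fun y => wedge h (f y) (g y)) U :=
  contDiffOn_bilin (wedgeL h) hf hg

theorem SmoothOn.wm {m : ℕ} {f : X → V6 [⋀^Fin m]→L[ℝ] ℝ} (hf : ContDiffOn ℝ ∞ f U)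
    (hR : SmoothOn R U) : SmoothOn (fun y => wm (f y) (R y)) U := fun n => by
  simp only [wm_apply]
  by_cases h : m ≤ n
  · simp only [wedgeMixed_apply (Nat.add_sub_of_le h)]
    exact contDiffOn_wedge _ hf (hR _)
  · simp only [wedgeMixed_apply_of_lt (not_le.1 h)]
    exact contDiffOn_const

/-- Contraction with a vector as a continuous linear map. -/
def contractL (v : V6) (n : ℕ) : (V6 [⋀^Fin (n + 1)]→L[ℝ] ℝ) →L[ℝ] (V6 [⋀^Fin n]→L[ℝ] ℝ) :=
  LinearMap.toContinuousLinearMap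
    { toFun := fun f => f.curryLeft v
      map_add' := fun _ _ => rfl
      map_smul' := fun _ _ => rfl }

theorem contractL_apply (v : V6) (n : ℕ) (f : V6 [⋀^Fin (n + 1)]→L[ℝ] ℝ) :
    contractL v n f = f.curryLeft v := rfl

theorem SmoothOn.cl (w : W ℝ) (hR : SmoothOn R U) : SmoothOn (fun y => cl w (R y)) U := by
  have h1 : SmoothOn (fun y => ann w.1 (R y)) U := fun n => by
    simp only [ann_apply]
    exact (contractL w.1 n).contDiff.comp_contDiffOn (hR (n + 1))
  have h2 : SmoothOn (fun y => cre w.2 (R y)) U := by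
    simp only [cre_eq, ← wm_apply]
    exact SmoothOn.wm contDiffOn_const hR
  simp only [cl_eq w]
  exact h1.add h2

theorem SmoothOn.pr (hR : SmoothOn R U) (hS : SmoothOn S U) :
    ContDiffOn ℝ ∞ (fun y => pr (R y) (S y)) U := by
  simp only [pr_apply, pairing_eq_sum]
  refine ContDiffOn.sum fun k _ => contDiffOn_const.mul ?_
  exact ((ContinuousAlternatingMap.apply ℝ V6 ℝ stdVec).contDiff).comp_contDiffOn
    (contDiffOn_wedge _ (hR _) (hS _))

theorem SmoothOn.cub (hR : SmoothOn R U) : SmoothOn (fun y => cub (R y)) U := by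
  have h : ∀ ρ : Mixed ℝ, GenCY.cub ρ = (1 / 2 : ℝ) • ∑ a, (1 / 4 : ℝ) • ∑ b,
      GenCY.pr (GenCY.cl (eW a) (GenCY.cl (eW (dualIdx b)) ρ)) ρ •
        GenCY.cl (eW b) (GenCY.cl (eW (dualIdx a)) ρ) := fun ρ => by
    rw [GenCY.cub, spinL_apply]
    simp only [mom₂_apply, map_smul, map_sum, LinearMap.smul_apply, LinearMap.sum_apply]
  simp only [h]
  exact SmoothOn.const_smul _ (SmoothOn.sum fun a _ => SmoothOn.const_smul _ (SmoothOn.sum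
    fun b _ => SmoothOn.smul (((hR.cl _).cl _).pr hR) ((hR.cl _).cl _)))

theorem SmoothOn.quartic (hR : SmoothOn R U) : ContDiffOn ℝ ∞ (fun y => quartic (R y)) U := by
  simp only [quartic_eq]
  exact contDiffOn_const.mul (hR.cub.pr hR)

theorem SmoothOn.hatE (hR : SmoothOn R U) (hq : ∀ y ∈ U, GenCY.quartic (R y) < 0) :
    SmoothOn (fun y => hatE (R y)) U := by
  refine SmoothOn.smul ?_ hR.cub
  refine (contDiffOn_const.div (contDiffOn_const.mul (ContDiffOn.sqrt (hR.quartic.neg.div_const 12)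
    fun y hy => ?_)) fun y hy => ?_).neg
  · have := hq y hy
    intro h
    linarith
  · have := sqrt_pos_of_stable (hq y hy)
    positivity

end LocalForms

/-! ### The exterior derivative on open sets of `ℝ⁶` and the local Stokes formula -/

section ExteriorDerivative

variable {R S : V6 → Mixed ℝ} {U : Set V6}

/-- The exterior derivative of a local mixed form. -/
def dL (R : V6 → Mixed ℝ) (y : V6) : Mixed ℝ
  | 0 => 0
  | k + 1 => extDeriv (fun z => R z k) y

/-- The partial derivatives of a local mixed form. -/
def partialL (i : Fin 6) (R : V6 → Mixed ℝ) (y : V6) : Mixed ℝ :=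
  fun k => fderiv ℝ (fun z => R z k) y (stdVec i)

open ContinuousAlternatingMap in
theorem SmoothOn.dL (hU : IsOpen U) (hR : SmoothOn R U) : SmoothOn (dL R) U := fun k => by
  cases k with
  | zero => exact contDiffOn_const
  | succ k =>
    exact (alternatizeUncurryFinCLM ℝ V6 ℝ (n := k)).contDiff.comp_contDiffOn
      ((hR k).fderiv_of_isOpen (m := ∞) hU (by simp))

open ContinuousAlternatingMap in
-- The exterior derivative is the alternatization of the Fréchet derivative; on a rank-one
-- derivative `ξ ⊗ φ` it must give `ξ ∧ φ`. Both sides have the same contractions, by `ann_cre` and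
-- induction on the degree.
theorem alternatizeUncurryFin_smulRight (ξ : V6 →L[ℝ] ℝ) (φ : Mixed ℝ) (k : ℕ) :
    alternatizeUncurryFin (ξ.smulRight (φ k)) = cre ξ φ (k + 1) := by
  induction k generalizing φ with
  | zero =>
    -- The 1-form is completed to a mixed form so that `mixed_ext_succ` applies; its other
    -- components play no role.
    refine mixed_ext_succ (φ := fun n => match n with
      | 0 => 0
      | 1 => alternatizeUncurryFin (ξ.smulRight (φ 0))
      | _ + 2 => 0) (n := 0) fun v => ?_
    have h := congrFun (ann_cre v ξ φ) 0
    rw [Pi.add_apply, cre_zero, add_zero] at h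
    rw [h, ann_apply]
    ext w
    change alternatizeUncurryFin (ξ.smulRight (φ 0)) (Matrix.vecCons v w) = ξ v * φ 0 w
    rw [alternatizeUncurryFin_apply, Fin.sum_univ_one]
    simp [Subsingleton.elim _ w]
  | succ k ih =>
    refine ext_curryLeft fun v => ?_
    have h := congrFun (ann_cre v ξ φ) (k + 1)
    rw [Pi.add_apply, ← ih] at h
    rw [← ann_apply, eq_sub_of_add_eq h]
    ext w
    change alternatizeUncurryFin (ξ.smulRight (φ (k + 1))) (Matrix.vecCons v w) = ξ v * φ (k + 1) w -
      alternatizeUncurryFin (ξ.smulRight (ann v φ k)) w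
    rw [alternatizeUncurryFin_apply, alternatizeUncurryFin_apply, Fin.sum_univ_succ,
      sub_eq_add_neg, ← Finset.sum_neg_distrib]
    congr 1
    · simp [Matrix.vecCons]
    · refine Finset.sum_congr rfl fun j _ => ?_
      rw [ann_apply]
      have : (Fin.succ j).removeNth (Matrix.vecCons v w : Fin (k + 2) → V6) =
          Matrix.vecCons v (j.removeNth w) := by
        funext i
        refine Fin.cases ?_ (fun i => ?_) i
        · simp [Fin.removeNth, Matrix.vecCons]
        · simp [Fin.removeNth, Matrix.vecCons]
      rw [this]
      simp [pow_succ]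

/-- Writing `d = ∑ e^i ∂_i` reduces Stokes' formula to the self-adjointness of the constant
operators `e^i`. -/
theorem dL_eq (R : V6 → Mixed ℝ) (y : V6) : dL R y = ∑ i, crei i (partialL i R y) := by
  funext n
  rw [Finset.sum_apply]
  cases n with
  | zero =>
    simp only [cre_zero, Finset.sum_const_zero]
    rfl
  | succ k =>
    have h : fderiv ℝ (fun z => R z k) y =
        ∑ i, (stdCovec i).smulRight (partialL i R y k) := by
      ext1 v
      conv_lhs => rw [sum_stdVec v, map_sum]
      simp only [_root_.sum_apply, ContinuousLinearMap.smulRight_apply, stdCovec_apply, map_smul]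
      rfl
    change ContinuousAlternatingMap.alternatizeUncurryFin (fderiv ℝ (fun z => R z k) y) = _
    rw [h]
    change ContinuousAlternatingMap.alternatizeUncurryFinCLM ℝ V6 ℝ _ = _
    rw [map_sum]
    exact Finset.sum_congr rfl fun i _ => alternatizeUncurryFin_smulRight _ _ _

theorem hasFDerivAt_bilin {E F G : Type*} [NormedAddCommGroup E] [NormedSpace ℝ E]
    [FiniteDimensional ℝ E] [NormedAddCommGroup F] [NormedSpace ℝ F] [FiniteDimensional ℝ F]
    [NormedAddCommGroup G] [NormedSpace ℝ G] (b : E →ₗ[ℝ] F →ₗ[ℝ] G) {f : V6 → E} {g : V6 → F}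
    {y : V6} (hf : DifferentiableAt ℝ f y) (hg : DifferentiableAt ℝ g y) :
    ∃ L : V6 →L[ℝ] G, HasFDerivAt (fun z => b (f z) (g z)) L y ∧
      ∀ v, L v = b (fderiv ℝ f y v) (g y) + b (f y) (fderiv ℝ g y v) := by
  let B := LinearMap.toContinuousLinearMap
    ((LinearMap.toContinuousLinearMap (𝕜 := ℝ) (E := F) (F' := G)).toLinearMap ∘ₗ b)
  refine ⟨_, B.hasFDerivAt_of_bilinear hf.hasFDerivAt hg.hasFDerivAt, fun v => ?_⟩
  rw [add_comm]
  rfl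

theorem hasFDerivAt_pr {y : V6} (hR : ∀ k, DifferentiableAt ℝ (fun z => R z k) y)
    (hS : ∀ k, DifferentiableAt ℝ (fun z => S z k) y) (i : Fin 6) :
    fderiv ℝ (fun z => pr (R z) (S z)) y (stdVec i) =
      pr (partialL i R y) (S y) + pr (R y) (partialL i S y) := by
  let b (k : Fin 7) : (V6 [⋀^Fin k]→L[ℝ] ℝ) →ₗ[ℝ] (V6 [⋀^Fin (6 - k)]→L[ℝ] ℝ) →ₗ[ℝ] ℝ :=
    (wedgeL (Nat.add_sub_of_le (Nat.lt_succ_iff.mp k.isLt))).compr₂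
      (((-1 : ℝ) ^ ((k : ℕ) / 2)) • (ContinuousAlternatingMap.apply ℝ V6 ℝ stdVec).toLinearMap)
  have hb : ∀ φ ψ, pr φ ψ = ∑ k : Fin 7, b k (φ k) (ψ (6 - k)) := fun φ ψ => by
    rw [pr_apply, pairing_eq_sum]
    rfl
  choose L hL hLv using fun k : Fin 7 => hasFDerivAt_bilin (b k) (hR k) (hS (6 - k))
  simp only [hb]
  rw [(HasFDerivAt.fun_sum fun k _ => hL k).fderiv, _root_.sum_apply, ← Finset.sum_add_distrib]
  exact Finset.sum_congr rfl fun k _ => hLv k _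

theorem partialL_cl {y : V6} (w : W ℝ) (hR : ∀ k, DifferentiableAt ℝ (fun z => R z k) y)
    (i : Fin 6) : partialL i (fun z => cl w (R z)) y = cl w (partialL i R y) := by
  funext n
  have h1 := ((contractL w.1 n).hasFDerivAt).comp y (hR (n + 1)).hasFDerivAt
  cases n with
  | zero =>
    have h : ∀ φ, cl w φ 0 = contractL w.1 0 (φ 1) := fun φ => by
      rw [cl_eq, Pi.add_apply, cre_zero, add_zero, ann_apply, contractL_apply]
    rw [h, partialL]
    simp only [h]
    rw [show (fun z => contractL w.1 0 (R z 1)) = contractL w.1 0 ∘ fun z => R z 1 from rfl,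
      h1.fderiv]
    rfl
  | succ n =>
    let a := LinearMap.toContinuousLinearMap (wedgeL (add_comm 1 n)
      (ContinuousAlternatingMap.ofSubsingleton ℝ V6 ℝ (0 : Fin 1) w.2))
    have h2 := a.hasFDerivAt.comp y (hR n).hasFDerivAt
    have h : ∀ φ : Mixed ℝ, cl w φ (n + 1) = contractL w.1 (n + 1) (φ (n + 2)) + a (φ n) :=
      fun φ => by
        rw [cl_eq, Pi.add_apply, cre_succ, ann_apply, contractL_apply]
        rfl
    rw [h, partialL]
    simp only [h]
    rw [show (fun z => contractL w.1 (n + 1) (R z (n + 2)) + a (R z n)) =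
      (contractL w.1 (n + 1) ∘ fun z => R z (n + 2)) + (a ∘ fun z => R z n) from rfl,
      (h1.add h2).fderiv]
    rfl

open MeasureTheory in
theorem integral_fderiv_eq_zero {f : V6 → ℝ} (hf : ContDiff ℝ ∞ f) (hc : HasCompactSupport f)
    (v : V6) : ∫ y, fderiv ℝ f y v = 0 := by
  have h1 : Integrable (fun y => fderiv ℝ f y v) := by
    refine Continuous.integrable_of_hasCompactSupport ?_ (hc.fderiv_apply ℝ v)
    exact (hf.continuous_fderiv (by simp)).clm_apply continuous_const
  -- Integration by parts against the constant function `1`.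
  have h := integral_mul_fderiv_eq_neg_fderiv_mul_of_integrable (μ := (volume : Measure V6))
    (f := fun _ : V6 => (1 : ℝ)) (g := f) (v := v) (by simp) (by simpa using h1)
    (by simpa using hf.continuous.integrable_of_hasCompactSupport hc)
    (fun _ _ => differentiableAt_const _) (fun _ _ => hf.differentiable (by simp) _)
  simpa using h

theorem SmoothOn.differentiableAt (hU : IsOpen U) (hR : SmoothOn R U) {y : V6} (hy : y ∈ U) (k : ℕ) :
    DifferentiableAt ℝ (fun z => R z k) y :=
  ((hR k).contDiffAt (hU.mem_nhds hy)).differentiableAt (by simp)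

open MeasureTheory in
/-- Stokes' theorem for the pairing of two local mixed forms, one of them compactly supported. -/
theorem setIntegral_pr_dL (hU : IsOpen U) (hR : SmoothOn R U) (hS : SmoothOn S U) {K : Set V6}
    (hK : IsCompact K) (hKU : K ⊆ U) (hRK : ∀ y ∉ K, R y = 0) :
    ∫ y in U, (pr (dL R y) (S y) + pr (R y) (dL S y)) = 0 := by
  -- The integrand is the divergence `∑ ∂_i ⟨e^i R, S⟩`. These functions vanish off `K`, so they are
  -- smooth on all of `ℝ⁶` although `R` and `S` are only assumed smooth on `U`.
  let f (i : Fin 6) (y : V6) : ℝ := pr (crei i (R y)) (S y)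
  have hf0 : ∀ i, ∀ y ∉ K, f i y = 0 := fun i y hy => by simp [f, hRK y hy]
  have hfs : ∀ i, ContDiff ℝ ∞ (f i) := fun i => contDiff_iff_contDiffAt.2 fun y => by
    by_cases hy : y ∈ U
    · exact ((hR.cl _).pr hS).contDiffAt (hU.mem_nhds hy)
    · refine contDiffAt_const (c := (0 : ℝ)) |>.congr_of_eventuallyEq ?_
      filter_upwards [hK.isClosed.isOpen_compl.mem_nhds fun h => hy (hKU h)] with z hz
      exact hf0 i z hz
  have hfc : ∀ i, HasCompactSupport (f i) := fun i => HasCompactSupport.intro hK (hf0 i)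
  have h1 : ∀ y ∈ U, pr (dL R y) (S y) + pr (R y) (dL S y) =
      ∑ i, fderiv ℝ (f i) y (stdVec i) := fun y hy => by
    rw [dL_eq, dL_eq, map_sum, map_sum, LinearMap.sum_apply, ← Finset.sum_add_distrib]
    refine Finset.sum_congr rfl fun i _ => ?_
    rw [hasFDerivAt_pr ((hR.cl _).differentiableAt hU hy) (hS.differentiableAt hU hy),
      partialL_cl _ (hR.differentiableAt hU hy), ← pr_cl (_, _) (R y)]
  rw [setIntegral_congr_fun hU.measurableSet h1]
  have h2 : ∀ y ∉ U, ∑ i, fderiv ℝ (f i) y (stdVec i) = 0 := fun y hy => by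
    refine Finset.sum_eq_zero fun i _ => ?_
    have : f i =ᶠ[nhds y] fun _ => 0 := by
      filter_upwards [hK.isClosed.isOpen_compl.mem_nhds fun h => hy (hKU h)] with z hz
      exact hf0 i z hz
    rw [this.fderiv_eq]
    simp
  rw [setIntegral_eq_integral_of_forall_compl_eq_zero h2, integral_finsetSum]
  · exact Finset.sum_eq_zero fun i _ => integral_fderiv_eq_zero (hfs i) (hfc i) _
  · intro i _
    refine Continuous.integrable_of_hasCompactSupport ?_ ((hfc i).fderiv_apply ℝ _)
    exact ((hfs i).continuous_fderiv (by simp)).clm_apply continuous_const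

end ExteriorDerivative

end GenCY
end

noncomputable section
namespace GenCY

/-! ### Smoothness of pullbacks -/

section PullSmooth

variable {X : Type*} [NormedAddCommGroup X] [NormedSpace ℝ X] {U : Set X}

theorem contDiffOn_form {k : ℕ} {f : X → V6 [⋀^Fin k]→L[ℝ] ℝ}
    (h : ∀ r : Fin k → Fin 6, ContDiffOn ℝ ∞ (fun y => f y fun i => stdVec (r i)) U) :
    ContDiffOn ℝ ∞ f U := by
  let T : (V6 [⋀^Fin k]→L[ℝ] ℝ) →ₗ[ℝ] ((Fin k → Fin 6) → ℝ) :=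
    { toFun := fun f r => f fun i => stdVec (r i)
      map_add' := fun _ _ => rfl
      map_smul' := fun _ _ => rfl }
  have hT : LinearMap.ker T = ⊥ := by
    refine LinearMap.ker_eq_bot.2 fun f g h => ?_
    refine ContinuousAlternatingMap.toAlternatingMap_injective
      (Module.Basis.ext_alternating (EuclideanSpace.basisFun (Fin 6) ℝ).toBasis fun r _ => ?_)
    have := congrFun h r
    simpa [T, stdVec] using this
  obtain ⟨g, hg⟩ := T.exists_leftInverse_of_injective hT
  have h1 : f = fun y => LinearMap.toContinuousLinearMap g (T (f y)) := by
    funext y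
    exact (LinearMap.congr_fun hg (f y)).symm
  rw [h1]
  exact (LinearMap.toContinuousLinearMap g).contDiff.comp_contDiffOn (contDiffOn_pi.2 h)

theorem SmoothOn.pull {R : X → Mixed ℝ} {L : X → V6 →L[ℝ] V6} (hR : SmoothOn R U)
    (hL : ContDiffOn ℝ ∞ L U) : SmoothOn (fun y => pull (L y) (R y)) U := fun k => by
  refine contDiffOn_form fun r => ?_
  have h : ∀ y, GenCY.pull (L y) (R y) k (fun i => stdVec (r i)) =
      ∑ s : Fin k → Fin 6, (∏ i, (L y (stdVec (r i))) (s i)) * R y k fun i => stdVec (s i) := by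
    intro y
    change R y k (fun i => L y (stdVec (r i))) = _
    conv_lhs => rw [show (fun i => L y (stdVec (r i))) =
      fun i => ∑ j, (L y (stdVec (r i))) j • stdVec j from funext fun i => sum_stdVec _]
    change (R y k).toMultilinearMap _ = _
    rw [MultilinearMap.map_sum]
    exact Finset.sum_congr rfl fun s _ => by rw [MultilinearMap.map_smul_univ]; rfl
  simp only [h]
  refine ContDiffOn.sum fun s _ => ContDiffOn.mul (contDiffOn_prod fun i _ => ?_) ?_
  · exact (EuclideanSpace.proj (s i) : V6 →L[ℝ] ℝ).contDiff.comp_contDiffOn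
      (hL.clm_apply contDiffOn_const)
  · exact ((ContinuousAlternatingMap.apply ℝ V6 ℝ fun i => stdVec (s i)).contDiff).comp_contDiffOn
      (hR k)

theorem SmoothOn.comp {R : V6 → Mixed ℝ} {V : Set V6} (hR : SmoothOn R V) {f : X → V6}
    (hf : ContDiffOn ℝ ∞ f U) (h : Set.MapsTo f U V) : SmoothOn (fun y => R (f y)) U :=
  fun k => (hR k).comp hf h

theorem pull_pull (A B : V6 →L[ℝ] V6) (φ : Mixed ℝ) : pull A (pull B φ) = pull (B.comp A) φ := rfl

theorem pull_id (φ : Mixed ℝ) : pull (ContinuousLinearMap.id ℝ V6) φ = φ := rfl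

end PullSmooth

/-! ### Forms on the manifold and their expressions in charts -/

section Charts

variable {M : Type*} [TopologicalSpace M] [ChartedSpace V6 M]

/-- The change of charts. -/
def tau (x₀ x₁ : M) : V6 → V6 := extChartAt (𝓡 6) x₁ ∘ (extChartAt (𝓡 6) x₀).symm

/-- The domain of the change of charts. -/
def overlap (x₀ x₁ : M) : Set V6 :=
  ((extChartAt (𝓡 6) x₀).symm ≫ extChartAt (𝓡 6) x₁).source

/-- The Jacobian of the inverse of a chart. -/
def jac (x₀ : M) (y : V6) : V6 →L[ℝ] V6 :=
  mfderiv 𝓘(ℝ, V6) (𝓡 6) (extChartAt (𝓡 6) x₀).symm y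

variable {x₀ x₁ x₂ : M} {y : V6}

theorem mem_overlap : y ∈ overlap x₀ x₁ ↔ y ∈ (extChartAt (𝓡 6) x₀).target ∧
    (extChartAt (𝓡 6) x₀).symm y ∈ (extChartAt (𝓡 6) x₁).source := by
  simp [overlap, PartialEquiv.trans_source]

theorem isOpen_overlap (x₀ x₁ : M) : IsOpen (overlap x₀ x₁) := by
  have : overlap x₀ x₁ = ((chartAt V6 x₀).symm ≫ₕ chartAt V6 x₁).source := by
    simp [overlap, PartialEquiv.trans_source]
  rw [this]
  exact ((chartAt V6 x₀).symm ≫ₕ chartAt V6 x₁).open_source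

theorem isOpen_target (x₀ : M) : IsOpen (extChartAt (𝓡 6) x₀).target := isOpen_extChartAt_target x₀

theorem symm_tau (hy : y ∈ overlap x₀ x₁) :
    (extChartAt (𝓡 6) x₁).symm (tau x₀ x₁ y) = (extChartAt (𝓡 6) x₀).symm y :=
  (extChartAt (𝓡 6) x₁).left_inv (mem_overlap.1 hy).2

theorem tau_mem (hy : y ∈ overlap x₀ x₁) : tau x₀ x₁ y ∈ overlap x₁ x₀ := by
  rw [mem_overlap, symm_tau hy]
  exact ⟨(extChartAt (𝓡 6) x₁).map_source (mem_overlap.1 hy).2,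
    (extChartAt (𝓡 6) x₀).map_target (mem_overlap.1 hy).1⟩

theorem tau_tau (hy : y ∈ overlap x₀ x₁) : tau x₁ x₂ (tau x₀ x₁ y) = tau x₀ x₂ y := by
  rw [tau, Function.comp_apply, symm_tau hy]
  rfl

theorem tau_self (hy : y ∈ (extChartAt (𝓡 6) x₀).target) : tau x₀ x₀ y = y :=
  (extChartAt (𝓡 6) x₀).right_inv hy

theorem target_subset_overlap (x₀ : M) : (extChartAt (𝓡 6) x₀).target ⊆ overlap x₀ x₀ :=
  fun _ hy => mem_overlap.2 ⟨hy, (extChartAt (𝓡 6) x₀).map_target hy⟩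

theorem overlap_subset_target (x₀ x₁ : M) : overlap x₀ x₁ ⊆ (extChartAt (𝓡 6) x₀).target :=
  fun _ hy => (mem_overlap.1 hy).1

theorem mem_overlap_symm (hy : y ∈ (extChartAt (𝓡 6) x₀).target) :
    y ∈ overlap x₀ ((extChartAt (𝓡 6) x₀).symm y) :=
  mem_overlap.2 ⟨hy, mem_extChartAt_source _⟩

theorem fderiv_tau_self (hy : y ∈ (extChartAt (𝓡 6) x₀).target) :
    fderiv ℝ (tau x₀ x₀) y = ContinuousLinearMap.id ℝ V6 := by
  have : tau x₀ x₀ =ᶠ[nhds y] id := by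
    filter_upwards [(isOpen_target x₀).mem_nhds hy] with z hz using tau_self hz
  rw [this.fderiv_eq, fderiv_id]

theorem det_fderiv_tau_pos (hM : OrientedAtlas M) (hy : y ∈ overlap x₀ x₁) :
    0 < (fderiv ℝ (tau x₀ x₁) y).det := by
  refine hM (chartAt V6 x₀) (chart_mem_atlas V6 x₀) (chartAt V6 x₁) (chart_mem_atlas V6 x₁) y ?_
  simpa [overlap, PartialEquiv.trans_source] using hy

/-- The expression of a mixed form in a chart. -/
def locRep (ρ : MixedForm M) (x₀ : M) (y : V6) : Mixed ℝ :=
  pull (jac x₀ y) (ρ ((extChartAt (𝓡 6) x₀).symm y))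

theorem isSmoothMixed_iff (ρ : MixedForm M) :
    IsSmoothMixed ρ ↔ ∀ x₀, SmoothOn (locRep ρ x₀) (extChartAt (𝓡 6) x₀).target :=
  ⟨fun h x₀ k => h k x₀, fun h k x₀ => h x₀ k⟩

/-- The tangent space at `x` is identified with `ℝ⁶` by the chart at `x` itself. -/
theorem mfderiv_extChartAt_self (x : M) :
    (mfderiv (𝓡 6) 𝓘(ℝ, V6) (extChartAt (𝓡 6) x) x : V6 →L[ℝ] V6) =
      ContinuousLinearMap.id ℝ V6 := by
  have h : MDifferentiableAt (𝓡 6) 𝓘(ℝ, V6) (extChartAt (𝓡 6) x) x :=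
    (contMDiffAt_extChartAt (n := ∞)).mdifferentiableAt (by simp)
  refine Eq.trans (if_pos h) ?_
  simp only [writtenInExtChartAt, Set.range_id, fderivWithin_univ,
    extChartAt_model_space_eq_id, PartialEquiv.refl_coe, Function.id_comp, modelWithCornersSelf_coe]
  exact fderiv_tau_self (mem_extChartAt_target x)

variable [IsManifold (𝓡 6) ∞ M]

theorem contDiffOn_tau (x₀ x₁ : M) : ContDiffOn ℝ ∞ (tau x₀ x₁) (overlap x₀ x₁) :=
  contDiffOn_ext_coord_change x₁ x₀

theorem differentiableAt_tau (hy : y ∈ overlap x₀ x₁) : DifferentiableAt ℝ (tau x₀ x₁) y :=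
  ((contDiffOn_tau x₀ x₁).contDiffAt ((isOpen_overlap _ _).mem_nhds hy)).differentiableAt (by simp)

theorem fderiv_tau_comp (hy : y ∈ overlap x₀ x₁) (hy' : y ∈ overlap x₀ x₂) :
    fderiv ℝ (tau x₀ x₂) y = (fderiv ℝ (tau x₁ x₂) (tau x₀ x₁ y)).comp (fderiv ℝ (tau x₀ x₁) y) := by
  have h1 : tau x₀ x₂ =ᶠ[nhds y] tau x₁ x₂ ∘ tau x₀ x₁ := by
    filter_upwards [(isOpen_overlap x₀ x₁).mem_nhds hy] with z hz using (tau_tau hz).symm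
  have h2 : tau x₀ x₁ y ∈ overlap x₁ x₂ := by
    rw [mem_overlap, symm_tau hy]
    exact ⟨((mem_overlap.1 (tau_mem hy)).1), (mem_overlap.1 hy').2⟩
  rw [h1.fderiv_eq, fderiv_comp _ (differentiableAt_tau h2) (differentiableAt_tau hy)]

/-- The tangent space at the image point is trivialized by the preferred chart of that point, so the
derivative of the inverse chart is that of a coordinate change whose target chart depends on `y`. -/
theorem jac_eq (hy : y ∈ (extChartAt (𝓡 6) x₀).target) :
    jac x₀ y = fderiv ℝ (tau x₀ ((extChartAt (𝓡 6) x₀).symm y)) y := by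
  have h : MDifferentiableAt 𝓘(ℝ, V6) (𝓡 6) (extChartAt (𝓡 6) x₀).symm y :=
    ((contMDiffOn_extChartAt_symm (n := ∞) x₀).contMDiffAt
      ((isOpen_target x₀).mem_nhds hy)).mdifferentiableAt (by simp)
  refine Eq.trans (if_pos h) ?_
  simp only [writtenInExtChartAt, modelWithCornersSelf_coe, Set.range_id, fderivWithin_univ,
    extChartAt_model_space_eq_id, PartialEquiv.refl_coe, PartialEquiv.refl_symm]
  rfl

theorem jac_comp (hy : y ∈ overlap x₀ x₁) :
    jac x₀ y = (jac x₁ (tau x₀ x₁ y)).comp (fderiv ℝ (tau x₀ x₁) y) := by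
  rw [jac_eq (mem_overlap.1 hy).1, jac_eq (mem_overlap.1 (tau_mem hy)).1, symm_tau hy]
  exact fderiv_tau_comp hy (mem_overlap_symm (mem_overlap.1 hy).1)

theorem locRep_tau (ρ : MixedForm M) (hy : y ∈ overlap x₀ x₁) :
    locRep ρ x₀ y = pull (fderiv ℝ (tau x₀ x₁) y) (locRep ρ x₁ (tau x₀ x₁ y)) := by
  rw [locRep, locRep, pull_pull, symm_tau hy, ← jac_comp hy]

theorem chartRep_tau {k : ℕ} (η : Form M k) (hy : y ∈ overlap x₀ x₁) :
    chartRep η x₀ y =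
      (chartRep η x₁ (tau x₀ x₁ y)).compContinuousLinearMap (fderiv ℝ (tau x₀ x₁) y) := by
  change (η ((extChartAt (𝓡 6) x₀).symm y)).compContinuousLinearMap (jac x₀ y) =
    ((η ((extChartAt (𝓡 6) x₁).symm (tau x₀ x₁ y))).compContinuousLinearMap
      (jac x₁ (tau x₀ x₁ y))).compContinuousLinearMap (fderiv ℝ (tau x₀ x₁) y)
  rw [symm_tau hy, jac_comp hy]
  rfl

/-- `extD` is computed at each point in that point's own chart; naturality of the exterior
derivative under coordinate changes moves the computation to one fixed chart. -/
theorem chartRep_extD {k : ℕ} {η : Form M k} (hη : IsSmooth η)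
    (hy : y ∈ (extChartAt (𝓡 6) x₀).target) :
    chartRep (extD η) x₀ y = extDeriv (chartRep η x₀) y := by
  set x := (extChartAt (𝓡 6) x₀).symm y with hx
  have hyx : y ∈ overlap x₀ x := mem_overlap_symm hy
  have hd : DifferentiableAt ℝ (chartRep η x) (tau x₀ x y) :=
    ((hη x).contDiffAt ((isOpen_target x).mem_nhds
      (mem_overlap.1 (tau_mem hyx)).1)).differentiableAt (by simp)
  have h1 : chartRep η x₀ =ᶠ[nhds y] fun z =>
      (chartRep η x (tau x₀ x z)).compContinuousLinearMap (fderiv ℝ (tau x₀ x) z) := by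
    filter_upwards [(isOpen_overlap x₀ x).mem_nhds hyx] with z hz using chartRep_tau η hz
  rw [h1.extDeriv_eq, extDeriv_pullback (r := ∞) hd
    ((contDiffOn_tau x₀ x).contDiffAt ((isOpen_overlap _ _).mem_nhds hyx)) (by
      rw [minSmoothness_of_isRCLikeNormedField]
      exact WithTop.coe_le_coe.2 (le_top : (2 : ℕ∞) ≤ ⊤)),
    ← jac_eq hy]
  change ((extDeriv (chartRep η x) (extChartAt (𝓡 6) x x)).compContinuousLinearMap
    (mfderiv (𝓡 6) 𝓘(ℝ, V6) (extChartAt (𝓡 6) x) x : V6 →L[ℝ] V6)).compContinuousLinearMap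
      (jac x₀ y) = _
  rw [mfderiv_extChartAt_self]
  rfl

theorem locRep_twistedD {H : Form M 3} {α : MixedForm M} (hα : IsSmoothMixed α)
    (hy : y ∈ (extChartAt (𝓡 6) x₀).target) :
    locRep (twistedD H α) x₀ y = dL (locRep α x₀) y + wm (chartRep H x₀ y) (locRep α x₀ y) := by
  have h1 : locRep (twistedD H α) x₀ y =
      locRep (extDMixed α) x₀ y + wm (chartRep H x₀ y) (locRep α x₀ y) := by
    rw [locRep, twistedD, map_add]
    congr 1
    exact (wm_pull _ _ _).symm
  rw [h1]
  congr 1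
  funext k
  cases k with
  | zero => rfl
  | succ k => exact chartRep_extD (hα k) hy

theorem IsSmoothMixed.twistedD {H : Form M 3} (hH : IsSmooth H) {α : MixedForm M}
    (hα : IsSmoothMixed α) : IsSmoothMixed (twistedD H α) := by
  rw [isSmoothMixed_iff] at hα ⊢
  intro x₀
  refine SmoothOn.congr ?_ fun y hy => locRep_twistedD ((isSmoothMixed_iff α).2 hα) hy
  exact ((hα x₀).dL (isOpen_target x₀)).add (SmoothOn.wm (hH x₀) (hα x₀))

theorem det_jac_pos (hM : OrientedAtlas M) (hy : y ∈ (extChartAt (𝓡 6) x₀).target) :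
    0 < (jac x₀ y).det := by
  rw [jac_eq hy]
  exact det_fderiv_tau_pos hM (mem_overlap_symm hy)

/-- The Jacobian is an orientation-preserving linear isomorphism. -/
theorem exists_jac (hM : OrientedAtlas M) (hy : y ∈ (extChartAt (𝓡 6) x₀).target) :
    ∃ A : V6 ≃L[ℝ] V6, (A : V6 →L[ℝ] V6) = jac x₀ y ∧ 0 < (A : V6 →L[ℝ] V6).det :=
  ⟨_, ContinuousLinearMap.coe_toContinuousLinearEquivOfDetNeZero _ (det_jac_pos hM hy).ne', by
    rw [ContinuousLinearMap.coe_toContinuousLinearEquivOfDetNeZero]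
    exact det_jac_pos hM hy⟩

/-- The Jacobians are orientation-preserving, so equivariance puts the pointwise choice `hat` into
the explicit formula in every chart. This is how `ρ̂` is seen to be smooth. -/
theorem locRep_hatForm (hM : OrientedAtlas M) {p : ZMod 2} {ρ : MixedForm M}
    (hp : ∀ x, HasParity p (ρ x)) (hρ : IsStable ρ) (hy : y ∈ (extChartAt (𝓡 6) x₀).target) :
    locRep (hatForm ρ) x₀ y = hatE (locRep ρ x₀ y) := by
  obtain ⟨A, hA, hd⟩ := exists_jac hM hy
  rw [locRep, locRep, ← hA, hatE_pull (hp _) A hd, hatForm, hat_eq (hp _) (hρ _)]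

theorem quartic_locRep_neg (hM : OrientedAtlas M) {ρ : MixedForm M} (hρ : IsStable ρ)
    (hy : y ∈ (extChartAt (𝓡 6) x₀).target) : quartic (locRep ρ x₀ y) < 0 := by
  obtain ⟨A, hA, hd⟩ := exists_jac hM hy
  rw [locRep, ← hA, quartic_pull]
  exact mul_neg_of_pos_of_neg (by positivity) (hρ _)

theorem chartRep_phi (hM : OrientedAtlas M) (ρ : MixedForm M)
    (hy : y ∈ (extChartAt (𝓡 6) x₀).target) :
    chartRep (M := M) (fun x => phi (ρ x)) x₀ y stdVec =
      Real.sqrt (-quartic (locRep ρ x₀ y) / 3) := by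
  obtain ⟨A, hA, hd⟩ := exists_jac hM hy
  rw [locRep, ← hA, ← phi_comp A hd, hA]
  rfl

theorem isOmega_hatForm (hM : OrientedAtlas M) {p : ZMod 2} {ρ : MixedForm M}
    (hρ : IsOmega p ρ) (hs : IsStable ρ) : IsOmega p (hatForm ρ) := by
  refine ⟨(isSmoothMixed_iff _).2 fun x₀ => ?_, fun x => ?_⟩
  · exact (((isSmoothMixed_iff ρ).1 hρ.1 x₀).hatE fun y hy => quartic_locRep_neg hM hs hy).congr
      fun y hy => locRep_hatForm hM hρ.2 hs hy
  · rw [hatForm, hat_eq (hρ.2 x) (hs x)]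
    exact (hρ.2 x).hatE

end Charts

end GenCY
end

noncomputable section
namespace GenCY

open MeasureTheory

/-! ### Differentiation of the local volume under the integral -/

section Analysis

theorem integrableOn_of_eq_zero {U K : Set V6} (hU : IsOpen U) (hK : IsCompact K) (hKU : K ⊆ U)
    {f : V6 → ℝ} (hf : ContinuousOn f U) (h0 : ∀ y ∈ U, y ∉ K → f y = 0) : IntegrableOn f U :=
  ((hf.mono hKU).integrableOn_compact hK).of_forall_sdiff_eq_zero hU.measurableSet
    fun y hy => h0 y hy.1 hy.2

theorem hasDerivAt_setIntegral_sqrt_quartic {R S : V6 → Mixed ℝ} {U K : Set V6} {χ : V6 → ℝ}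
    (hU : IsOpen U) (hR : SmoothOn R U) (hS : SmoothOn S U) (hq : ∀ y ∈ U, quartic (R y) < 0)
    (hχ : ContinuousOn χ U) (hK : IsCompact K) (hKU : K ⊆ U) (h0 : ∀ y ∈ U, y ∉ K → χ y = 0) :
    HasDerivAt (fun t : ℝ => ∫ y in U, χ y * Real.sqrt (-quartic (R y + t • S y) / 3))
      (∫ y in U, χ y * (1 / 2 * pr (hatE (R y)) (S y))) 0 := by
  -- The cutoff vanishes on `U` outside `K`, so all integrals may be taken over the compact set `K`,
  -- where uniform bounds exist.
  have hres : ∀ f : V6 → ℝ, ∫ y in U, χ y * f y = ∫ y in K, χ y * f y := fun f =>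
    setIntegral_eq_of_subset_of_forall_sdiff_eq_zero hU.measurableSet hKU
      fun y hy => by rw [h0 y hy.1 hy.2, zero_mul]
  simp only [hres]
  let RS : ℝ × V6 → Mixed ℝ := fun z => R z.2 + z.1 • S z.2
  have hsnd : ContDiffOn ℝ ∞ (fun z : ℝ × V6 => z.2) (Set.univ ×ˢ U) := contDiffOn_snd
  have hmaps : Set.MapsTo (fun z : ℝ × V6 => z.2) (Set.univ ×ˢ U) U := fun z hz => hz.2
  have hRS : SmoothOn RS (Set.univ ×ˢ U) :=
    (hR.comp hsnd hmaps).add (SmoothOn.smul contDiffOn_fst (hS.comp hsnd hmaps))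
  -- The open set of parameters and points with `R + tS` stable. It contains `{0} × K`, and by the
  -- tube lemma a whole neighbourhood of it, so stability persists on `K` for small `t`.
  let V : Set (ℝ × V6) := (Set.univ ×ˢ U) ∩ (fun z => quartic (RS z)) ⁻¹' Set.Iio 0
  have hV : IsOpen V := hRS.quartic.continuousOn.isOpen_inter_preimage
    (isOpen_univ.prod hU) isOpen_Iio
  have hVU : V ⊆ Set.univ ×ˢ U := Set.inter_subset_left
  obtain ⟨u, v, hu, -, h0u, hKv, huv⟩ := generalized_tube_lemma
    (isCompact_singleton (x := (0 : ℝ))) hK hV (by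
      rintro ⟨t, y⟩ ⟨ht, hy⟩
      rw [Set.mem_singleton_iff] at ht
      simp only at ht hy
      subst ht
      refine ⟨⟨trivial, hKU hy⟩, ?_⟩
      change quartic (R y + (0 : ℝ) • S y) < 0
      rw [zero_smul, add_zero]
      exact hq y (hKU hy))
  obtain ⟨ε, hε, hεu⟩ := Metric.isOpen_iff.1 hu 0 (h0u rfl)
  have hsub : Metric.closedBall (0 : ℝ) (ε / 2) ×ˢ K ⊆ V := fun z hz =>
    huv ⟨hεu (Metric.closedBall_subset_ball (by linarith) hz.1), hKv hz.2⟩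
  let G : ℝ × V6 → ℝ := fun z => χ z.2 * (1 / 2 * pr (hatE (RS z)) (S z.2))
  have hG : ContinuousOn G V := by
    refine ContinuousOn.mul (hχ.comp continuousOn_snd fun z hz => (hVU hz).2)
      (continuousOn_const.mul ?_)
    exact (((hRS.mono hVU).hatE fun z hz => hz.2).pr ((hS.comp hsnd hmaps).mono hVU)).continuousOn
  -- The `t`-derivative of the integrand is continuous on a compact product, which provides a
  -- constant dominating function.
  obtain ⟨C, hC⟩ := ((isCompact_closedBall (0 : ℝ) (ε / 2)).prod hK).exists_bound_of_continuousOn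
    (hG.mono hsub)
  have hball : Metric.ball (0 : ℝ) (ε / 2) ⊆ Metric.closedBall 0 (ε / 2) :=
    Metric.ball_subset_closedBall
  have hpair : ∀ t : ℝ, ContinuousOn (fun y : V6 => (t, y)) K := fun t =>
    continuousOn_const.prodMk continuousOn_id
  have hF : ∀ t, ContinuousOn (fun y => χ y * Real.sqrt (-quartic (R y + t • S y) / 3)) K :=
    fun t => (hχ.mono hKU).mul (Real.continuous_sqrt.comp_continuousOn
      ((hRS.quartic.continuousOn.comp (hpair t) fun y hy => ⟨trivial, hKU hy⟩).neg.div_const 3))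
  have key := hasDerivAt_integral_of_dominated_loc_of_deriv_le (μ := volume.restrict K)
    (F := fun t y => χ y * Real.sqrt (-quartic (R y + t • S y) / 3))
    (F' := fun t y => χ y * (1 / 2 * pr (hatE (R y + t • S y)) (S y)))
    (x₀ := (0 : ℝ)) (s := Metric.ball 0 (ε / 2)) (bound := fun _ => C)
    (Metric.ball_mem_nhds 0 (by linarith))
    (.of_forall fun t => (hF t).aestronglyMeasurable hK.measurableSet)
    ((hF 0).integrableOn_compact hK)
    (ContinuousOn.aestronglyMeasurable (hG.comp (hpair 0) fun y hy =>
      hsub ⟨Metric.mem_closedBall_self (by linarith), hy⟩) hK.measurableSet)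
    ((ae_restrict_iff' hK.measurableSet).2 (.of_forall fun y hy t ht =>
      hC (t, y) ⟨hball ht, hy⟩))
    (integrableOn_const hK.measure_lt_top.ne)
    ((ae_restrict_iff' hK.measurableSet).2 (.of_forall fun y hy t ht =>
      (hasDerivAt_sqrt_quartic_line (hsub ⟨hball ht, hy⟩ : ((t, y) : ℝ × V6) ∈ V).2).const_mul (χ y)))
  simpa only [zero_smul, add_zero] using key.2

end Analysis

/-! ### Integration over the manifold, the first variation and Stokes' theorem -/

section Integration

variable {M : Type*} [TopologicalSpace M] [ChartedSpace V6 M]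

theorem locRep_add (α β : MixedForm M) (x₀ : M) (y : V6) :
    locRep (α + β) x₀ y = locRep α x₀ y + locRep β x₀ y := map_add _ _ _

theorem locRep_smul (f : M → ℝ) (α : MixedForm M) (x₀ : M) (y : V6) :
    locRep (fun x => f x • α x) x₀ y =
      f ((extChartAt (𝓡 6) x₀).symm y) • locRep α x₀ y := map_smul _ _ _

theorem locRep_sum {ι : Type*} (s : Finset ι) (α : ι → MixedForm M) (x₀ : M) (y : V6) :
    locRep (∑ j ∈ s, α j) x₀ y = ∑ j ∈ s, locRep (α j) x₀ y := by
  rw [locRep, Finset.sum_apply, map_sum]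
  rfl

theorem image_chart_subset {i : M} {C : Set M} (h : C ⊆ (extChartAt (𝓡 6) i).source) :
    extChartAt (𝓡 6) i '' C ⊆ (extChartAt (𝓡 6) i).target := by
  rintro _ ⟨x, hx, rfl⟩
  exact (extChartAt (𝓡 6) i).map_source (h hx)

theorem symm_notMem {i : M} {C : Set M} {y : V6} (hy : y ∈ (extChartAt (𝓡 6) i).target)
    (h : y ∉ extChartAt (𝓡 6) i '' C) : (extChartAt (𝓡 6) i).symm y ∉ C := fun hC =>
  h ⟨_, hC, (extChartAt (𝓡 6) i).right_inv hy⟩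

theorem isCompact_image_chart [CompactSpace M] {i : M} {C : Set M} (hC : IsClosed C)
    (h : C ⊆ (extChartAt (𝓡 6) i).source) : IsCompact (extChartAt (𝓡 6) i '' C) :=
  hC.isCompact.image_of_continuousOn ((continuousOn_extChartAt i).mono h)

theorem IsSmoothMixed.sum {ι : Type*} {s : Finset ι} {α : ι → MixedForm M}
    (h : ∀ j ∈ s, IsSmoothMixed (α j)) : IsSmoothMixed (∑ j ∈ s, α j) := by
  rw [isSmoothMixed_iff]
  exact fun x₀ => (SmoothOn.sum fun j hj => (isSmoothMixed_iff _).1 (h j hj) x₀).congr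
    fun y _ => locRep_sum s α x₀ y

variable [IsManifold (𝓡 6) ∞ M]

theorem jac_self (x : M) : jac x (extChartAt (𝓡 6) x x) = ContinuousLinearMap.id ℝ V6 := by
  rw [jac_eq (mem_extChartAt_target x), extChartAt_to_inv,
    fderiv_tau_self (mem_extChartAt_target x)]

theorem locRep_self (ρ : MixedForm M) (x : M) : locRep ρ x (extChartAt (𝓡 6) x x) = ρ x := by
  rw [locRep, jac_self, extChartAt_to_inv, pull_id]

theorem contDiffOn_comp_symm {f : M → ℝ} (hf : ContMDiff (𝓡 6) 𝓘(ℝ, ℝ) ∞ f) (x₀ : M) :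
    ContDiffOn ℝ ∞ (fun y => f ((extChartAt (𝓡 6) x₀).symm y)) (extChartAt (𝓡 6) x₀).target :=
  contMDiffOn_iff_contDiffOn.1 (hf.comp_contMDiffOn (contMDiffOn_extChartAt_symm x₀))

theorem IsSmoothMixed.smul {f : M → ℝ} (hf : ContMDiff (𝓡 6) 𝓘(ℝ, ℝ) ∞ f) {α : MixedForm M}
    (hα : IsSmoothMixed α) : IsSmoothMixed (fun x => f x • α x : MixedForm M) := by
  rw [isSmoothMixed_iff] at hα ⊢
  exact fun x₀ => (SmoothOn.smul (contDiffOn_comp_symm hf x₀) (hα x₀)).congr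
    fun y _ => locRep_smul f α x₀ y

theorem dL_congr {R S : V6 → Mixed ℝ} {y : V6} (h : R =ᶠ[nhds y] S) : dL R y = dL S y := by
  funext k
  cases k with
  | zero => rfl
  | succ k =>
    exact Filter.EventuallyEq.extDeriv_eq (h.mono fun z hz => congrFun hz k)

theorem dL_sum {ι : Type*} {s : Finset ι} {R : ι → V6 → Mixed ℝ} {y : V6}
    (h : ∀ j ∈ s, ∀ k, DifferentiableAt ℝ (fun z => R j z k) y) :
    dL (fun z => ∑ j ∈ s, R j z) y = ∑ j ∈ s, dL (R j) y := by
  funext k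
  rw [Finset.sum_apply]
  cases k with
  | zero =>
    simp only [dL, Finset.sum_const_zero]
  | succ k =>
    change ContinuousAlternatingMap.alternatizeUncurryFinCLM ℝ V6 ℝ _ =
      ∑ j ∈ s, ContinuousAlternatingMap.alternatizeUncurryFinCLM ℝ V6 ℝ _
    rw [← map_sum]
    simp only [Finset.sum_apply]
    rw [fderiv_fun_sum fun j hj => h j hj k]

theorem twistedD_sum {H : Form M 3} {ι : Type*} {s : Finset ι} {α : ι → MixedForm M}
    (h : ∀ j ∈ s, IsSmoothMixed (α j)) :
    twistedD H (∑ j ∈ s, α j) = ∑ j ∈ s, twistedD H (α j) := by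
  funext x
  have hx := mem_extChartAt_target (I := 𝓡 6) x
  rw [← locRep_self (twistedD H _) x, ← locRep_self (∑ j ∈ s, twistedD H (α j)) x, locRep_sum,
    locRep_twistedD (IsSmoothMixed.sum h) hx, Finset.sum_congr rfl fun j hj =>
      locRep_twistedD (h j hj) hx, Finset.sum_add_distrib, locRep_sum, map_sum]
  congr 1
  rw [← dL_sum fun j hj => ((isSmoothMixed_iff _).1 (h j hj) x).differentiableAt (isOpen_target x) hx]
  congr 1
  funext z
  exact locRep_sum s α x z

theorem twistedD_eq_zero {H : Form M 3} {α : MixedForm M} (hα : IsSmoothMixed α) {C : Set M}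
    (hC : IsClosed C) (h0 : ∀ x ∉ C, α x = 0) {x : M} (hx : x ∉ C) : twistedD H α x = 0 := by
  have hx' := mem_extChartAt_target (I := 𝓡 6) x
  rw [← locRep_self (twistedD H _) x, locRep_twistedD hα hx', locRep_self, h0 x hx, map_zero,
    add_zero]
  have : locRep α x =ᶠ[nhds (extChartAt (𝓡 6) x x)] fun _ => 0 := by
    have hc := continuousAt_extChartAt_symm (I := 𝓡 6) x
    have hn : Cᶜ ∈ nhds ((extChartAt (𝓡 6) x).symm (extChartAt (𝓡 6) x x)) := by
      rw [extChartAt_to_inv]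
      exact hC.isOpen_compl.mem_nhds hx
    filter_upwards [hc hn] with z hz
    rw [locRep, h0 _ hz, map_zero]
  rw [dL_congr this]
  -- Additivity over the empty set of summands yields `d 0 = 0`.
  have h2 := dL_sum (s := (∅ : Finset ℕ)) (R := fun _ _ => (0 : Mixed ℝ))
    (y := extChartAt (𝓡 6) x x) (by simp)
  simpa using h2

variable [CompactSpace M] [T2Space M]

theorem chartPartition_subordinate (i : M) :
    tsupport (chartPartition M i) ⊆ (extChartAt (𝓡 6) i).source := by
  rw [extChartAt_source]
  exact (SmoothPartitionOfUnity.exists_isSubordinate_chartAt_source (𝓡 6) M).choose_spec i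

variable (M) in
theorem finite_chartPartition :
    {i : M | (Function.support (chartPartition M i)).Nonempty}.Finite :=
  (chartPartition M).locallyFinite.finite_nonempty_of_compact

variable (M) in
/-- The indices of the non-zero functions of the partition of unity. -/
def partIdx : Finset M := (finite_chartPartition M).toFinset

theorem chartPartition_eq_zero {i : M} (hi : i ∉ partIdx M) (x : M) : chartPartition M i x = 0 := by
  by_contra h
  exact hi ((finite_chartPartition M).mem_toFinset.2 ⟨x, h⟩)

theorem sum_chartPartition (x : M) : ∑ i ∈ partIdx M, chartPartition M i x = 1 := by
  rw [← (chartPartition M).sum_eq_one (Set.mem_univ x)]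
  refine (finsum_eq_sum_of_support_subset _ fun i hi => ?_).symm
  by_contra h
  exact hi (chartPartition_eq_zero h x)

theorem volumeFunctional_eq (hM : OrientedAtlas M) (ρ : MixedForm M) :
    volumeFunctional ρ = ∑ i ∈ partIdx M, ∫ y in (extChartAt (𝓡 6) i).target,
      chartPartition M i ((extChartAt (𝓡 6) i).symm y) *
        Real.sqrt (-quartic (locRep ρ i y) / 3) := by
  unfold volumeFunctional GenCY.integral
  rw [finsum_eq_sum_of_support_subset (s := partIdx M)]
  · refine Finset.sum_congr rfl fun i _ => ?_
    refine setIntegral_congr_fun (isOpen_target i).measurableSet fun y hy => ?_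
    beta_reduce
    rw [chartRep_phi hM ρ hy]
  · intro i hi
    by_contra h
    refine hi ?_
    simp [chartPartition_eq_zero h]

/-- The integral over `M` of the pairing of two mixed forms. -/
def prInt (α β : MixedForm M) : ℝ :=
  ∑ i ∈ partIdx M, ∫ y in (extChartAt (𝓡 6) i).target,
    chartPartition M i ((extChartAt (𝓡 6) i).symm y) * pr (locRep α i y) (locRep β i y)

/-- The partition of unity reduces the functional to finitely many chart integrals with compactly
supported cutoffs, each differentiated under the integral sign; in each chart `ρ̂` is given by the
explicit formula. -/
theorem hasDerivAt_volumeFunctional (hM : OrientedAtlas M) {p : ZMod 2} {ρ σ : MixedForm M}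
    (hρ : IsOmega p ρ) (hs : IsStable ρ) (hσ : IsSmoothMixed σ) :
    HasDerivAt (fun t : ℝ => volumeFunctional (ρ + t • σ)) (1 / 2 * prInt (hatForm ρ) σ) 0 := by
  simp only [volumeFunctional_eq hM]
  rw [prInt, Finset.mul_sum]
  refine HasDerivAt.fun_sum fun i _ => ?_
  have hsub := chartPartition_subordinate i
  have h := hasDerivAt_setIntegral_sqrt_quartic (isOpen_target i)
    ((isSmoothMixed_iff ρ).1 hρ.1 i) ((isSmoothMixed_iff σ).1 hσ i)
    (fun y hy => quartic_locRep_neg hM hs hy)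
    (contDiffOn_comp_symm (chartPartition M i).contMDiff i).continuousOn
    (isCompact_image_chart (isClosed_tsupport _) hsub) (image_chart_subset hsub)
    (fun y hy h => image_eq_zero_of_notMem_tsupport (symm_notMem hy h))
  have h1 : ∀ (t : ℝ) y, locRep (ρ + t • σ) i y = locRep ρ i y + t • locRep σ i y := fun t y => by
    rw [locRep_add]
    exact congrArg _ (locRep_smul (fun _ => t) σ i y)
  simp only [h1]
  refine h.congr_deriv ?_
  rw [← integral_const_mul]
  refine setIntegral_congr_fun (isOpen_target i).measurableSet fun y hy => ?_
  beta_reduce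
  rw [locRep_hatForm hM hρ.2 hs hy]
  ring

theorem integrableOn_part {α β : MixedForm M} (hα : IsSmoothMixed α) (hβ : IsSmoothMixed β) (i : M) :
    IntegrableOn (fun y => chartPartition M i ((extChartAt (𝓡 6) i).symm y) *
      pr (locRep α i y) (locRep β i y)) (extChartAt (𝓡 6) i).target := by
  have hsub := chartPartition_subordinate i
  refine integrableOn_of_eq_zero (isOpen_target i)
    (isCompact_image_chart (isClosed_tsupport _) hsub) (image_chart_subset hsub) ?_ ?_
  · exact (contDiffOn_comp_symm (chartPartition M i).contMDiff i).continuousOn.mul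
      (((isSmoothMixed_iff α).1 hα i).pr ((isSmoothMixed_iff β).1 hβ i)).continuousOn
  · intro y hy h
    rw [image_eq_zero_of_notMem_tsupport (symm_notMem hy h), zero_mul]

theorem prInt_sum_left {ι : Type*} {s : Finset ι} {α : ι → MixedForm M} {β : MixedForm M}
    (hα : ∀ j ∈ s, IsSmoothMixed (α j)) (hβ : IsSmoothMixed β) :
    prInt (∑ j ∈ s, α j) β = ∑ j ∈ s, prInt (α j) β := by
  simp only [prInt]
  rw [Finset.sum_comm]
  refine Finset.sum_congr rfl fun i _ => ?_
  rw [← integral_finsetSum _ fun j hj => integrableOn_part (hα j hj) hβ i]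
  simp only [locRep_sum, map_sum, LinearMap.sum_apply, Finset.mul_sum]

theorem prInt_skew (α β : MixedForm M) : prInt α β = -prInt β α := by
  simp only [prInt]
  rw [← Finset.sum_neg_distrib]
  refine Finset.sum_congr rfl fun i _ => ?_
  rw [← integral_neg]
  refine integral_congr_ae (.of_forall fun y => ?_)
  beta_reduce
  rw [pr_skew]
  ring

/-- The integral of a pairing supported in a chart can be computed in this chart. -/
theorem prInt_eq_setIntegral (hM : OrientedAtlas M) {α β : MixedForm M} (hα : IsSmoothMixed α)
    (hβ : IsSmoothMixed β) {j : M} {C : Set M} (hC : IsClosed C)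
    (hCj : C ⊆ (extChartAt (𝓡 6) j).source) (h0 : ∀ x ∉ C, α x = 0) :
    prInt α β = ∫ y in (extChartAt (𝓡 6) j).target, pr (locRep α j y) (locRep β j y) := by
  have hα0 : ∀ i y, (extChartAt (𝓡 6) i).symm y ∉ C → locRep α i y = 0 := fun i y hy => by
    rw [locRep, h0 _ hy, map_zero]
  -- Both integrals reduce to the overlap of the charts: the first because `α` is supported in chart
  -- `j`, the second because the partition function is supported in chart `i`. The pairing
  -- transforms by the Jacobian determinant, which is positive and so equals the factor in the
  -- change of variables.
  have h1 : ∀ i : M, ∫ y in (extChartAt (𝓡 6) i).target,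
      chartPartition M i ((extChartAt (𝓡 6) i).symm y) * pr (locRep α i y) (locRep β i y) =
      ∫ y in (extChartAt (𝓡 6) j).target,
        chartPartition M i ((extChartAt (𝓡 6) j).symm y) * pr (locRep α j y) (locRep β j y) := by
    intro i
    rw [setIntegral_eq_of_subset_of_forall_sdiff_eq_zero (isOpen_target i).measurableSet
      (overlap_subset_target i j) (fun y hy => by
        rw [hα0 i y fun hy' => hy.2 (mem_overlap.2 ⟨hy.1, hCj hy'⟩)]
        simp),
      setIntegral_eq_of_subset_of_forall_sdiff_eq_zero (isOpen_target j).measurableSet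
      (overlap_subset_target j i) (fun y hy => by
        rw [image_eq_zero_of_notMem_tsupport (fun hy' => hy.2 (mem_overlap.2
          ⟨hy.1, chartPartition_subordinate i hy'⟩)), zero_mul])]
    have himg : overlap j i = tau i j '' overlap i j := by
      ext z
      refine ⟨fun hz => ⟨tau j i z, tau_mem hz, ?_⟩, ?_⟩
      · rw [tau_tau hz, tau_self (overlap_subset_target _ _ hz)]
      · rintro ⟨y, hy, rfl⟩
        exact tau_mem hy
    have hinj : Set.InjOn (tau i j) (overlap i j) := fun y hy z hz h => by
      rw [← tau_self (overlap_subset_target _ _ hy), ← tau_tau hy, h, tau_tau hz,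
        tau_self (overlap_subset_target _ _ hz)]
    rw [himg, integral_image_eq_integral_abs_det_fderiv_smul volume
      (isOpen_overlap i j).measurableSet
      (fun y hy => (differentiableAt_tau hy).hasFDerivAt.hasFDerivWithinAt) hinj]
    refine setIntegral_congr_fun (isOpen_overlap i j).measurableSet fun y hy => ?_
    beta_reduce
    rw [locRep_tau α hy, locRep_tau β hy, pr_pull, symm_tau hy,
      abs_of_pos (det_fderiv_tau_pos hM hy), smul_eq_mul]
    ring
  -- All terms now live in chart `j`, where the partition functions add up to one.
  rw [prInt, Finset.sum_congr rfl fun i _ => h1 i, ← integral_finsetSum]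
  · refine setIntegral_congr_fun (isOpen_target j).measurableSet fun y hy => ?_
    beta_reduce
    rw [← Finset.sum_mul, sum_chartPartition, one_mul]
  · intro i _
    refine integrableOn_of_eq_zero (isOpen_target j) (isCompact_image_chart hC hCj)
      (image_chart_subset hCj) ?_ ?_
    · exact (contDiffOn_comp_symm (chartPartition M i).contMDiff j).continuousOn.mul
        (((isSmoothMixed_iff α).1 hα j).pr ((isSmoothMixed_iff β).1 hβ j)).continuousOn
    · intro y hy h
      rw [hα0 j y (symm_notMem hy h)]
      simp

/-- Stokes' theorem for the pairing. -/
theorem prInt_twistedD (hM : OrientedAtlas M) {H : Form M 3} (hH : IsSmooth H) {α β : MixedForm M}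
    (hα : IsSmoothMixed α) (hβ : IsSmoothMixed β) :
    prInt (twistedD H α) β + prInt α (twistedD H β) = 0 := by
  -- Only `α` is cut into pieces supported in single charts; `β` stays whole.
  let A : M → MixedForm M := fun j x => chartPartition M j x • α x
  have hA : ∀ j, IsSmoothMixed (A j) := fun j => hα.smul (chartPartition M j).contMDiff
  have hsum : α = ∑ j ∈ partIdx M, A j := by
    funext x
    rw [Finset.sum_apply, ← Finset.sum_smul, sum_chartPartition, one_smul]
  rw [hsum, twistedD_sum fun j _ => hA j, prInt_sum_left (fun j _ => (hA j).twistedD hH) hβ,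
    prInt_sum_left (fun j _ => hA j) (hβ.twistedD hH), ← Finset.sum_add_distrib]
  refine Finset.sum_eq_zero fun j _ => ?_
  have hCj := chartPartition_subordinate j
  have hC := isClosed_tsupport (chartPartition M j)
  have h0 : ∀ x ∉ tsupport (chartPartition M j), A j x = 0 := fun x hx => by
    simp only [A]
    rw [image_eq_zero_of_notMem_tsupport hx, zero_smul]
  have h0' : ∀ x ∉ tsupport (chartPartition M j), twistedD H (A j) x = 0 := fun x hx =>
    twistedD_eq_zero (hA j) hC h0 hx
  rw [prInt_eq_setIntegral hM ((hA j).twistedD hH) hβ hC hCj h0',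
    prInt_eq_setIntegral hM (hA j) (hβ.twistedD hH) hC hCj h0]
  have hR := (isSmoothMixed_iff _).1 (hA j) j
  have hS := (isSmoothMixed_iff β).1 hβ j
  have hdR := (isSmoothMixed_iff _).1 ((hA j).twistedD hH) j
  have hdS := (isSmoothMixed_iff _).1 (hβ.twistedD hH) j
  have hK := isCompact_image_chart hC hCj
  have hKU := image_chart_subset hCj
  rw [← integral_add
    (integrableOn_of_eq_zero (isOpen_target j) hK hKU (hdR.pr hS).continuousOn fun y hy h => by
      rw [locRep, h0' _ (symm_notMem hy h)]
      simp)
    (integrableOn_of_eq_zero (isOpen_target j) hK hKU (hR.pr hdS).continuousOn fun y hy h => by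
      rw [locRep, h0 _ (symm_notMem hy h)]
      simp)]
  -- The local Stokes formula needs a form that vanishes off `K` on all of `ℝ⁶`, whereas the chart
  -- expression is meaningful only on the target of the chart.
  let R : V6 → Mixed ℝ := (extChartAt (𝓡 6) j).target.indicator (locRep (A j) j)
  have hRe : ∀ y ∈ (extChartAt (𝓡 6) j).target, R y = locRep (A j) j y := fun y hy =>
    Set.indicator_of_mem hy _
  rw [← setIntegral_pr_dL (isOpen_target j) (hR.congr hRe) hS hK hKU fun y hy => by
    by_cases hyt : y ∈ (extChartAt (𝓡 6) j).target
    · rw [hRe y hyt, locRep, h0 _ (symm_notMem hyt hy), map_zero]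
    · exact Set.indicator_of_notMem hyt _]
  refine setIntegral_congr_fun (isOpen_target j).measurableSet fun y hy => ?_
  have hdR' : dL R y = dL (locRep (A j) j) y := dL_congr (by
    filter_upwards [(isOpen_target j).mem_nhds hy] with z hz using hRe z hz)
  beta_reduce
  -- The two terms containing `H` cancel by `pr_wm_three`.
  rw [locRep_twistedD (hA j) hy, locRep_twistedD hβ hy, hdR', hRe y hy, map_add, map_add,
    LinearMap.add_apply, pr_wm_three]
  ring

end Integration

end GenCY
end

noncomputable section
namespace GenCY

open MeasureTheory

/-! ### Parity of forms under the pairing and the twisted differential -/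

section Parity

theorem zmod_two_ne {a b : ZMod 2} (h : a ≠ b) : a = b + 1 := by
  revert a b; decide

theorem pr_eq_zero_of_parity {p : ZMod 2} {φ ψ : Mixed ℝ} (hφ : HasParity p φ)
    (hψ : HasParity (p + 1) ψ) : pr φ ψ = 0 := by
  rw [pr_apply, pairing_eq_sum]
  refine Finset.sum_eq_zero fun k _ => ?_
  by_cases hk : ((k : ℕ) : ZMod 2) = p
  · rw [hψ (6 - k), wedge_zero_right]
    · simp
    · rw [Nat.cast_sub (Nat.lt_succ_iff.1 k.isLt), hk]
      clear hφ hψ hk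
      revert p
      decide
  · rw [hφ _ hk, wedge_zero_left]
    simp

/-- The part of a mixed form of parity `p`. -/
def parPart (p : ZMod 2) (φ : Mixed ℝ) : Mixed ℝ := fun k => if (k : ZMod 2) = p then φ k else 0

theorem hasParity_parPart (p : ZMod 2) (φ : Mixed ℝ) : HasParity p (parPart p φ) :=
  fun _ hk => if_neg hk

theorem pr_parPart {p : ZMod 2} {γ : Mixed ℝ} (hγ : HasParity p γ) (φ : Mixed ℝ) :
    pr φ γ = pr (parPart p φ) γ := by
  have h : HasParity (p + 1) (φ - parPart p φ) := fun k hk => by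
    have hkp : (k : ZMod 2) = p := by
      by_contra h
      exact hk (zmod_two_ne h)
    simp [parPart, hkp]
  have h1 := pr_eq_zero_of_parity hγ h
  rw [pr_skew, map_sub, LinearMap.sub_apply] at h1
  linarith

theorem HasParity.wm_three {p : ZMod 2} {φ : Mixed ℝ} (hφ : HasParity p φ)
    (a : V6 [⋀^Fin 3]→L[ℝ] ℝ) : HasParity (p + 1) (wm a φ) := fun n hn => by
  rw [wm_apply]
  by_cases h : 3 ≤ n
  · rw [wedgeMixed_apply (Nat.add_sub_of_le h), hφ, wedge_zero_right]
    intro h'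
    apply hn
    rw [← h', Nat.cast_sub h]
    generalize (n : ZMod 2) = m
    revert m
    decide
  · exact wedgeMixed_apply_of_lt (not_le.1 h) _ _

variable {M : Type*} [TopologicalSpace M] [ChartedSpace V6 M]

theorem hasParity_twistedD {p : ZMod 2} {α : MixedForm M} (hα : ∀ x, HasParity p (α x))
    (H : Form M 3) (x : M) : HasParity (p + 1) (twistedD H α x) := by
  refine HasParity.add (fun k hk => ?_) ((hα x).wm_three (H x))
  cases k with
  | zero => rfl
  | succ k =>
    have h : α.comp k = 0 := by
      funext z
      refine hα z k fun h => hk ?_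
      rw [Nat.cast_succ, h]
    change extD (α.comp k) x = 0
    have h1 : chartRep (α.comp k) x = fun _ => 0 := by
      rw [h]
      rfl
    have h2 : extDeriv (chartRep (α.comp k) x) (extChartAt (𝓡 6) x x) = 0 := by
      rw [h1, extDeriv, fderiv_const_apply]
      exact map_zero (ContinuousAlternatingMap.alternatizeUncurryFinCLM ℝ V6 ℝ)
    rw [extD, h2]
    rfl

end Parity

/-! ### Test forms supported in a chart and nondegeneracy of the integrated pairing -/

section TestForms

variable {M : Type*} [TopologicalSpace M] [ChartedSpace V6 M]

open Classical in
/-- The form with expression `g φ` in the chart at `x₀`, extended by zero. -/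
def testForm (x₀ : M) (g : V6 → ℝ) (φ : Mixed ℝ) : MixedForm M := fun x =>
  if x ∈ (extChartAt (𝓡 6) x₀).source then
    pull (fderiv ℝ (tau x x₀) (extChartAt (𝓡 6) x x)) (g (extChartAt (𝓡 6) x₀ x) • φ)
  else 0

variable {x₀ : M} {g : V6 → ℝ} {φ : Mixed ℝ}

theorem HasParity.testForm {p : ZMod 2} (hφ : HasParity p φ) (x₀ : M) (g : V6 → ℝ) (x : M) :
    HasParity p (testForm x₀ g φ x) := by
  rw [GenCY.testForm]
  split_ifs
  · exact (hφ.smul _).pull _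
  · exact fun _ _ => rfl

theorem testForm_eq_zero {x : M} (hx : x ∉ (extChartAt (𝓡 6) x₀).symm '' tsupport g) :
    testForm x₀ g φ x = 0 := by
  rw [testForm]
  split_ifs with h
  · have h0 : g (extChartAt (𝓡 6) x₀ x) = 0 := image_eq_zero_of_notMem_tsupport
      fun h' => hx ⟨_, h', (extChartAt (𝓡 6) x₀).left_inv h⟩
    rw [h0, zero_smul, map_zero]
  · rfl

theorem isClosed_image_symm [T2Space M] (hc : HasCompactSupport g)
    (hs : tsupport g ⊆ (extChartAt (𝓡 6) x₀).target) :
    IsClosed ((extChartAt (𝓡 6) x₀).symm '' tsupport g) :=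
  (hc.isCompact.image_of_continuousOn ((continuousOn_extChartAt_symm x₀).mono hs)).isClosed

theorem image_symm_subset (hs : tsupport g ⊆ (extChartAt (𝓡 6) x₀).target) :
    (extChartAt (𝓡 6) x₀).symm '' tsupport g ⊆ (extChartAt (𝓡 6) x₀).source := by
  rintro _ ⟨y, hy, rfl⟩
  exact (extChartAt (𝓡 6) x₀).map_target (hs hy)

variable [IsManifold (𝓡 6) ∞ M]

theorem locRep_testForm {y : V6} (hy : y ∈ (extChartAt (𝓡 6) x₀).target) :
    locRep (testForm x₀ g φ) x₀ y = g y • φ := by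
  have h := mem_overlap_symm hy
  rw [locRep, testForm, if_pos ((extChartAt (𝓡 6) x₀).map_target hy), pull_pull, jac_eq hy,
    (extChartAt (𝓡 6) x₀).right_inv hy]
  have h2 := fderiv_tau_comp h (target_subset_overlap x₀ hy)
  rw [fderiv_tau_self hy] at h2
  change pull ((fderiv ℝ (tau _ x₀) (tau x₀ _ y)).comp _) _ = _
  rw [← h2, pull_id]

/-- In another chart the form is a smooth pullback on the overlap and zero off the image of the
support of `g`. That image is compact, hence closed as `M` is Hausdorff, so these two open sets
cover the chart. -/
theorem isSmoothMixed_testForm [T2Space M] (hg : ContDiff ℝ ∞ g) (hc : HasCompactSupport g)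
    (hs : tsupport g ⊆ (extChartAt (𝓡 6) x₀).target) (φ : Mixed ℝ) :
    IsSmoothMixed (testForm x₀ g φ) := by
  rw [isSmoothMixed_iff]
  intro x₁
  have hC := isClosed_image_symm hc hs
  have hCs := image_symm_subset hs
  set C := (extChartAt (𝓡 6) x₀).symm '' tsupport g
  have hO : IsOpen ((extChartAt (𝓡 6) x₁).target ∩ (extChartAt (𝓡 6) x₁).symm ⁻¹' Cᶜ) :=
    (continuousOn_extChartAt_symm x₁).isOpen_inter_preimage (isOpen_target x₁) hC.isOpen_compl
  have h1 : SmoothOn (locRep (testForm x₀ g φ) x₁) (overlap x₁ x₀) := by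
    have hτ := contDiffOn_tau x₁ x₀
    refine SmoothOn.congr (R := fun y => pull (fderiv ℝ (tau x₁ x₀) y) (g (tau x₁ x₀ y) • φ))
      (SmoothOn.pull (SmoothOn.smul (hg.comp_contDiffOn hτ) (smoothOn_const φ))
        (hτ.fderiv_of_isOpen (m := ∞) (isOpen_overlap _ _) (by simp))) fun y hy => ?_
    rw [locRep_tau _ hy, locRep_testForm (overlap_subset_target _ _ (tau_mem hy))]
  have h2 : SmoothOn (locRep (testForm x₀ g φ) x₁)
      ((extChartAt (𝓡 6) x₁).target ∩ (extChartAt (𝓡 6) x₁).symm ⁻¹' Cᶜ) :=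
    (smoothOn_const 0).congr fun y hy => by
      rw [locRep, testForm_eq_zero hy.2, map_zero]
  refine SmoothOn.mono (fun k => (h1 k).union_of_isOpen (h2 k) (isOpen_overlap _ _) hO)
    fun y hy => ?_
  by_cases h : (extChartAt (𝓡 6) x₁).symm y ∈ C
  · exact Or.inl (mem_overlap.2 ⟨hy, hCs h⟩)
  · exact Or.inr ⟨hy, h⟩

/-- The pairing of smooth forms of a given parity is non-degenerate. -/
theorem eq_zero_of_prInt [CompactSpace M] [T2Space M] (hM : OrientedAtlas M) {p : ZMod 2}
    {γ : MixedForm M} (hγ : IsOmega p γ) (h : ∀ α, IsOmega p α → prInt γ α = 0) : γ = 0 := by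
  funext x₀
  have hx₀ := mem_extChartAt_target (I := 𝓡 6) x₀
  rw [← locRep_self γ x₀]
  have hpar : HasParity p (locRep γ x₀ (extChartAt (𝓡 6) x₀ x₀)) := (hγ.2 _).pull _
  refine pr_nondeg fun φ => ?_
  -- Only the part of `φ` of parity `p` pairs with `γ`; with it the test forms are admissible in the
  -- hypothesis.
  rw [pr_skew, pr_parPart hpar, neg_eq_zero]
  have hcont : ContinuousOn (fun y => pr (parPart p φ) (locRep γ x₀ y))
      (extChartAt (𝓡 6) x₀).target :=
    ((smoothOn_const _).pr ((isSmoothMixed_iff γ).1 hγ.1 x₀)).continuousOn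
  -- The fundamental lemma of the calculus of variations gives vanishing almost everywhere in the
  -- chart; continuity then gives it at the point `x₀`.
  have hae := (isOpen_target x₀).ae_eq_zero_of_integral_contDiff_smul_eq_zero
    (μ := (volume : Measure V6))
    (hcont.locallyIntegrableOn (isOpen_target x₀).measurableSet) fun g hg hc hs => by
      have h1 := h (testForm x₀ g (parPart p φ)) ⟨isSmoothMixed_testForm hg hc hs _,
        (hasParity_parPart p φ).testForm x₀ g⟩
      rw [prInt_skew, neg_eq_zero, prInt_eq_setIntegral hM (isSmoothMixed_testForm hg hc hs _) hγ.1
        (isClosed_image_symm hc hs) (image_symm_subset hs) fun x hx => testForm_eq_zero hx] at h1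
      rw [← setIntegral_eq_integral_of_forall_compl_eq_zero
        (s := (extChartAt (𝓡 6) x₀).target), ← h1]
      · refine setIntegral_congr_fun (isOpen_target x₀).measurableSet fun y hy => ?_
        beta_reduce
        rw [locRep_testForm hy, map_smul, LinearMap.smul_apply]
      · intro y hy
        rw [image_eq_zero_of_notMem_tsupport fun h' => hy (hs h'), zero_smul]
  exact Measure.eqOn_open_of_ae_eq ((ae_restrict_iff' (isOpen_target x₀).measurableSet).2 hae)
    (isOpen_target x₀) hcont continuousOn_const hx₀

end TestForms

end GenCY
end

/-! ### Critical points of the volume in a `d_H`-cohomology class -/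

theorem theorem2 {M : Type*} [TopologicalSpace M] [ChartedSpace GenCY.V6 M]
    [IsManifold (𝓡 6) ∞ M] [CompactSpace M] [T2Space M]
    (hM : GenCY.OrientedAtlas M)
    (H : GenCY.Form M 3) (hH : GenCY.IsSmooth H) (hdH : GenCY.extD H = 0)
    (p : ZMod 2) (ρ : GenCY.MixedForm M) (hρ : GenCY.IsOmega p ρ)
    (hstable : GenCY.IsStable ρ) (hclosed : GenCY.twistedD H ρ = 0) :
    GenCY.IsCriticalInClass H p ρ ↔
      (GenCY.IsOmega p (GenCY.hatForm ρ) ∧ GenCY.twistedD H (GenCY.hatForm ρ) = 0) := by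
  have hhat := GenCY.isOmega_hatForm hM hρ hstable
  have hder := fun (α : GenCY.MixedForm M) (hα : GenCY.IsOmega (p + 1) α) =>
    GenCY.hasDerivAt_volumeFunctional hM hρ hstable (hα.1.twistedD hH)
  have hstokes : ∀ α, GenCY.IsOmega (p + 1) α → GenCY.prInt (GenCY.hatForm ρ)
      (GenCY.twistedD H α) = -GenCY.prInt (GenCY.twistedD H (GenCY.hatForm ρ)) α := fun α hα =>
    eq_neg_of_add_eq_zero_right (GenCY.prInt_twistedD hM hH hhat.1 hα.1)
  constructor
  · intro hcrit
    refine ⟨hhat, GenCY.eq_zero_of_prInt hM (p := p + 1)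
      ⟨hhat.1.twistedD hH, GenCY.hasParity_twistedD hhat.2 H⟩ fun α hα => ?_⟩
    -- Uniqueness of the derivative identifies the computed first variation with zero, so `d_H ρ̂`
    -- pairs to zero with every admissible `α`.
    have h := (hder α hα).unique (hcrit α hα)
    rw [hstokes α hα] at h
    linarith
  · rintro ⟨-, h0⟩ α hα
    refine (hder α hα).congr_deriv ?_
    rw [hstokes α hα, h0]
    have : GenCY.prInt (0 : GenCY.MixedForm M) α = 0 := by
      simp [GenCY.prInt, GenCY.locRep]
    rw [this]
    simp
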